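/- **Setting.** Let $\boldsymbol M$ (nodes) and $\boldsymbol P$ (chains) be finite sets. For $p\in\boldsymbol P$ let $n_p\in\mathbb N^*$, $\theta_p\in[0,1/n_p)$, $\mathcal D_p=\theta_p+\frac1{n_p}\mathbb Z$, and let $\mathcal Q=\{(p,k):p\in\boldsymbol P,\ k\in\mathcal D_p\}$. On a probability space $(\Omega,\mathcal F,\mathbb P)$ let $\pi^m$ ($m\in\boldsymbol M$) be Poisson random measures on $\mathbb R\times\mathbb R_+$ with Lebesgue intensity, all of whose atoms have distinct time coordinates, and let $\xi^p_k$ ($(p,k)\in\mathcal Q$) be real random variables such that $\xi^p_k$ and $\xi^p_{k+n}$ have the same law for all $n\in\mathbb Z$; all the $\pi^m$ and $\xi^p_k$ are mutually independent. Let $\mathcal F_t$ be generated by the restrictions of the $\pi^m$ to $(-\infty,t]\times\mathbb R_+$ and by the $\xi^p_k$ with $k\le t$, and let $\mathcal F_{t-}=\sigma(\bigcup_{s<t}\mathcal F_s)$. *Parameters* $\mathfrak M$ consist of real numbers $\mu_m$, Borel functions $h^\alpha_\beta:(0,\infty)\to\mathbb R$, Lipschitz functions $\kappa^\alpha_p:\mathbb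 R\to\mathbb R$, non-negative non-decreasing functions $\Phi^m:\mathbb R\to\mathbb R_+$, and Lipschitz functions $\Phi^p:\mathbb R\to\mathbb R$ with $\Phi^p(0)=0$ ($m\in\boldsymbol M$, $p\in\boldsymbol P$, $\alpha,\beta\in\boldsymbol M\cup\boldsymbol P$). One sets $\kappa^\alpha_p(\varnothing)=0$. Assumption (NoExpl) says that every $\Phi^m$ is Lipschitz and that $h^m_{m'},h^m_p,h^p_m\in L^1(0,\infty)$ for all $m,m'\in\boldsymbol M$, $p\in\boldsymbol P$. An *initial condition* at time $t_0\in\mathbb R$ is an $\mathcal F_{t_0-}$-measurable $\mathfrak C=((\mathfrak C^m)_m,(\mathfrak C^p_k)_{k<t_0})$ with pairwise disjoint random sets $\mathfrak C^m\subset(-\infty,t_0)$ and $\mathfrak C^p_k\in\mathbb R\cup\{\varnothing\}$. It is *integrable* if for some $K<\infty$ one has $\mathbb E[\mathrm{card}(\mathfrak C^m\cap B)]\le K$ for all $m$ and all intervals $B$ of length $1$, and $\mathbb E[\mathbf 1_{\mathfrak C^p_k\ne\varnothing}|\mathfrak C^p_k|]\le K$ for all $(p,k)\in\mathcal Q$ with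 $k<t_0$. A *HAR process* with parameters $\mathfrak M$ started at $t_0$ with initial condition $\mathfrak C$ is a triple $((\lambda^m)_m,(S^m)_m,(W^p)_p)$ of real-valued intensities on $[t_0,\infty)$, pairwise disjoint random point sets in $\mathbb R$, and chains $W^p=(W^p_k)_{k\in\mathcal D_p}$ with values in $\mathbb R\cup\{\varnothing\}$, adapted to $(\mathcal F_t)_{t\ge t_0}$ and with $\lambda^m$ predictable, such that $S^m\cap(-\infty,t_0)=\mathfrak C^m$, $W^p_k=\mathfrak C^p_k$ for $k<t_0$, and $$\lambda^m_t=\Phi^m\Big(\mu_m+\sum_{m'}\int_{(-\infty,t)}h^m_{m'}(t-s)\,dS^{m'}_s+\sum_{p}\sum_{k\in\mathcal D_p,\,k<t}h^m_p(t-k)\kappa^m_p(W^p_k)\Big)\quad d\mathbb P\otimes dt\text{-a.e. on }\Omega\times[t_0,\infty),$$ $$S^m(B)=\int_{B\times\mathbb R_+}\mathbf 1_{x\le\lambda^m_s}\,d\pi^m(s,x)\quad\text{for all }B\subset[t_0,\infty),\ \text{a.s.},$$ $$W^p_k=\xi^p_k+\Phi^p\Big(\sum_{m}\int_{(-\infty,k)}h^p_m(k-s)\,dS^m_s+\sum_{p'}\sum_{k'\in\mathcal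 D_{p'},\,k'<k}h^p_{p'}(k-k')\kappa^p_{p'}(W^{p'}_{k'})\Big)\quad\text{for all }(p,k)\in\mathcal Q,\ k\ge t_0,\ \text{a.s.},$$ where all integrals and series are required to converge absolutely. It is *non-exploding* if a.s. every $S^m$ has finitely many points in every bounded set. Two such processes are *modifications* of each other if their intensities agree $d\mathbb P\otimes dt$-a.e. on $\Omega\times[t_0,\infty)$ and, a.s., their point sets and their chains agree. **Theorem (existence and uniqueness of non-exploding HAR processes).** Let $\mathfrak M$ satisfy (NoExpl) and let $\mathfrak C$ be an integrable initial condition at time $t_0$. Then any two non-exploding HAR processes with parameters $\mathfrak M$ started at $t_0$ with initial condition $\mathfrak C$ are modifications of each other. Such a process exists if (and only if) the contribution of $\mathfrak C$ to the chain equations is well defined, i.e. for all $(p,k)\in\mathcal Q$ with $k\ge t_0$, almost surely $$\int|h^p_m(k-s)|\,d\mathfrak C^m_s<\infty\ \ (m\in\boldsymbol M)\qquad\text{and}\qquad\sum_{k'\in\mathcal D_{p'},\,k'<t_0}|h^p_{p'}(k-k')|\,|\kappa^p_{p'}(\mathfrak C^{p'}_{k'})|<\infty\ \ (p'\in\boldsymbol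 P).$$ -/

import Mathlib

open MeasureTheory ProbabilityTheory Set

open scoped NNReal ENNReal

noncomputable section

namespace HAR

/-! Nodes are indexed by a finite type `M`, chains by a finite type `P`; an element `α : M ⊕ P`
is a node or a chain. -/

/-- The time embedding of the chains: chain `p` lives on `θ_p + (1 / n_p) ℤ`, with `n_p ≥ 1` and
`θ_p ∈ [0, 1 / n_p)`. -/
structure ChainGrid (P : Type*) where
  freq : P → ℕ
  freq_pos : ∀ p, 0 < freq p
  phase : P → ℝ
  phase_mem : ∀ p, phase p ∈ Ico (0 : ℝ) (1 / (freq p : ℝ))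

/-- The `j`-th time of chain `p`. The set of pairs (chain, time of this chain) is thus
parametrized bijectively by `P × ℤ`. -/
def ChainGrid.time {P : Type*} (G : ChainGrid P) (p : P) (j : ℤ) : ℝ :=
  G.phase p + (j : ℝ) / (G.freq p : ℝ)

/-- The parameters of a HAR process: base rates `μ`, interaction functions `h α β` (the function
`h^α_β`, evaluated at positive arguments only), masks `κ α p` (the function `κ^α_p`), node link
functions `Φnode` and chain link functions `Φchain`. That the node link functions are Lipschitz is
part of `Params.NoExpl`. -/
structure Params (M P : Type*) where
  μ : M → ℝ
  h : M ⊕ P → M ⊕ P → ℝ → ℝ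
  h_measurable : ∀ α β, Measurable (h α β)
  κ : M ⊕ P → P → ℝ → ℝ
  κ_lipschitz : ∀ α p, ∃ K : ℝ≥0, LipschitzWith K (κ α p)
  Φnode : M → ℝ → ℝ
  Φnode_nonneg : ∀ m x, 0 ≤ Φnode m x
  Φnode_mono : ∀ m, Monotone (Φnode m)
  Φchain : P → ℝ → ℝ
  Φchain_lipschitz : ∀ p, ∃ K : ℝ≥0, LipschitzWith K (Φchain p)
  Φchain_zero : ∀ p, Φchain p 0 = 0

/-- The assumption (NoExpl). -/
structure Params.NoExpl {M P : Type*} (𝔐 : Params M P) : Prop where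
  Φnode_lipschitz : ∀ m, ∃ K : ℝ≥0, LipschitzWith K (𝔐.Φnode m)
  node_node : ∀ m m', IntegrableOn (𝔐.h (.inl m) (.inl m')) (Ioi 0)
  node_chain : ∀ m p, IntegrableOn (𝔐.h (.inl m) (.inr p)) (Ioi 0)
  chain_node : ∀ p m, IntegrableOn (𝔐.h (.inr p) (.inl m)) (Ioi 0)

/-- The masks extended by `0` to the additional value `∅`, which is represented by `none`. -/
def Params.mask {M P : Type*} (𝔐 : Params M P) (α : M ⊕ P) (p : P) : Option ℝ → ℝ
  | none => 0
  | some x => 𝔐.κ α p x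

section Noise

variable {Ω M P : Type*}

/-- The number of points of the random set `A` in `B`. -/
def count {E : Type*} (A : Ω → Set E) (B : Set E) (ω : Ω) : ℕ∞ := (A ω ∩ B).encard

/-- The driving randomness: random sets of atoms `π m` of `ℝ × ℝ₊` and random drifts `ξ p j`, the
latter at time `G.time p j`. -/
structure Noise (Ω M P : Type*) where
  π : M → Ω → Set (ℝ × ℝ)
  ξ : P → ℤ → Ω → ℝ

/-- `A` is the set of atoms of a Poisson random measure on `ℝ × ℝ₊` with intensity the Lebesgue
measure. -/
structure IsPoisson [MeasurableSpace Ω] (Pr : Measure Ω) (A : Ω → Set (ℝ × ℝ)) : Prop where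
  subset : ∀ ω, A ω ⊆ univ ×ˢ Ici 0
  locallyFinite : ∀ ω B, Bornology.IsBounded B → (A ω ∩ B).Finite
  measurable : ∀ B, MeasurableSet B → Measurable (count A B)
  law : ∀ B, MeasurableSet B → volume (B ∩ univ ×ˢ Ici (0 : ℝ)) ≠ ∞ →
    Pr.map (count A B) =
      (poissonMeasure (volume (B ∩ univ ×ˢ Ici (0 : ℝ))).toNNReal).map (fun n : ℕ => (n : ℕ∞))
  indep : ∀ (n : ℕ) (B : Fin n → Set (ℝ × ℝ)), (∀ i, MeasurableSet (B i)) →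
    Pairwise (fun i j => Disjoint (B i) (B j)) → iIndepFun (fun i => count A (B i)) Pr

/-- The σ-algebra generated by a random set. -/
abbrev sigmaSet {E : Type*} [MeasurableSpace E] (A : Ω → Set E) : MeasurableSpace Ω :=
  ⨆ (B : Set E) (_ : MeasurableSet B), MeasurableSpace.comap (count A B) inferInstance

/-- The standing assumptions on the driving randomness. -/
structure Noise.IsDriving [MeasurableSpace Ω] (N : Noise Ω M P) (G : ChainGrid P)
    (Pr : Measure Ω) : Prop where
  poisson : ∀ m, IsPoisson Pr (N.π m)
  /-- All atoms of all the Poisson random measures have distinct time coordinates. -/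
  distinct : ∀ ω m m' s x x', (s, x) ∈ N.π m ω → (s, x') ∈ N.π m' ω → m = m' ∧ x = x'
  ξ_measurable : ∀ p j, Measurable (N.ξ p j)
  /-- The Poisson random measures and the random drifts are mutually independent. -/
  indep : iIndep (fun i : M ⊕ (P × ℤ) =>
    Sum.elim (fun m => sigmaSet (N.π m))
      (fun q => MeasurableSpace.comap (N.ξ q.1 q.2) inferInstance) i) Pr
  /-- Drifts of one chain whose times differ by an integer have the same law. -/
  ident : ∀ p (j n : ℤ), IdentDistrib (N.ξ p j) (N.ξ p (j + n * (G.freq p : ℤ))) Pr Pr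

/-- The σ-algebra `𝓕_t` generated by the Poisson random measures on `(-∞, t] × ℝ₊` and the random
drifts at times at most `t`. -/
abbrev Noise.filt (N : Noise Ω M P) (G : ChainGrid P) (t : ℝ) : MeasurableSpace Ω :=
  (⨆ m : M, sigmaSet (fun ω => N.π m ω ∩ Iic t ×ˢ univ)) ⊔
    ⨆ (p : P) (j : ℤ) (_ : G.time p j ≤ t), MeasurableSpace.comap (N.ξ p j) inferInstance

/-- The σ-algebra `𝓕_{t-}`. -/
abbrev Noise.filtLeft (N : Noise Ω M P) (G : ChainGrid P) (t : ℝ) : MeasurableSpace Ω :=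
  ⨆ (s : ℝ) (_ : s < t), N.filt G s

/-- The predictable σ-algebra, generated by the sets `(s, t] × A` with `A ∈ 𝓕_s`. -/
abbrev Noise.predictable (N : Noise Ω M P) (G : ChainGrid P) : MeasurableSpace (ℝ × Ω) :=
  MeasurableSpace.generateFrom
    {R | ∃ (s t : ℝ) (A : Set Ω), s < t ∧ MeasurableSet[N.filt G s] A ∧ R = Ioc s t ×ˢ A}

/-- Measurability of a random element of `ℝ ∪ {∅}`, a disjoint union of measurable spaces. -/
def OptMeasurable (𝓕 : MeasurableSpace Ω) (V : Ω → Option ℝ) : Prop :=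
  Measurable[𝓕] (fun ω => Equiv.optionEquivSumPUnit.{0} ℝ (V ω))

/-- An initial condition at time `t₀`: points of the nodes before `t₀` and values in `ℝ ∪ {∅}` of
the chains before `t₀`. By convention `chain p j` is `∅` when the time of `(p, j)` is not before
`t₀`. -/
structure InitialCondition (N : Noise Ω M P) (G : ChainGrid P) (t₀ : ℝ) where
  node : M → Ω → Set ℝ
  chain : P → ℤ → Ω → Option ℝ
  node_subset : ∀ m ω, node m ω ⊆ Iio t₀
  node_disjoint : ∀ ω m m', m ≠ m' → Disjoint (node m ω) (node m' ω)
  node_measurable : ∀ m B, MeasurableSet B → Measurable[N.filtLeft G t₀] (count (node m) B)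
  chain_eq_none : ∀ p j ω, t₀ ≤ G.time p j → chain p j ω = none
  chain_measurable : ∀ p j, OptMeasurable (N.filtLeft G t₀) (chain p j)

/-- Integrable initial conditions. -/
def InitialCondition.IsIntegrable [MeasurableSpace Ω] {N : Noise Ω M P} {G : ChainGrid P} {t₀ : ℝ}
    (C : InitialCondition N G t₀) (Pr : Measure Ω) : Prop :=
  ∃ K : ℝ≥0,
    (∀ m (a : ℝ), ∫⁻ ω, (count (C.node m) (Icc a (a + 1)) ω : ℝ≥0∞) ∂Pr ≤ K) ∧
    ∀ p j, ∫⁻ ω, ‖(C.chain p j ω).getD 0‖ₑ ∂Pr ≤ K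

end Noise

section Equation

variable {Ω M P : Type*}

/-- `∫_{-∞}^{t-} h^α_m (t - s) dS^m_s` and `∫_{-∞}^{t-} h^α_p (t - k) κ^α_p (W^p_k)` (against the
counting measure on the times of chain `p`) converge absolutely, for all `m` and `p`. -/
def MemoryConverges (𝔐 : Params M P) (G : ChainGrid P) (S : M → Set ℝ) (W : P → ℤ → Option ℝ)
    (α : M ⊕ P) (t : ℝ) : Prop :=
  (∀ m, Summable fun s : ↥(S m ∩ Iio t) => 𝔐.h α (.inl m) (t - s)) ∧
  (∀ p, Summable fun j : ↥{j : ℤ | G.time p j < t} =>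
    𝔐.h α (.inr p) (t - G.time p j) * 𝔐.mask α p (W p j))

/-- The sum over all nodes and chains of the integrals in `MemoryConverges`. -/
def memory [Fintype M] [Fintype P] (𝔐 : Params M P) (G : ChainGrid P) (S : M → Set ℝ)
    (W : P → ℤ → Option ℝ) (α : M ⊕ P) (t : ℝ) : ℝ :=
  (∑ m, ∑' s : ↥(S m ∩ Iio t), 𝔐.h α (.inl m) (t - s)) +
  ∑ p, ∑' j : ↥{j : ℤ | G.time p j < t},
    𝔐.h α (.inr p) (t - G.time p j) * 𝔐.mask α p (W p j)

/-- The data of a process `((λ^m), (S^m), (W^p))`: intensities, points and chains. -/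
structure Proc (Ω M P : Type*) where
  intensity : M → ℝ → Ω → ℝ
  points : M → Ω → Set ℝ
  chain : P → ℤ → Ω → Option ℝ

/-- `X` is a HAR process with parameters `𝔐` started at `t₀` with initial condition `C`. The
intensities are processes on `[t₀, ∞)`: their values before `t₀` play no role. As the initial
condition is only `𝓕_{t₀-}`-measurable, adaptedness is required at times at least `t₀`. -/
structure IsHAR [Fintype M] [Fintype P] [MeasurableSpace Ω] (Pr : Measure Ω) (G : ChainGrid P)
    (N : Noise Ω M P) (𝔐 : Params M P) (t₀ : ℝ) (C : InitialCondition N G t₀)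
    (X : Proc Ω M P) : Prop where
  points_disjoint : ∀ ω m m', m ≠ m' → Disjoint (X.points m ω) (X.points m' ω)
  points_adapted : ∀ m t, t₀ ≤ t → ∀ B, MeasurableSet B → B ⊆ Iic t →
    Measurable[N.filt G t] (count (X.points m) B)
  chain_adapted : ∀ p j, t₀ ≤ G.time p j → OptMeasurable (N.filt G (G.time p j)) (X.chain p j)
  intensity_predictable : ∀ m, Measurable[N.predictable G]
    (fun z : ℝ × Ω => (Ici t₀).indicator (fun t => X.intensity m t z.2) z.1)
  points_init : ∀ m ω, X.points m ω ∩ Iio t₀ = C.node m ω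
  chain_init : ∀ p j ω, G.time p j < t₀ → X.chain p j ω = C.chain p j ω
  intensity_eq : ∀ m, ∀ᵐ z ∂(Pr.prod (volume.restrict (Ici t₀))),
    MemoryConverges 𝔐 G (fun m' => X.points m' z.1) (fun p j => X.chain p j z.1) (.inl m) z.2 ∧
    X.intensity m z.2 z.1 = 𝔐.Φnode m (𝔐.μ m +
      memory 𝔐 G (fun m' => X.points m' z.1) (fun p j => X.chain p j z.1) (.inl m) z.2)
  points_eq : ∀ᵐ ω ∂Pr, ∀ m, ∀ B ⊆ Ici t₀,
    (X.points m ω ∩ B).encard =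
      (N.π m ω ∩ {z | z.1 ∈ B ∧ z.2 ≤ X.intensity m z.1 ω}).encard
  chain_eq : ∀ᵐ ω ∂Pr, ∀ p j, t₀ ≤ G.time p j →
    MemoryConverges 𝔐 G (fun m => X.points m ω) (fun p' j' => X.chain p' j' ω) (.inr p)
      (G.time p j) ∧
    X.chain p j ω = some (N.ξ p j ω + 𝔐.Φchain p
      (memory 𝔐 G (fun m => X.points m ω) (fun p' j' => X.chain p' j' ω) (.inr p) (G.time p j)))

/-- Non-explosion. The intensities and the chains have finite values by their types. -/
def Proc.NonExploding [MeasurableSpace Ω] (Pr : Measure Ω) (X : Proc Ω M P) : Prop :=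
  ∀ᵐ ω ∂Pr, ∀ m B, Bornology.IsBounded B → (X.points m ω ∩ B).Finite

/-- Two processes started at `t₀` are modifications of each other. -/
structure IsModification [MeasurableSpace Ω] (Pr : Measure Ω) (t₀ : ℝ) (X Y : Proc Ω M P) :
    Prop where
  intensity : ∀ m, ∀ᵐ z ∂(Pr.prod (volume.restrict (Ici t₀))),
    X.intensity m z.2 z.1 = Y.intensity m z.2 z.1
  points : ∀ᵐ ω ∂Pr, ∀ m, X.points m ω = Y.points m ω
  chain : ∀ᵐ ω ∂Pr, ∀ p j, X.chain p j ω = Y.chain p j ω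

/-- The integrals over the initial condition that enter the equations of the chains at times
at least `t₀` are almost surely absolutely convergent. -/
def InitialCondition.ChainMemoryConverges [MeasurableSpace Ω] {N : Noise Ω M P} {G : ChainGrid P}
    {t₀ : ℝ} (C : InitialCondition N G t₀) (𝔐 : Params M P) (Pr : Measure Ω) : Prop :=
  ∀ p j, t₀ ≤ G.time p j → ∀ᵐ ω ∂Pr,
    MemoryConverges 𝔐 G (fun m => C.node m ω) (fun p' j' => C.chain p' j' ω) (.inr p)
      (G.time p j)

end Equation

end HAR

end

noncomputable section

namespace HAR

/-! ### Sums over random sets -/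

section RandomSets

/-! Both halves rest on the compensation formula (`compensation`). For a nonnegative predictable
marked process, the expected sum over the atoms of a Poisson measure equals the integral against
Lebesgue × probability × Lebesgue. It follows from the independence of the past at `s` and the atoms
after `s` (`indep_filt_count`), checked on rectangles and extended by a π-system argument
(`atomLaw_trim_eq`). It has two consequences. Almost surely no atom falls in a predictable set of
measure zero (`ae_forall_notMem_of_null`). The expected weighted number of points on which two
thinnings differ is at most the weighted distance of their intensities
(`lintegral_tsum_symmDiff_le`).

Uniqueness (`IsHAR.isModification`) is a first-disagreement argument and needs no moments. The set
of pairs `(t, ω)` such that two solutions agree strictly before `t` is predictable. On it the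
intensity equations have the same right-hand side, so the intensities agree outside a null
predictable set, which no atom hits. By non-explosion the times of disagreement are locally finite.
At the first one, neither the thinning of an atom nor a chain update can differ, because both depend
on the strict past only.

Existence is by Picard iteration. A global contraction in mean is out of reach, since drifts and
chain values need not have moments and the chain-to-chain functions need not be integrable. The
iteration is therefore run from one chain time `a` to the next one `b`, on `𝓕_a`-events on which all
iterates have size at most `K` up to `a` and have stopped changing there from index `K` on. Between
two chain times only the node-to-node interactions distinguish consecutive iterates. Lipschitz
continuity and integrability, with a weight `exp (-c t)` for large `c`, then halve at each step the
expected weighted distance of consecutive intensities (`ae_eventually_symmDiff_eq_empty`). Point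
counts are integers, so summability means that consecutive iterates have exactly the same points
from some index on. A chain value at `b` depends on the strict past and is constant one iterate
later (`Stable.extend`). Induction over the finitely many chain times below a horizon gives
`ae_stable`. The limit then coincides locally with a late iterate and solves the equations exactly,
without any continuity argument (`Stable.picardLimit_eq`).

Two technical points remain. The memory is a possibly divergent sum over a random set, so the
iteration uses `regMemory`, which is switched off where the points are not locally finite and is
predictable everywhere. As for convergence, only finitely many points and chain times in `[t₀, t)`
contribute, so it is decided by the initial condition. In the node equations, which hold for almost
every time, it follows from integrability and Tonelli. In the chain equations, imposed at fixed
times, it is exactly the stated condition, which is necessary because the initial condition gives a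
subsum. -/

theorem measurable_enat_iff {Ω : Type*} {_ : MeasurableSpace Ω} {f : Ω → ℕ∞} :
    Measurable f ↔ Measurable fun ω => (f ω : ℝ≥0∞) := by
  refine ⟨fun hf => (measurable_from_top (f := fun n : ℕ∞ => (n : ℝ≥0∞))).comp hf, fun hf => ?_⟩
  refine measurable_to_countable' fun n => ?_
  have : f ⁻¹' {n} = (fun ω => (f ω : ℝ≥0∞)) ⁻¹' {(n : ℝ≥0∞)} := by
    ext ω; simp
  rw [this]
  exact hf (measurableSet_singleton _)

variable {E : Type*} [MeasurableSpace E]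

/-- The counting measure of the points of a set. -/
def atomMeasure (A : Set E) : Measure E := Measure.sum fun a : A => Measure.dirac (a : E)

theorem atomMeasure_apply (A : Set E) {B : Set E} (hB : MeasurableSet B) :
    atomMeasure A B = (A ∩ B).encard := by
  rw [atomMeasure, Measure.sum_apply _ hB, ← ENNReal.tsum_set_one, ← tsum_subtype_eq_of_support_subset
    (f := fun a : A => Measure.dirac (a : E) B) (s := {a : A | (a : E) ∈ B})]
  · have e : {a : A | (a : E) ∈ B} ≃ ↥(A ∩ B) :=
      (Equiv.subtypeSubtypeEquivSubtypeInter (· ∈ A) (· ∈ B))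
    rw [← e.tsum_eq]
    refine tsum_congr fun a => ?_
    have : (a : E) ∈ B := a.2
    simp [Measure.dirac_apply' _ hB, this]
  · intro a ha
    simp only [Function.mem_support, Measure.dirac_apply' _ hB] at ha
    by_contra h
    exact ha (indicator_of_notMem (show (a : E) ∉ B from h) _)

theorem lintegral_atomMeasure (A : Set E) {g : E → ℝ≥0∞} (hg : Measurable g) :
    ∫⁻ x, g x ∂(atomMeasure A) = ∑' a : A, g a := by
  rw [atomMeasure, lintegral_sum_measure]
  exact tsum_congr fun a => lintegral_dirac' _ hg

variable {Ω : Type*} {mΩ : MeasurableSpace Ω}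

theorem measurable_atomMeasure {A : Ω → Set E}
    (hA : ∀ B, MeasurableSet B → Measurable (count A B)) :
    Measurable fun ω => atomMeasure (A ω) := by
  refine Measure.measurable_of_measurable_coe _ fun B hB => ?_
  simp_rw [atomMeasure_apply _ hB]
  exact measurable_enat_iff.1 (hA B hB)

/-- Sums of a measurable function over a random set with finitely many points in each set of a
countable measurable cover are measurable. -/
theorem measurable_tsum_randomSet {A : Ω → Set E}
    (hA : ∀ B, MeasurableSet B → Measurable (count A B))
    {D : ℕ → Set E} (hD : ∀ n, MeasurableSet (D n)) (hcov : ⋃ n, D n = univ)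
    (hfin : ∀ ω n, count A (D n) ω ≠ ⊤) {g : Ω × E → ℝ≥0∞} (hg : Measurable g) :
    Measurable fun ω => ∑' a : A ω, g (ω, a) := by
  -- The random measure is finite on each `D n` for every `ω`, but not uniformly in `ω`. Restricted
  -- to the disjoint pieces it is a kernel of finite measures, and the sum is recovered piece by
  -- piece.
  let κ : Kernel Ω E := ⟨fun ω => atomMeasure (A ω), measurable_atomMeasure hA⟩
  have hset : ∀ n : ℕ, ∀ t : Set (Ω × E), MeasurableSet t →
      Measurable fun ω => (atomMeasure (A ω)).restrict (disjointed D n) (Prod.mk ω ⁻¹' t) := by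
    intro n t ht
    have hdm : MeasurableSet (disjointed D n) := MeasurableSet.disjointed hD n
    have := Kernel.measurable_kernel_prodMk_left_of_finite (κ := κ.restrict hdm) ht (fun ω => ?_)
    · simp only [Kernel.restrict_apply] at this; exact this
    · rw [Kernel.restrict_apply]
      refine ⟨?_⟩
      rw [Measure.restrict_apply_univ]
      change atomMeasure (A ω) _ < ⊤
      refine (measure_mono (disjointed_subset D n)).trans_lt ?_
      rw [atomMeasure_apply _ (hD n)]
      have := hfin ω n
      rw [count] at this
      simpa [lt_top_iff_ne_top] using this
  have key : ∀ n : ℕ, Measurable fun ω =>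
      ∫⁻ x, g (ω, x) ∂(atomMeasure (A ω)).restrict (disjointed D n) := by
    intro n
    refine Measurable.ennreal_induction (motive := fun g => Measurable fun ω =>
      ∫⁻ x, g (ω, x) ∂(atomMeasure (A ω)).restrict (disjointed D n)) ?_ ?_ ?_ hg
    · intro c s hs
      have : ∀ ω, ∫⁻ x, s.indicator (fun _ => c) (ω, x)
          ∂(atomMeasure (A ω)).restrict (disjointed D n) =
          c * (atomMeasure (A ω)).restrict (disjointed D n) (Prod.mk ω ⁻¹' s) := by
        intro ω
        rw [← lintegral_indicator_const (measurable_prodMk_left hs)]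
        rfl
      simp_rw [this]
      exact (hset n s hs).const_mul c
    · intro f g _ hf hg hf' hg'
      have : ∀ ω, ∫⁻ x, (f + g) (ω, x) ∂(atomMeasure (A ω)).restrict (disjointed D n) =
          ∫⁻ x, f (ω, x) ∂(atomMeasure (A ω)).restrict (disjointed D n) +
          ∫⁻ x, g (ω, x) ∂(atomMeasure (A ω)).restrict (disjointed D n) := by
        intro ω
        exact lintegral_add_left (hf.comp measurable_prodMk_left) _
      simp_rw [this]
      exact hf'.add hg'
    · intro f hf hmono hf'
      have : ∀ ω, ∫⁻ x, ⨆ k, f k (ω, x) ∂(atomMeasure (A ω)).restrict (disjointed D n) =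
          ⨆ k, ∫⁻ x, f k (ω, x) ∂(atomMeasure (A ω)).restrict (disjointed D n) := by
        intro ω
        exact lintegral_iSup (fun k => (hf k).comp measurable_prodMk_left)
          (fun i j hij x => hmono hij _)
      simp_rw [this]
      exact Measurable.iSup hf'
  have hsum : ∀ ω, ∑' a : A ω, g (ω, a) =
      ∑' n, ∫⁻ x, g (ω, x) ∂(atomMeasure (A ω)).restrict (disjointed D n) := by
    intro ω
    rw [← lintegral_atomMeasure (A ω) (g := fun x => g (ω, x)) (hg.comp measurable_prodMk_left),
      ← lintegral_iUnion (fun n => MeasurableSet.disjointed hD n) (disjoint_disjointed D),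
      iUnion_disjointed, hcov, Measure.restrict_univ]
  simp_rw [hsum]
  exact Measurable.tsum key

/-- A real series is summable iff the sum of its norms is finite. -/
theorem summable_iff_tsum_enorm_ne_top {ι : Type*} {f : ι → ℝ} :
    Summable f ↔ ∑' i, ‖f i‖ₑ ≠ ⊤ := by
  rw [← summable_norm_iff]
  have : ∀ i, ‖f i‖ₑ = ((‖f i‖₊ : ℝ≥0) : ℝ≥0∞) := fun i => rfl
  simp_rw [this]
  rw [ENNReal.tsum_coe_ne_top_iff_summable, ← NNReal.summable_coe]
  rfl

/-- Expresses a real sum, including the default value `0` in the divergent case, through sums in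
`ℝ≥0∞`, so that `measurable_tsum_randomSet` also yields measurability of signed sums. -/
theorem real_tsum_eq {ι : Type*} (f : ι → ℝ) :
    ∑' i, f i = if ∑' i, ‖f i‖ₑ = ⊤ then 0 else
      (∑' i, ENNReal.ofReal (f i)).toReal - (∑' i, ENNReal.ofReal (-f i)).toReal := by
  split_ifs with h
  · exact tsum_eq_zero_of_not_summable fun hs => summable_iff_tsum_enorm_ne_top.1 hs h
  · have hs : Summable f := summable_iff_tsum_enorm_ne_top.2 h
    have hp : ∀ i, ENNReal.ofReal (f i) ≤ ‖f i‖ₑ := fun i => by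
      rw [← ofReal_norm]; exact ENNReal.ofReal_le_ofReal (le_abs_self _)
    have hn : ∀ i, ENNReal.ofReal (-f i) ≤ ‖f i‖ₑ := fun i => by
      rw [← ofReal_norm]; exact ENNReal.ofReal_le_ofReal (neg_le_abs _)
    have hp' : ∑' i, ENNReal.ofReal (f i) ≠ ⊤ := ne_top_of_le_ne_top h (ENNReal.tsum_le_tsum hp)
    have hn' : ∑' i, ENNReal.ofReal (-f i) ≠ ⊤ := ne_top_of_le_ne_top h (ENNReal.tsum_le_tsum hn)
    rw [ENNReal.tsum_toReal_eq (fun i => ENNReal.ofReal_ne_top),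
      ENNReal.tsum_toReal_eq (fun i => ENNReal.ofReal_ne_top),
      ← Summable.tsum_sub (ENNReal.summable_toReal hp') (ENNReal.summable_toReal hn')]
    refine tsum_congr fun i => ?_
    rcases le_total 0 (f i) with hi | hi
    · rw [ENNReal.toReal_ofReal hi, ENNReal.ofReal_of_nonpos (by linarith)]; simp
    · rw [ENNReal.ofReal_of_nonpos hi, ENNReal.toReal_ofReal (by linarith)]; simp

theorem enorm_tsum_le {ι : Type*} (f : ι → ℝ) : ‖∑' i, f i‖ₑ ≤ ∑' i, ‖f i‖ₑ := by
  by_cases h : Summable f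
  · have hn : Summable fun i => ‖f i‖₊ := by
      rw [← NNReal.summable_coe]; exact h.norm
    have e : ∑' i, ‖f i‖ₑ = ((∑' i, ‖f i‖₊ : ℝ≥0) : ℝ≥0∞) := (ENNReal.coe_tsum hn).symm
    rw [e]
    exact ENNReal.coe_le_coe.2 (nnnorm_tsum_le hn)
  · simp [tsum_eq_zero_of_not_summable h]

theorem measurable_tsum_randomSet_real {A : Ω → Set E}
    (hA : ∀ B, MeasurableSet B → Measurable (count A B))
    {D : ℕ → Set E} (hD : ∀ n, MeasurableSet (D n)) (hcov : ⋃ n, D n = univ)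
    (hfin : ∀ ω n, count A (D n) ω ≠ ⊤) {g : Ω × E → ℝ} (hg : Measurable g) :
    Measurable fun ω => ∑' a : A ω, g (ω, a) := by
  simp_rw [real_tsum_eq]
  refine Measurable.ite ?_ measurable_const ?_
  · exact measurable_tsum_randomSet hA hD hcov hfin hg.enorm (measurableSet_singleton ⊤)
  · exact (measurable_tsum_randomSet hA hD hcov hfin hg.ennreal_ofReal).ennreal_toReal.sub
      (measurable_tsum_randomSet hA hD hcov hfin hg.neg.ennreal_ofReal).ennreal_toReal

theorem measurable_tsum_of_countable {ι : Type*} [Countable ι] {f : ι → Ω → ℝ}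
    (hf : ∀ i, Measurable (f i)) : Measurable fun ω => ∑' i, f i ω :=
  Measurable.tsum hf

theorem optMeasurable_iff {Ω : Type*} {𝓕 : MeasurableSpace Ω} {V : Ω → Option ℝ} :
    OptMeasurable 𝓕 V ↔ MeasurableSet[𝓕] {ω | V ω = none} ∧
      Measurable[𝓕] fun ω => (V ω).getD 0 := by
  unfold OptMeasurable
  constructor
  · intro h
    constructor
    · have : {ω | V ω = none} = (fun ω => Equiv.optionEquivSumPUnit.{0} ℝ (V ω)) ⁻¹'
          (range Sum.inr) := by
        ext ω; cases hV : V ω <;> simp [hV]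
      rw [this]
      exact h (measurableSet_range_inr)
    · have : (fun ω => (V ω).getD 0) = (Sum.elim id (fun _ => (0 : ℝ))) ∘
          (fun ω => Equiv.optionEquivSumPUnit.{0} ℝ (V ω)) := by
        ext ω; cases hV : V ω <;> simp [hV]
      rw [this]
      exact (measurable_id.sumElim measurable_const).comp h
  · rintro ⟨h1, h2⟩
    have : (fun ω => Equiv.optionEquivSumPUnit.{0} ℝ (V ω)) =
        fun ω => @ite _ (V ω = none) (Classical.dec _) (Sum.inr PUnit.unit) (Sum.inl ((V ω).getD 0)) := by
      ext ω; cases V ω <;> simp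
    rw [this]
    exact Measurable.ite h1 measurable_const (measurable_inl.comp h2)

end RandomSets

/-! ### The filtration and the predictable σ-algebra -/

section Filtration

variable {Ω M P : Type*} {N : Noise Ω M P} {G : ChainGrid P}

theorem count_inter {E : Type*} (A : Ω → Set E) (B D : Set E) :
    count (fun ω => A ω ∩ D) B = count A (B ∩ D) := by
  ext ω; simp only [count]; congr 1; ext x; simp only [mem_inter_iff]; tauto

theorem measurable_count_filt (m : M) (t : ℝ) {B : Set (ℝ × ℝ)} (hB : MeasurableSet B) :
    Measurable[N.filt G t] (count (fun ω => N.π m ω ∩ Iic t ×ˢ univ) B) := by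
  have h1 : Measurable[sigmaSet (fun ω => N.π m ω ∩ Iic t ×ˢ univ)]
      (count (fun ω => N.π m ω ∩ Iic t ×ˢ univ) B) :=
    Measurable.mono (comap_measurable _) (le_iSup₂_of_le B hB le_rfl) le_rfl
  exact h1.mono ((le_iSup (fun m : M => sigmaSet (fun ω => N.π m ω ∩ Iic t ×ˢ univ)) m).trans
    le_sup_left) le_rfl

theorem measurable_drift_filt {p : P} {j : ℤ} {t : ℝ} (h : G.time p j ≤ t) :
    Measurable[N.filt G t] (N.ξ p j) := by
  refine Measurable.mono (comap_measurable _) ?_ le_rfl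
  exact le_sup_of_le_right (le_iSup_of_le p (le_iSup_of_le j (le_iSup_of_le h le_rfl)))

theorem sigmaSet_inter_mono (m : M) {D D' : Set (ℝ × ℝ)} (hD : MeasurableSet D) (h : D ⊆ D') :
    sigmaSet (fun ω => N.π m ω ∩ D) ≤ sigmaSet (fun ω => N.π m ω ∩ D') := by
  refine iSup₂_le fun B hB => ?_
  refine le_iSup₂_of_le (B ∩ D) (hB.inter hD) ?_
  rw [count_inter, count_inter, inter_assoc, inter_eq_left.2 h]

theorem filt_mono {s t : ℝ} (h : s ≤ t) : N.filt G s ≤ N.filt G t := by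
  refine sup_le_sup (iSup_mono fun m => ?_) ?_
  · exact sigmaSet_inter_mono m (measurableSet_Iic.prod .univ)
      (prod_mono (Iic_subset_Iic.2 h) le_rfl)
  · exact iSup_mono fun p => iSup_mono fun j => iSup_le fun hj => le_iSup_of_le (hj.trans h) le_rfl

theorem filtLeft_le {t : ℝ} : N.filtLeft G t ≤ N.filt G t :=
  iSup₂_le fun _ hs => filt_mono hs.le

theorem predictable_Ioi_prod {q : ℝ} {A : Set Ω} (hA : MeasurableSet[N.filt G q] A) :
    MeasurableSet[N.predictable G] (Ioi q ×ˢ A) := by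
  have : Ioi q ×ˢ A = ⋃ n : ℕ, Ioc q (q + (n + 1)) ×ˢ A := by
    ext ⟨t, ω⟩
    simp only [mem_prod, mem_Ioi, mem_iUnion, mem_Ioc]
    constructor
    · rintro ⟨h1, h2⟩
      obtain ⟨n, hn⟩ := exists_nat_ge (t - q)
      exact ⟨n, ⟨h1, by linarith⟩, h2⟩
    · rintro ⟨n, h1, h2⟩; exact ⟨h1.1, h2⟩
  rw [this]
  refine MeasurableSet.iUnion fun n => MeasurableSpace.measurableSet_generateFrom
    ⟨q, _, A, ?_, hA, rfl⟩
  have : (0 : ℝ) ≤ n := n.cast_nonneg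
  linarith

/-- An event known at some `s < t₀` is already known just before `t₀`, so the closed half-line is a
countable intersection of open ones. This is why the initial condition is usable at time `t₀`
itself. -/
theorem predictable_Ici_prod {t₀ : ℝ} {A : Set Ω} (hA : MeasurableSet[N.filtLeft G t₀] A) :
    MeasurableSet[N.predictable G] (Ici t₀ ×ˢ A) := by
  have key : ∀ s < t₀, ∀ A, MeasurableSet[N.filt G s] A →
      MeasurableSet[N.predictable G] (Ici t₀ ×ˢ A) := by
    intro s hs A hA
    have : Ici t₀ ×ˢ A = ⋂ n : ℕ, Ioi (max s (t₀ - 1 / ((n : ℝ) + 1))) ×ˢ A := by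
      ext ⟨t, ω⟩
      simp only [mem_prod, mem_Ici, mem_iInter, mem_Ioi, max_lt_iff]
      constructor
      · rintro ⟨h1, h2⟩ n
        have : (0 : ℝ) < 1 / ((n : ℝ) + 1) := Nat.one_div_pos_of_nat
        exact ⟨⟨by linarith, by linarith⟩, h2⟩
      · intro h
        refine ⟨?_, (h 0).2⟩
        by_contra! hlt
        obtain ⟨n, hn⟩ := exists_nat_one_div_lt (sub_pos.2 hlt)
        have := (h n).1.2
        linarith
    rw [this]
    exact MeasurableSet.iInter fun n => predictable_Ioi_prod (filt_mono (le_max_left _ _) _ hA)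
  -- `𝓕_{t₀-}` is generated by a union of σ-algebras; the sets with the desired property form a
  -- σ-algebra containing each of them.
  let 𝓖 : MeasurableSpace Ω :=
    { MeasurableSet' := fun A => MeasurableSet[N.predictable G] (Ici t₀ ×ˢ A)
      measurableSet_empty := by simp
      measurableSet_compl := fun A hA => by
        have : Ici t₀ ×ˢ Aᶜ = Ici t₀ ×ˢ (univ : Set Ω) \ Ici t₀ ×ˢ A := by
          ext ⟨t, ω⟩; simp only [mem_prod, mem_sdiff, mem_compl_iff, mem_univ]; tauto
        rw [this]
        exact (key (t₀ - 1) (by linarith) _ MeasurableSet.univ).diff hA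
      measurableSet_iUnion := fun f hf => by
        rw [prod_iUnion]; exact MeasurableSet.iUnion hf }
  have : N.filtLeft G t₀ ≤ 𝓖 := iSup₂_le fun s hs A hA => key s hs A hA
  exact this A hA

theorem measurable_fst_predictable : Measurable[N.predictable G] (Prod.fst : ℝ × Ω → ℝ) := by
  refine measurable_of_Ioi fun q => ?_
  have : Prod.fst ⁻¹' Ioi q = Ioi q ×ˢ (univ : Set Ω) := by ext; simp
  rw [this]
  exact predictable_Ioi_prod MeasurableSet.univ

open Classical in
/-- A random variable known at time `q` is predictable after `q`. -/
theorem measurable_ite_Ioi {β : Type*} [MeasurableSpace β] {q : ℝ} {f : Ω → β}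
    (hf : Measurable[N.filt G q] f) (c : β) :
    Measurable[N.predictable G] fun z : ℝ × Ω => if q < z.1 then f z.2 else c := by
  intro U hU
  have : (fun z : ℝ × Ω => if q < z.1 then f z.2 else c) ⁻¹' U =
      Ioi q ×ˢ (f ⁻¹' U) ∪ (Prod.fst ⁻¹' Iic q ∩ {_z | c ∈ U}) := by
    ext ⟨t, ω⟩
    by_cases h : q < t <;> simp [h, not_le.2, not_lt.1]
  rw [this]
  exact (predictable_Ioi_prod (hf hU)).union
    ((measurable_fst_predictable measurableSet_Iic).inter (MeasurableSet.const _))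

open Classical in
/-- A random variable known strictly before time `t₀` is predictable from `t₀` on. -/
theorem measurable_ite_Ici {β : Type*} [MeasurableSpace β] {t₀ : ℝ} {f : Ω → β}
    (hf : Measurable[N.filtLeft G t₀] f) (c : β) :
    Measurable[N.predictable G] fun z : ℝ × Ω => if t₀ ≤ z.1 then f z.2 else c := by
  intro U hU
  have : (fun z : ℝ × Ω => if t₀ ≤ z.1 then f z.2 else c) ⁻¹' U =
      Ici t₀ ×ˢ (f ⁻¹' U) ∪ (Prod.fst ⁻¹' Iio t₀ ∩ {_z | c ∈ U}) := by
    ext ⟨t, ω⟩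
    by_cases h : t₀ ≤ t <;> simp [h, not_lt.2, not_le.1]
  rw [this]
  exact (predictable_Ici_prod (hf hU)).union
    ((measurable_fst_predictable measurableSet_Iio).inter (MeasurableSet.const _))

/-- Predictable processes are progressively measurable. -/
theorem measurable_min_predictable (t : ℝ) :
    @Measurable (Ω × ℝ) (ℝ × Ω) (@Prod.instMeasurableSpace _ _ (N.filt G t) inferInstance)
      (N.predictable G) (fun z => (min z.2 t, z.1)) := by
  refine @measurable_generateFrom _ _ (@Prod.instMeasurableSpace _ _ (N.filt G t) inferInstance)
    _ _ ?_
  rintro _ ⟨u, v, A, -, hA, rfl⟩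
  by_cases h : u < t
  · have : (fun z : Ω × ℝ => (min z.2 t, z.1)) ⁻¹' Ioc u v ×ˢ A =
        A ×ˢ ((fun s => min s t) ⁻¹' Ioc u v) := by
      ext ⟨ω, s⟩; simp only [mem_preimage, mem_prod]; tauto
    rw [this]
    exact @MeasurableSet.prod _ _ (N.filt G t) _ _ _ (filt_mono h.le _ hA)
      ((measurable_id.min measurable_const) measurableSet_Ioc)
  · have : (fun z : Ω × ℝ => (min z.2 t, z.1)) ⁻¹' Ioc u v ×ˢ A = ∅ := by
      ext ⟨ω, s⟩
      simp only [mem_preimage, mem_prod, mem_Ioc, lt_min_iff, mem_empty_iff_false, iff_false]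
      tauto
    rw [this]
    exact @MeasurableSet.empty _ (@Prod.instMeasurableSpace _ _ (N.filt G t) inferInstance)

theorem measurable_section_predictable (t : ℝ) :
    @Measurable Ω (ℝ × Ω) (N.filt G t) (N.predictable G) (fun ω => (t, ω)) := by
  refine @measurable_generateFrom _ _ (N.filt G t) _ _ ?_
  rintro _ ⟨u, v, A, -, hA, rfl⟩
  by_cases h : t ∈ Ioc u v
  · have : (fun ω : Ω => (t, ω)) ⁻¹' Ioc u v ×ˢ A = A := by
      ext ω; simp only [mem_preimage, mem_prod]; tauto
    rw [this]
    exact filt_mono h.1.le _ hA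
  · have : (fun ω : Ω => (t, ω)) ⁻¹' Ioc u v ×ˢ A = ∅ := by
      ext ω; simp only [mem_preimage, mem_prod, mem_empty_iff_false, iff_false]; tauto
    rw [this]
    exact @MeasurableSet.empty _ (N.filt G t)

open Classical in
/-- Left limits of adapted increasing processes are predictable. -/
theorem measurable_iSup_predictable {β : Type*} [CompleteLinearOrder β] [TopologicalSpace β]
    [OrderTopology β] [SecondCountableTopology β] [MeasurableSpace β] [BorelSpace β]
    {t₀ : ℝ} {Z : ℝ → Ω → β}
    (hZ : ∀ q, t₀ ≤ q → Measurable[N.filt G q] (Z q)) :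
    Measurable[N.predictable G] fun z : ℝ × Ω => ⨆ q : ℚ, ⨆ _ : t₀ ≤ q,
      if (q : ℝ) < z.1 then Z q z.2 else ⊥ := by
  refine Measurable.iSup fun q => ?_
  by_cases hq : t₀ ≤ q
  · simp only [hq, iSup_pos]
    exact measurable_ite_Ioi (hZ q hq) ⊥
  · simp only [hq, iSup_neg, not_false_eq_true]
    exact measurable_const

/-- The σ-algebra of predictable marked processes. -/
abbrev marked (N : Noise Ω M P) (G : ChainGrid P) : MeasurableSpace ((ℝ × Ω) × ℝ) :=
  @Prod.instMeasurableSpace _ _ (N.predictable G) inferInstance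

/-- The number of atoms of `π m` in a marked random region. -/
def hits (N : Noise Ω M P) (m : M) (R : Set ((ℝ × Ω) × ℝ)) (ω : Ω) : ℕ∞ :=
  (N.π m ω ∩ {z | ((z.1, ω), z.2) ∈ R}).encard

variable [mΩ : MeasurableSpace Ω] {Pr : Measure Ω}

theorem filt_le (hN : N.IsDriving G Pr) (t : ℝ) : N.filt G t ≤ mΩ := by
  refine sup_le (iSup_le fun m => iSup₂_le fun B hB => ?_)
    (iSup_le fun p => iSup_le fun j => iSup_le fun _ => (hN.ξ_measurable p j).comap_le)
  rw [count_inter]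
  exact ((hN.poisson m).measurable _ (hB.inter (measurableSet_Iic.prod .univ))).comap_le

theorem predictable_le (hN : N.IsDriving G Pr) :
    N.predictable G ≤ (inferInstance : MeasurableSpace (ℝ × Ω)) := by
  refine MeasurableSpace.generateFrom_le ?_
  rintro _ ⟨s, t, A, -, hA, rfl⟩
  exact measurableSet_Ioc.prod (filt_le hN s A hA)

/-- The number of atoms in a predictable marked region up to time `t` is known at time `t`. -/
theorem measurable_hits (hN : N.IsDriving G Pr) (m : M) {R : Set ((ℝ × Ω) × ℝ)}
    (hR : MeasurableSet[marked N G] R) {t : ℝ} (hRt : ∀ z ∈ R, z.1.1 ≤ t) :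
    Measurable[N.filt G t] (hits N m R) := by
  -- Truncating the time at `t` makes the predictable indicator jointly measurable over `𝓕_t`. The
  -- truncation is harmless because only atoms up to time `t` are summed.
  have hf : @Measurable (Ω × (ℝ × ℝ)) ((ℝ × Ω) × ℝ)
      (@Prod.instMeasurableSpace _ _ (N.filt G t) inferInstance) (marked N G)
      (fun z => ((min z.2.1 t, z.1), z.2.2)) := by
    let _ : MeasurableSpace Ω := N.filt G t
    refine @Measurable.prodMk _ _ _ _ (N.predictable G) _ _ _ ?_ (measurable_snd.comp measurable_snd)
    exact (measurable_min_predictable (N := N) (G := G) t).comp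
      (measurable_fst.prodMk (measurable_fst.comp measurable_snd))
  have hg : @Measurable (Ω × (ℝ × ℝ)) ℝ≥0∞
      (@Prod.instMeasurableSpace _ _ (N.filt G t) inferInstance) _
      (fun z => R.indicator 1 ((min z.2.1 t, z.1), z.2.2)) :=
    have h1 : Measurable[marked N G] (R.indicator (1 : (ℝ × Ω) × ℝ → ℝ≥0∞)) :=
      (@measurable_const _ _ _ (marked N G) 1).indicator hR
    h1.comp hf
  have := @measurable_tsum_randomSet (ℝ × ℝ) _ Ω (N.filt G t)
    (fun ω => N.π m ω ∩ Iic t ×ˢ univ) (fun B hB => measurable_count_filt m t hB)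
    (fun n : ℕ => Metric.closedBall 0 n) (fun n => Metric.isClosed_closedBall.measurableSet)
    (Metric.iUnion_closedBall_nat 0) (fun ω n => ?_) _ hg
  · refine measurable_enat_iff.2 ?_
    convert this using 2 with ω
    rw [hits, ← ENNReal.tsum_set_one, tsum_subtype (N.π m ω ∩ Iic t ×ˢ univ)
      (fun a => R.indicator 1 ((min a.1 t, ω), a.2)),
      tsum_subtype (N.π m ω ∩ {z | ((z.1, ω), z.2) ∈ R}) (fun _ => 1)]
    refine tsum_congr fun z => ?_
    classical
    simp only [indicator_apply, mem_inter_iff, mem_ofPred_eq, mem_prod, mem_univ, mem_Iic,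
      and_true, Pi.one_apply]
    by_cases hz : z.1 ≤ t
    · simp [hz, ite_and]
    · have : ((z.1, ω), z.2) ∉ R := fun h => hz (hRt _ h)
      simp [hz, this]
  · have := (hN.poisson m).locallyFinite ω (Metric.closedBall 0 n) Metric.isBounded_closedBall
    rw [count_inter, count, encard_ne_top_iff]
    exact this.subset (inter_subset_inter_right _ inter_subset_left)

end Filtration

/-! ### The compensation formula -/

section Compensation

/-- The intersections `a ∩ h` form a π-system generating `𝒜 ⊔ ℋ`. Since `a ∩ b` lies in `𝒢`, the
event `h` factors out first, and then `a` and `b` separate. -/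
theorem indep_sup_left_of_indep {Ω : Type*} {𝒜 𝒢 ℬ ℋ mΩ : MeasurableSpace Ω} {Pr : Measure Ω}
    [IsProbabilityMeasure Pr] (h𝒢 : 𝒢 ≤ mΩ) (hℋ : ℋ ≤ mΩ) (h𝒜𝒢 : 𝒜 ≤ 𝒢) (hℬ𝒢 : ℬ ≤ 𝒢)
    (h𝒜ℬ : Indep 𝒜 ℬ Pr) (h𝒢ℋ : Indep 𝒢 ℋ Pr) : Indep (𝒜 ⊔ ℋ) ℬ Pr := by
  refine IndepSets.indep (p1 := image2 (· ∩ ·) {a | MeasurableSet[𝒜] a} {h | MeasurableSet[ℋ] h})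
    (p2 := {b | MeasurableSet[ℬ] b}) (sup_le (h𝒜𝒢.trans h𝒢) hℋ) (hℬ𝒢.trans h𝒢) ?_
    (@MeasurableSpace.isPiSystem_measurableSet _ ℬ) ?_ (@MeasurableSpace.generateFrom_measurableSet _ ℬ).symm ?_
  · rintro _ ⟨a, ha, h, hh, rfl⟩ _ ⟨a', ha', h', hh', rfl⟩ -
    exact ⟨a ∩ a', @MeasurableSet.inter _ 𝒜 _ _ ha ha', h ∩ h', @MeasurableSet.inter _ ℋ _ _ hh hh',
      by simp only; rw [inter_inter_inter_comm]⟩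
  · refine le_antisymm (sup_le ?_ ?_) (MeasurableSpace.generateFrom_le ?_)
    · intro a ha
      exact MeasurableSpace.measurableSet_generateFrom
        ⟨a, ha, univ, @MeasurableSet.univ _ ℋ, by simp⟩
    · intro h hh
      exact MeasurableSpace.measurableSet_generateFrom
        ⟨univ, @MeasurableSet.univ _ 𝒜, h, hh, by simp⟩
    · rintro _ ⟨a, ha, h, hh, rfl⟩
      exact @MeasurableSet.inter _ (𝒜 ⊔ ℋ) _ _ ((le_sup_left : 𝒜 ≤ 𝒜 ⊔ ℋ) a ha)
        ((le_sup_right : ℋ ≤ 𝒜 ⊔ ℋ) h hh)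
  · rw [IndepSets_iff]
    rintro _ b ⟨a, ha, h, hh, rfl⟩ hb
    rw [Indep_iff] at h𝒜ℬ h𝒢ℋ
    have e1 : a ∩ h ∩ b = (a ∩ b) ∩ h := by rw [inter_right_comm]
    simp only [e1]
    rw [h𝒢ℋ _ _ (@MeasurableSet.inter _ 𝒢 _ _ (h𝒜𝒢 a ha) (hℬ𝒢 b hb)) hh,
      h𝒢ℋ _ _ (h𝒜𝒢 a ha) hh, h𝒜ℬ _ _ ha hb]
    ring

variable {Ω : Type*} {mΩ : MeasurableSpace Ω} {Pr : Measure Ω}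

theorem IsPoisson.iIndepFun_count {A : Ω → Set (ℝ × ℝ)} (hA : IsPoisson Pr A) {ι : Type*}
    [Fintype ι] {B : ι → Set (ℝ × ℝ)} (hB : ∀ i, MeasurableSet (B i))
    (hd : Pairwise fun i j => Disjoint (B i) (B j)) : iIndepFun (fun i => count A (B i)) Pr := by
  have e := Fintype.equivFin ι
  have := hA.indep _ (fun k => B (e.symm k)) (fun k => hB _)
    (fun i j hij => hd fun h => hij (e.symm.injective h))
  have h2 := this.precomp (g := e) e.injective
  simpa using h2

/-- The restrictions of a Poisson random measure to disjoint sets are independent. -/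
theorem IsPoisson.indep_sigmaSet [IsProbabilityMeasure Pr] {A : Ω → Set (ℝ × ℝ)}
    (hA : IsPoisson Pr A) {D B' : Set (ℝ × ℝ)} (hD : MeasurableSet D) (hB' : MeasurableSet B')
    (hDB : Disjoint D B') :
    Indep (sigmaSet fun ω => A ω ∩ D) (MeasurableSpace.comap (count A B') inferInstance) Pr := by
  classical
  let I := {B : Set (ℝ × ℝ) // MeasurableSet B}
  -- Independence passes to directed suprema, so finitely many test sets `B` may be treated at a
  -- time.
  let 𝓂 : Finset I → MeasurableSpace Ω := fun F =>
    ⨆ B ∈ F, MeasurableSpace.comap (count A (B.1 ∩ D)) inferInstance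
  have hle : ∀ B : Set (ℝ × ℝ), MeasurableSet B →
      MeasurableSpace.comap (count A B) inferInstance ≤ mΩ := fun B hB =>
    (hA.measurable B hB).comap_le
  have hsup : sigmaSet (fun ω => A ω ∩ D) = ⨆ F, 𝓂 F := by
    refine le_antisymm (iSup₂_le fun B hB => ?_) (iSup_le fun F => iSup₂_le fun B _ => ?_)
    · rw [count_inter]
      exact le_iSup_of_le {⟨B, hB⟩} (le_iSup₂_of_le ⟨B, hB⟩ (by simp) le_rfl)
    · rw [← count_inter]
      exact le_iSup₂_of_le B.1 B.2 le_rfl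
  rw [hsup]
  refine indep_iSup_of_directed_le (fun F => ?_) (fun F => iSup₂_le fun B _ => hle _ (B.2.inter hD))
    (hle _ hB') (Monotone.directed_le fun F F' h => biSup_mono fun B hB => Finset.mem_of_subset h hB)
  -- The test sets overlap, whereas complete independence concerns disjoint sets. They are cut into
  -- the atoms, inside `D`, of the algebra they generate; `B'` is added as one more disjoint cell,
  -- and each count is a finite sum of atom counts.
  let atom : (F → Bool) → Set (ℝ × ℝ) := fun T =>
    D ∩ ⋂ i : F, if T i then i.1.1 else i.1.1ᶜ
  have hatom : ∀ T, MeasurableSet (atom T) := fun T => by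
    refine hD.inter (MeasurableSet.iInter fun i => ?_)
    split_ifs
    exacts [i.1.2, i.1.2.compl]
  have hatomd : ∀ T T', T ≠ T' → Disjoint (atom T) (atom T') := by
    intro T T' hT
    obtain ⟨i, hi⟩ := Function.ne_iff.1 hT
    rw [Set.disjoint_left]
    rintro x ⟨-, h1⟩ ⟨-, h2⟩
    have h1 := mem_iInter.1 h1 i
    have h2 := mem_iInter.1 h2 i
    cases hTi : T i <;> cases hTi' : T' i <;> simp_all
  let cell : Option (F → Bool) → Set (ℝ × ℝ) := fun o => o.elim B' atom
  have hcell : ∀ o, MeasurableSet (cell o) := by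
    rintro (_ | T)
    exacts [hB', hatom T]
  have hcelld : Pairwise fun o o' => Disjoint (cell o) (cell o') := by
    rintro (_ | T) (_ | T') hne
    · exact absurd rfl hne
    · exact (hDB.mono_left inter_subset_left).symm
    · exact hDB.mono_left inter_subset_left
    · exact hatomd T T' fun h => hne (by rw [h])
  have hind := (hA.iIndepFun_count hcell hcelld).iIndep
  have h1 := indep_iSup_of_disjoint (fun o => hle _ (hcell o)) hind
    (S := range some) (T := {none}) (by simp)
  refine indep_of_indep_of_le h1 (iSup₂_le fun B hB => ?_) (le_iSup₂_of_le none rfl le_rfl)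
  refine Measurable.comap_le ?_
  rw [measurable_enat_iff]
  have hcount : (fun ω => (count A (B.1 ∩ D) ω : ℝ≥0∞)) = fun ω =>
      ∑ T ∈ Finset.univ.filter (fun T : F → Bool => T ⟨B, hB⟩ = true),
        (count A (atom T) ω : ℝ≥0∞) := by
    ext ω
    have hU : B.1 ∩ D = ⋃ T ∈ Finset.univ.filter (fun T : F → Bool => T ⟨B, hB⟩ = true),
        atom T := by
      ext x
      simp only [mem_inter_iff, Finset.mem_filter, Finset.mem_univ, true_and, mem_iUnion,
        exists_prop]
      constructor
      · rintro ⟨h1, h2⟩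
        refine ⟨fun i => decide (x ∈ i.1.1), by simpa using h1, h2, mem_iInter.2 fun i => ?_⟩
        by_cases hx : x ∈ i.1.1 <;> simp [hx]
      · rintro ⟨T, hT, h1, h2⟩
        have := mem_iInter.1 h2 ⟨B, hB⟩
        rw [if_pos hT] at this
        exact ⟨this, h1⟩
    simp only [count]
    rw [← atomMeasure_apply _ (B.2.inter hD), hU,
      measure_biUnion_finset (fun T _ T' _ h => hatomd T T' h) (fun T _ => hatom T)]
    exact Finset.sum_congr rfl fun T _ => atomMeasure_apply _ (hatom T)
  rw [hcount]
  refine Finset.measurable_fun_sum _ fun T _ => measurable_enat_iff.1 ?_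
  exact Measurable.mono (comap_measurable (count A (atom T)))
    (le_iSup₂_of_le (f := fun o (_ : o ∈ range some) =>
      MeasurableSpace.comap (count A (cell o)) inferInstance) (some T) ⟨T, rfl⟩ le_rfl) le_rfl

variable {M P : Type*} {N : Noise Ω M P} {G : ChainGrid P}

theorem sigmaSet_le (hN : N.IsDriving G Pr) (m : M) : sigmaSet (N.π m) ≤ mΩ :=
  iSup₂_le fun B hB => ((hN.poisson m).measurable B hB).comap_le

/-- The atoms after time `s` are independent of the past. -/
theorem indep_filt_count [IsProbabilityMeasure Pr] (hN : N.IsDriving G Pr) (m : M) {s : ℝ}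
    {B : Set (ℝ × ℝ)} (hB : MeasurableSet B) (hBs : B ⊆ Ioi s ×ˢ univ) :
    Indep (N.filt G s) (MeasurableSpace.comap (count (N.π m) B) inferInstance) Pr := by
  have hmem : ∀ D : Set (ℝ × ℝ), MeasurableSet D → ∀ m',
      sigmaSet (fun ω => N.π m' ω ∩ D) ≤ sigmaSet (N.π m') := by
    intro D hD m'
    have := sigmaSet_inter_mono (N := N) m' hD (subset_univ D)
    simpa only [inter_univ] using this
  have hIic : MeasurableSet (Iic s ×ˢ (univ : Set ℝ)) := measurableSet_Iic.prod .univ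
  have hdisj : Disjoint (Iic s ×ˢ (univ : Set ℝ)) B := by
    rw [Set.disjoint_left]
    intro z h1 h2
    exact (not_lt.2 (mem_Iic.1 h1.1)) (mem_Ioi.1 (hBs h2).1)
  have h𝒜ℬ := (hN.poisson m).indep_sigmaSet hIic hB hdisj
  have hσ := sigmaSet_le hN m
  -- `ℋ` collects all the noise other than `π m`. The past is contained in the past of `π m` joined
  -- with `ℋ`.
  obtain ⟨ℋ, hℋ, h1, hℋm, hℋξ⟩ : ∃ ℋ ≤ mΩ, Indep (sigmaSet (N.π m)) ℋ Pr ∧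
      (∀ m', m' ≠ m → sigmaSet (N.π m') ≤ ℋ) ∧
      ∀ p j, MeasurableSpace.comap (N.ξ p j) inferInstance ≤ ℋ := by
    have hind := hN.indep
    generalize h𝒢 : (fun i : M ⊕ (P × ℤ) => Sum.elim (fun m => sigmaSet (N.π m))
      (fun q => MeasurableSpace.comap (N.ξ q.1 q.2) inferInstance) i) = 𝒢 at hind
    have h𝒢m : ∀ m, 𝒢 (.inl m) = sigmaSet (N.π m) := fun m => by rw [← h𝒢]; rfl
    have h𝒢ξ : ∀ p j, 𝒢 (.inr (p, j)) = MeasurableSpace.comap (N.ξ p j) inferInstance :=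
      fun p j => by rw [← h𝒢]; rfl
    have hle : ∀ i, 𝒢 i ≤ mΩ := by
      rintro (m | ⟨p, j⟩)
      · rw [h𝒢m]; exact sigmaSet_le hN m
      · rw [h𝒢ξ]; exact (hN.ξ_measurable p j).comap_le
    have h1 := indep_iSup_of_disjoint hle hind (S := {.inl m}) (T := {.inl m}ᶜ)
      disjoint_compl_right
    simp only [mem_singleton_iff, iSup_iSup_eq_left, h𝒢m] at h1
    refine ⟨_, iSup₂_le fun i _ => hle i, h1, fun m' hm => ?_, fun p j => ?_⟩
    · rw [← h𝒢m]
      exact le_iSup₂_of_le (.inl m') (by simpa using hm) le_rfl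
    · rw [← h𝒢ξ]
      exact le_iSup₂_of_le (.inr (p, j)) (by simp) le_rfl
  have h2 := indep_sup_left_of_indep hσ hℋ (hmem _ hIic m) (le_iSup₂_of_le B hB le_rfl) h𝒜ℬ h1
  refine indep_of_indep_of_le_left h2 (sup_le (iSup_le fun m' => ?_) ?_)
  · by_cases hm : m' = m
    · rw [hm]; exact le_sup_left
    · exact le_sup_of_le_right ((hmem _ hIic m').trans (hℋm m' hm))
  · exact le_sup_of_le_right (iSup_le fun p => iSup_le fun j => iSup_le fun _ => hℋξ p j)

/-- Dropping the zero term and shifting the index turns the mean into `r` times the total mass. -/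
theorem lintegral_poissonMeasure_id (r : ℝ≥0) : ∫⁻ n : ℕ, (n : ℝ≥0∞) ∂(poissonMeasure r) = r := by
  rw [poissonMeasure, lintegral_sum_measure]
  simp_rw [lintegral_smul_measure, lintegral_dirac, smul_eq_mul]
  rw [tsum_eq_zero_add' ENNReal.summable]
  have h : ∀ n : ℕ, ENNReal.ofReal (Real.exp (-r) * r ^ (n + 1) / (n + 1).factorial) *
      ((n + 1 : ℕ) : ℝ≥0∞) =
      r * ENNReal.ofReal (Real.exp (-r) * r ^ n / n.factorial) := by
    intro n
    rw [← ENNReal.ofReal_natCast, ← ENNReal.ofReal_mul (by positivity), ← ENNReal.ofReal_coe_nnreal,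
      ← ENNReal.ofReal_mul (by positivity)]
    congr 1
    rw [Nat.factorial_succ]
    push_cast
    field_simp
    ring
  simp_rw [h]
  rw [ENNReal.tsum_mul_left, ← ENNReal.ofReal_tsum_of_nonneg (fun n => by positivity)
    (hasSum_one_poissonMeasure r).summable, (hasSum_one_poissonMeasure r).tsum_eq]
  simp

theorem IsPoisson.lintegral_count {A : Ω → Set (ℝ × ℝ)} (hA : IsPoisson Pr A) {B : Set (ℝ × ℝ)}
    (hB : MeasurableSet B) (hfin : volume (B ∩ univ ×ˢ Ici (0 : ℝ)) ≠ ∞) :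
    ∫⁻ ω, (count A B ω : ℝ≥0∞) ∂Pr = volume (B ∩ univ ×ˢ Ici (0 : ℝ)) := by
  have h1 : ∫⁻ ω, (count A B ω : ℝ≥0∞) ∂Pr = ∫⁻ n : ℕ∞, (n : ℝ≥0∞) ∂(Pr.map (count A B)) :=
    (lintegral_map measurable_from_top (hA.measurable B hB)).symm
  rw [h1, hA.law B hB hfin, lintegral_map measurable_from_top measurable_from_top]
  simp only [ENat.toENNReal_coe]
  rw [lintegral_poissonMeasure_id, ENNReal.coe_toNNReal hfin]

theorem isPiSystem_predictable : IsPiSystem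
    {R : Set (ℝ × Ω) | ∃ (s t : ℝ) (A : Set Ω), s < t ∧ MeasurableSet[N.filt G s] A ∧
      R = Ioc s t ×ˢ A} := by
  rintro _ ⟨s, t, A, hst, hA, rfl⟩ _ ⟨s', t', A', hst', hA', rfl⟩ hne
  rw [prod_inter_prod, Ioc_inter_Ioc] at hne ⊢
  obtain ⟨⟨x, ω⟩, hx, hω⟩ := hne
  exact ⟨_, _, _, lt_of_lt_of_le hx.1 hx.2, @MeasurableSet.inter _ (N.filt G (s ⊔ s')) _ _
    (filt_mono le_sup_left _ hA) (filt_mono le_sup_right _ hA'), rfl⟩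

/-- The measure on marked processes induced by the atoms of `π m`. -/
def atomLaw (Pr : Measure Ω) (N : Noise Ω M P) (m : M) : Measure ((ℝ × Ω) × ℝ) :=
  (Pr.bind fun ω => (atomMeasure (N.π m ω)).map fun z => ((z.1, ω), z.2))

theorem measurable_marking (ω : Ω) :
    Measurable fun z : ℝ × ℝ => ((z.1, ω), z.2) := by fun_prop

theorem IsPoisson.measurable_tsum {A : Ω → Set (ℝ × ℝ)} (hA : IsPoisson Pr A)
    {H : (ℝ × Ω) × ℝ → ℝ≥0∞} (hH : Measurable H) :
    Measurable fun ω => ∑' z : A ω, H ((z.1.1, ω), z.1.2) :=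
  measurable_tsum_randomSet hA.measurable (D := fun n : ℕ => Metric.closedBall 0 n)
    (fun n => Metric.isClosed_closedBall.measurableSet) (Metric.iUnion_closedBall_nat 0)
    (fun ω n => encard_ne_top_iff.2 (hA.locallyFinite ω _ Metric.isBounded_closedBall))
    (g := fun z : Ω × (ℝ × ℝ) => H ((z.2.1, z.1), z.2.2)) (by fun_prop)

theorem measurable_atomLaw_kernel (hN : N.IsDriving G Pr) (m : M) :
    Measurable fun ω => (atomMeasure (N.π m ω)).map fun z => ((z.1, ω), z.2) := by
  refine Measure.measurable_of_measurable_coe _ fun R hR => ?_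
  have : ∀ ω, (atomMeasure (N.π m ω)).map (fun z => ((z.1, ω), z.2)) R =
      ∑' z : N.π m ω, R.indicator (1 : (ℝ × Ω) × ℝ → ℝ≥0∞) ((z.1.1, ω), z.1.2) := by
    intro ω
    rw [← lintegral_indicator_one hR, lintegral_map (measurable_one.indicator hR)
      (measurable_marking ω), lintegral_atomMeasure]
    exact (measurable_one.indicator hR).comp (measurable_marking ω)
  simp_rw [this]
  exact (hN.poisson m).measurable_tsum (measurable_one.indicator hR)

theorem lintegral_atomLaw (hN : N.IsDriving G Pr) (m : M) {H : (ℝ × Ω) × ℝ → ℝ≥0∞}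
    (hH : Measurable H) :
    ∫⁻ z, H z ∂(atomLaw Pr N m) = ∫⁻ ω, ∑' z : N.π m ω, H ((z.1.1, ω), z.1.2) ∂Pr := by
  rw [atomLaw, Measure.lintegral_bind (measurable_atomLaw_kernel hN m).aemeasurable
    hH.aemeasurable]
  refine lintegral_congr fun ω => ?_
  rw [lintegral_map hH (measurable_marking ω), lintegral_atomMeasure]
  exact hH.comp (measurable_marking ω)

theorem marked_le (hN : N.IsDriving G Pr) :
    marked N G ≤ (inferInstance : MeasurableSpace ((ℝ × Ω) × ℝ)) :=
  sup_le_sup (MeasurableSpace.comap_mono (predictable_le hN)) le_rfl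

/-- On `((s, t] × A) × (-∞, x]` with `A` in `𝓕_s`, independence of the past factors the mean count
as `Pr A` times the Poisson intensity. These rectangles form a π-system generating the marked
predictable σ-algebra, and countably many of finite mass cover the space. Only the trimmed measures
agree, since independence fails for events that look into the future. -/
theorem atomLaw_trim_eq [IsProbabilityMeasure Pr] (hN : N.IsDriving G Pr) (m : M) :
    (atomLaw Pr N m).trim (marked_le hN) =
      ((volume.prod Pr).prod (volume.restrict (Ici (0 : ℝ)))).trim (marked_le hN) := by
  set 𝒞 := {R : Set (ℝ × Ω) | ∃ (s t : ℝ) (A : Set Ω), s < t ∧ MeasurableSet[N.filt G s] A ∧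
      R = Ioc s t ×ˢ A} with h𝒞
  have hneg : ∀ n : ℕ, (-(n + 1) : ℝ) < n + 1 := fun n => by
    have : (0 : ℝ) ≤ n := n.cast_nonneg
    linarith
  have hC : IsCountablySpanning 𝒞 := by
    refine ⟨fun n : ℕ => Ioc (-(n + 1) : ℝ) (n + 1) ×ˢ univ, fun n =>
      ⟨_, _, univ, hneg n, @MeasurableSet.univ _ (N.filt G _), rfl⟩, ?_⟩
    refine eq_univ_of_forall fun ⟨t, ω⟩ => ?_
    obtain ⟨n, hn⟩ := exists_nat_ge |t|
    refine mem_iUnion.2 ⟨n, ⟨?_, ?_⟩, trivial⟩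
    · simp only; linarith [neg_abs_le t]
    · simp only; linarith [le_abs_self t]
  have hD : IsCountablySpanning (range (Iic : ℝ → Set ℝ)) :=
    ⟨fun n : ℕ => Iic (n : ℝ), fun n => ⟨_, rfl⟩, iUnion_Iic_of_not_bddAbove_range (by
      rintro ⟨b, hb⟩
      obtain ⟨n, hn⟩ := exists_nat_gt b
      exact absurd (hb ⟨n, rfl⟩) (not_le.2 hn))⟩
  have hgen : marked N G = MeasurableSpace.generateFrom (image2 (· ×ˢ ·) 𝒞 (range Iic)) := by
    rw [← generateFrom_prod_eq hC hD, ← borel_eq_generateFrom_Iic, ← BorelSpace.measurable_eq]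
  have hgm : ∀ R ∈ image2 (· ×ˢ ·) 𝒞 (range (Iic : ℝ → Set ℝ)), MeasurableSet[marked N G] R := by
    intro R hR
    rw [hgen]
    exact MeasurableSpace.measurableSet_generateFrom hR
  have hval : ∀ s t : ℝ, ∀ A, ∀ x : ℝ, s < t → MeasurableSet[N.filt G s] A →
      (atomLaw Pr N m) ((Ioc s t ×ˢ A) ×ˢ Iic x) =
        ((volume.prod Pr).prod (volume.restrict (Ici (0 : ℝ)))) ((Ioc s t ×ˢ A) ×ˢ Iic x) ∧
      ((volume.prod Pr).prod (volume.restrict (Ici (0 : ℝ)))) ((Ioc s t ×ˢ A) ×ˢ Iic x) ≠ ∞ := by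
    intro s t A x hst hA
    have hA' : MeasurableSet A := filt_le hN s A hA
    have hR : MeasurableSet ((Ioc s t ×ˢ A) ×ˢ Iic x) :=
      (measurableSet_Ioc.prod hA').prod measurableSet_Iic
    have hB : MeasurableSet (Ioc s t ×ˢ Iic x) := measurableSet_Ioc.prod measurableSet_Iic
    have hvol : volume ((Ioc s t ×ˢ Iic x) ∩ univ ×ˢ Ici (0 : ℝ)) =
        ENNReal.ofReal (t - s) * ENNReal.ofReal (x - 0) := by
      rw [prod_inter_prod, inter_univ, inter_comm (Iic x), Ici_inter_Iic, Measure.volume_eq_prod,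
        Measure.prod_prod, Real.volume_Ioc, Real.volume_Icc]
    have hvol' : volume ((Ioc s t ×ˢ Iic x) ∩ univ ×ˢ Ici (0 : ℝ)) ≠ ∞ := by
      rw [hvol]; exact ENNReal.mul_ne_top ENNReal.ofReal_ne_top ENNReal.ofReal_ne_top
    have hprod : ((volume.prod Pr).prod (volume.restrict (Ici (0 : ℝ))))
        ((Ioc s t ×ˢ A) ×ˢ Iic x) = ENNReal.ofReal (t - s) * Pr A * ENNReal.ofReal (x - 0) := by
      rw [Measure.prod_prod, Measure.prod_prod, Measure.restrict_apply measurableSet_Iic,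
        inter_comm (Iic x), Ici_inter_Iic, Real.volume_Ioc, Real.volume_Icc]
    refine ⟨?_, ?_⟩
    · rw [← lintegral_indicator_one hR, lintegral_atomLaw hN m (measurable_one.indicator hR)]
      have e1 : ∀ ω, ∑' z : N.π m ω, ((Ioc s t ×ˢ A) ×ˢ Iic x).indicator
          (1 : (ℝ × Ω) × ℝ → ℝ≥0∞) ((z.1.1, ω), z.1.2) =
          A.indicator 1 ω * (count (N.π m) (Ioc s t ×ˢ Iic x) ω : ℝ≥0∞) := by
        intro ω
        rw [count, ← atomMeasure_apply _ hB, ← lintegral_indicator_one hB,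
          lintegral_atomMeasure _ (measurable_one.indicator hB), ← ENNReal.tsum_mul_left]
        refine tsum_congr fun z => ?_
        classical
        simp only [indicator_apply, mem_prod, Pi.one_apply]
        by_cases h1 : ω ∈ A <;> simp [h1]
      simp_rw [e1]
      rw [lintegral_mul_eq_lintegral_mul_lintegral_of_independent_measurableSpace (filt_le hN s)
        ((hN.poisson m).measurable _ hB).comap_le (indep_filt_count hN m hB (s := s)
          (prod_mono Ioc_subset_Ioi_self (subset_univ _)))
        (f := A.indicator 1) ((@measurable_const _ _ _ (N.filt G s) 1).indicator hA)
        (measurable_enat_iff.1 (comap_measurable _)), lintegral_indicator_one hA',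
        (hN.poisson m).lintegral_count hB hvol', hprod, hvol]
      ring
    · rw [hprod]
      exact ENNReal.mul_ne_top (ENNReal.mul_ne_top ENNReal.ofReal_ne_top (measure_ne_top _ _))
        ENNReal.ofReal_ne_top
  refine @Measure.ext_of_generateFrom_of_iUnion _ (marked N G) _ _
    (image2 (· ×ˢ ·) 𝒞 (range Iic))
    (fun n : ℕ => (Ioc (-(n + 1) : ℝ) (n + 1) ×ˢ univ) ×ˢ Iic (n : ℝ)) hgen
    (isPiSystem_predictable.prod isPiSystem_Iic) ?_ ?_ ?_ ?_
  · refine eq_univ_of_forall fun ⟨⟨t, ω⟩, x⟩ => ?_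
    obtain ⟨n, hn⟩ := exists_nat_ge (max |t| x)
    have h1 := (le_max_left _ _).trans hn
    have h2 := (le_max_right _ _).trans hn
    refine mem_iUnion.2 ⟨n, ⟨⟨?_, ?_⟩, trivial⟩, h2⟩
    · simp only; linarith [neg_abs_le t]
    · simp only; linarith [le_abs_self t]
  · exact fun n => ⟨_, ⟨_, _, univ, hneg n, @MeasurableSet.univ _ (N.filt G _), rfl⟩, _, ⟨_, rfl⟩, rfl⟩
  · intro n
    rw [trim_measurableSet_eq (marked_le hN) (hgm _ ⟨_, ⟨_, _, univ, hneg n,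
      @MeasurableSet.univ _ (N.filt G _), rfl⟩, _, ⟨_, rfl⟩, rfl⟩)]
    have := hval _ _ univ n (hneg n) (@MeasurableSet.univ _ (N.filt G _))
    rw [this.1]; exact this.2
  · rintro _ ⟨_, ⟨s, t, A, hst, hA, rfl⟩, _, ⟨x, rfl⟩, rfl⟩
    have hm := hgm _ ⟨_, ⟨s, t, A, hst, hA, rfl⟩, _, ⟨x, rfl⟩, rfl⟩
    rw [trim_measurableSet_eq (marked_le hN) hm, trim_measurableSet_eq (marked_le hN) hm]
    exact (hval s t A x hst hA).1

/-- The compensation formula for predictable marked processes. -/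
theorem compensation [IsProbabilityMeasure Pr] (hN : N.IsDriving G Pr) (m : M)
    {H : (ℝ × Ω) × ℝ → ℝ≥0∞} (hH : Measurable[marked N G] H) :
    ∫⁻ ω, ∑' z : N.π m ω, H ((z.1.1, ω), z.1.2) ∂Pr =
      ∫⁻ z, H z ∂((volume.prod Pr).prod (volume.restrict (Ici (0 : ℝ)))) := by
  rw [← lintegral_atomLaw hN m (hH.mono (marked_le hN) le_rfl), ← lintegral_trim (marked_le hN) hH,
    ← lintegral_trim (marked_le hN) hH, atomLaw_trim_eq hN m]

end Compensation

/-! ### Deterministic estimates of the memory -/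

section Memory

theorem enorm_tsum_sub_tsum_le {E : Type*} {A A' : Set E} {f : E → ℝ}
    (h : Summable fun s : A => f s) (h' : Summable fun s : A' => f s) :
    ‖∑' s : A, f s - ∑' s : A', f s‖ₑ ≤ ∑' s : ↥(symmDiff A A'), ‖f s‖ₑ := by
  have hs : Summable (A.indicator f) := summable_subtype_iff_indicator.1 h
  have hs' : Summable (A'.indicator f) := summable_subtype_iff_indicator.1 h'
  rw [tsum_subtype A f, tsum_subtype A' f, ← hs.tsum_sub hs',
    tsum_subtype (symmDiff A A') (fun s => ‖f s‖ₑ)]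
  refine (enorm_tsum_le _).trans (ENNReal.tsum_le_tsum fun s => ?_)
  classical
  simp only [indicator_apply, mem_symmDiff]
  by_cases h1 : s ∈ A <;> by_cases h2 : s ∈ A' <;> simp [h1, h2]

variable {M P : Type*} {𝔐 : Params M P} {G : ChainGrid P} {S S' : M → Set ℝ}
  {W W' : P → ℤ → Option ℝ} {α : M ⊕ P} {t : ℝ}

variable [Fintype M] [Fintype P]

/-- The sum over all nodes and chains of the absolute values of the terms of `memory`. -/
def absMemory (𝔐 : Params M P) (G : ChainGrid P) (S : M → Set ℝ)
    (W : P → ℤ → Option ℝ) (α : M ⊕ P) (t : ℝ) : ℝ≥0∞ :=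
  (∑ m, ∑' s : ↥(S m ∩ Iio t), ‖𝔐.h α (.inl m) (t - s)‖ₑ) +
  ∑ p, ∑' j : ↥{j : ℤ | G.time p j < t},
    ‖𝔐.h α (.inr p) (t - G.time p j) * 𝔐.mask α p (W p j)‖ₑ

theorem memoryConverges_iff :
    MemoryConverges 𝔐 G S W α t ↔ absMemory 𝔐 G S W α t ≠ ⊤ := by
  unfold MemoryConverges absMemory
  simp only [summable_iff_tsum_enorm_ne_top, ne_eq, ENNReal.add_eq_top, not_or,
    ENNReal.sum_eq_top, Finset.mem_univ, true_and, not_exists]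

theorem memory_congr (hS : ∀ m, S m ∩ Iio t = S' m ∩ Iio t)
    (hW : ∀ p j, G.time p j < t → W p j = W' p j) :
    memory 𝔐 G S W α t = memory 𝔐 G S' W' α t := by
  unfold memory
  congr 1
  · exact Finset.sum_congr rfl fun m _ => by rw [hS m]
  · refine Finset.sum_congr rfl fun p _ => tsum_congr fun j => ?_
    rw [hW p j j.2]

theorem enorm_memory_le : ‖memory 𝔐 G S W α t‖ₑ ≤ absMemory 𝔐 G S W α t := by
  refine (enorm_add_le _ _).trans (add_le_add ?_ ?_)
  · exact (enorm_sum_le _ _).trans (Finset.sum_le_sum fun m _ => enorm_tsum_le _)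
  · exact (enorm_sum_le _ _).trans (Finset.sum_le_sum fun p _ => enorm_tsum_le _)

/-- Equal chains cancel, and points common to both processes cancel as well. Convergence of both
memories is needed to subtract term by term. -/
theorem enorm_memory_sub_le (h : MemoryConverges 𝔐 G S W α t)
    (h' : MemoryConverges 𝔐 G S' W' α t) (hW : ∀ p j, G.time p j < t → W p j = W' p j) :
    ‖memory 𝔐 G S W α t - memory 𝔐 G S' W' α t‖ₑ ≤
      ∑ m, ∑' s : ↥(symmDiff (S m) (S' m) ∩ Iio t), ‖𝔐.h α (.inl m) (t - s)‖ₑ := by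
  have e : memory 𝔐 G S W α t - memory 𝔐 G S' W' α t =
      ∑ m, (∑' s : ↥(S m ∩ Iio t), 𝔐.h α (.inl m) (t - s) -
        ∑' s : ↥(S' m ∩ Iio t), 𝔐.h α (.inl m) (t - s)) := by
    have : ∀ p, ∑' j : ↥{j : ℤ | G.time p j < t},
        𝔐.h α (.inr p) (t - G.time p j) * 𝔐.mask α p (W p j) =
        ∑' j : ↥{j : ℤ | G.time p j < t},
        𝔐.h α (.inr p) (t - G.time p j) * 𝔐.mask α p (W' p j) :=
      fun p => tsum_congr fun j => by rw [hW p j j.2]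
    unfold memory
    simp_rw [this]
    rw [add_sub_add_right_eq_sub, Finset.sum_sub_distrib]
  rw [e]
  refine (enorm_sum_le _ _).trans (Finset.sum_le_sum fun m _ => ?_)
  have := enorm_tsum_sub_tsum_le (f := fun s => 𝔐.h α (.inl m) (t - s)) (h.1 m) (h'.1 m)
  rwa [← inter_symmDiff_distrib_right] at this

end Memory

/-! ### Uniqueness -/

section Uniqueness

variable {Ω M P : Type*} {mΩ : MeasurableSpace Ω} {Pr : Measure Ω}
  {N : Noise Ω M P} {G : ChainGrid P}

/-- The process `l` on `[t₀, ∞)` is predictable. -/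
def PredictableFrom (N : Noise Ω M P) (G : ChainGrid P) (t₀ : ℝ) (l : ℝ → Ω → ℝ) : Prop :=
  Measurable[N.predictable G] fun z : ℝ × Ω => (Ici t₀).indicator (fun t => l t z.2) z.1

/-- The marked region from `t₀` on where thinning by `l` and by `l'` disagree. -/
def disagree (t₀ : ℝ) (l l' : ℝ → Ω → ℝ) : Set ((ℝ × Ω) × ℝ) :=
  {z | t₀ ≤ z.1.1 ∧ ¬(z.2 ≤ l z.1.1 z.1.2 ↔ z.2 ≤ l' z.1.1 z.1.2)}

/-- The marked region from `t₀` on under the curve `l`. -/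
def under (t₀ : ℝ) (l : ℝ → Ω → ℝ) : Set ((ℝ × Ω) × ℝ) :=
  {z | t₀ ≤ z.1.1 ∧ z.2 ≤ l z.1.1 z.1.2}

theorem measurable_marked_fst :
    @Measurable _ _ (marked N G) (N.predictable G) (Prod.fst : (ℝ × Ω) × ℝ → ℝ × Ω) :=
  @measurable_fst _ _ (N.predictable G) _

theorem measurable_marked_snd : Measurable[marked N G] (Prod.snd : (ℝ × Ω) × ℝ → ℝ) :=
  @measurable_snd _ _ (N.predictable G) _

theorem measurable_marked_time :
    Measurable[marked N G] (fun z : (ℝ × Ω) × ℝ => z.1.1) :=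
  (measurable_fst_predictable (N := N) (G := G)).comp measurable_marked_fst

theorem measurableSet_under {t₀ : ℝ} {l : ℝ → Ω → ℝ} (hl : PredictableFrom N G t₀ l) :
    MeasurableSet[marked N G] (under t₀ l) := by
  have : under t₀ l = {z : (ℝ × Ω) × ℝ | t₀ ≤ z.1.1} ∩
      {z | z.2 ≤ (Ici t₀).indicator (fun t => l t z.1.2) z.1.1} := by
    ext z
    simp only [under, mem_ofPred_eq, mem_inter_iff]
    refine and_congr_right fun h => ?_
    rw [indicator_of_mem (show z.1.1 ∈ Ici t₀ from h)]
  rw [this]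
  exact (measurable_marked_time measurableSet_Ici).inter
    (@measurableSet_le _ _ _ _ _ (marked N G) _ _ _ _ _ measurable_marked_snd
      (hl.comp measurable_marked_fst))

theorem measurableSet_disagree {t₀ : ℝ} {l l' : ℝ → Ω → ℝ} (hl : PredictableFrom N G t₀ l)
    (hl' : PredictableFrom N G t₀ l') : MeasurableSet[marked N G] (disagree t₀ l l') := by
  have : disagree t₀ l l' = symmDiff (under t₀ l) (under t₀ l') := by
    ext z
    simp only [disagree, under, mem_ofPred_eq, mem_symmDiff]
    tauto
  rw [this]
  exact @MeasurableSet.symmDiff _ (marked N G) _ _ (measurableSet_under hl) (measurableSet_under hl')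

theorem hits_eq_zero_iff {m : M} {R : Set ((ℝ × Ω) × ℝ)} {ω : Ω} :
    hits N m R ω = 0 ↔ ∀ z ∈ N.π m ω, ((z.1, ω), z.2) ∉ R := by
  rw [hits, encard_eq_zero, eq_empty_iff_forall_notMem]
  simp only [mem_inter_iff, mem_ofPred_eq, not_and]

theorem ae_swap [SFinite Pr] {t₀ : ℝ} {p : Ω × ℝ → Prop}
    (h : ∀ᵐ z ∂(Pr.prod (volume.restrict (Ici t₀))), p z) :
    ∀ᵐ z ∂((volume : Measure ℝ).prod Pr), t₀ ≤ z.1 → p z.swap := by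
  have h1 : ∀ᵐ z ∂((volume.restrict (Ici t₀)).prod Pr), p z.swap :=
    (Measure.measurePreserving_swap (μ := volume.restrict (Ici t₀))
      (ν := Pr)).quasiMeasurePreserving.ae h
  have e : (volume.restrict (Ici t₀)).prod Pr = ((volume : Measure ℝ).prod Pr).restrict
      (Ici t₀ ×ˢ univ) := by
    rw [← Measure.prod_restrict, Measure.restrict_univ]
  rw [e, ae_restrict_iff' (measurableSet_Ici.prod .univ)] at h1
  filter_upwards [h1] with z hz ht
  exact hz ⟨ht, trivial⟩

/-- Almost surely no atom hits a predictable set of measure zero. -/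
theorem ae_forall_notMem_of_null [IsProbabilityMeasure Pr] (hN : N.IsDriving G Pr) (m : M)
    {E : Set (ℝ × Ω)} (hE : MeasurableSet[N.predictable G] E)
    (h0 : (volume.prod Pr) E = 0) : ∀ᵐ ω ∂Pr, ∀ z ∈ N.π m ω, (z.1, ω) ∉ E := by
  have hR : MeasurableSet[marked N G] (Prod.fst ⁻¹' E : Set ((ℝ × Ω) × ℝ)) :=
    measurable_marked_fst hE
  have hH : Measurable[marked N G] ((Prod.fst ⁻¹' E : Set ((ℝ × Ω) × ℝ)).indicator
      (1 : (ℝ × Ω) × ℝ → ℝ≥0∞)) := (@measurable_const _ _ _ (marked N G) 1).indicator hR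
  have h1 := compensation hN m hH
  rw [lintegral_indicator_one (marked_le hN _ hR)] at h1
  have h2 : ((volume.prod Pr).prod (volume.restrict (Ici (0 : ℝ))))
      (Prod.fst ⁻¹' E : Set ((ℝ × Ω) × ℝ)) = 0 := by
    have : (Prod.fst ⁻¹' E : Set ((ℝ × Ω) × ℝ)) = E ×ˢ univ := by ext; simp
    rw [this, Measure.prod_prod, h0, zero_mul]
  rw [h2, lintegral_eq_zero_iff
    ((hN.poisson m).measurable_tsum (hH.mono (marked_le hN) le_rfl))] at h1
  filter_upwards [h1] with ω hω z hz hzE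
  have := (ENNReal.tsum_eq_zero.1 hω) ⟨z, hz⟩
  simp [hzE] at this

variable {t₀ : ℝ} {C : InitialCondition N G t₀} {X Y : Proc Ω M P}

/-- The thinning equation of the points, at a fixed realization. -/
def ThinAt (N : Noise Ω M P) (t₀ : ℝ) (X : Proc Ω M P) (ω : Ω) : Prop :=
  ∀ m s, t₀ ≤ s → (s ∈ X.points m ω ↔ ∃ x, (s, x) ∈ N.π m ω ∧ x ≤ X.intensity m s ω)

/-- No atom before `t` distinguishes the points of `X` and `Y`, and their chains agree before
`t`. -/
def AgreeBefore (N : Noise Ω M P) (G : ChainGrid P) (t₀ : ℝ) (X Y : Proc Ω M P) (t : ℝ)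
    (ω : Ω) : Prop :=
  (∀ m, ∀ z ∈ N.π m ω, z.1 < t →
    ((z.1, ω), z.2) ∉ disagree t₀ (X.intensity m) (Y.intensity m)) ∧
  ∀ p j, t₀ ≤ G.time p j → G.time p j < t → X.chain p j ω = Y.chain p j ω

theorem points_inter_Iio_of_agreeBefore {t : ℝ} {ω : Ω}
    (hXi : ∀ m, X.points m ω ∩ Iio t₀ = C.node m ω) (hYi : ∀ m, Y.points m ω ∩ Iio t₀ = C.node m ω)
    (hX : ThinAt N t₀ X ω) (hY : ThinAt N t₀ Y ω) (h : AgreeBefore N G t₀ X Y t ω) (m : M) :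
    X.points m ω ∩ Iio t = Y.points m ω ∩ Iio t := by
  ext s
  simp only [mem_inter_iff, mem_Iio]
  refine and_congr_left fun hst => ?_
  rcases lt_or_ge s t₀ with hs | hs
  · have h1 : s ∈ X.points m ω ∩ Iio t₀ ↔ s ∈ Y.points m ω ∩ Iio t₀ := by rw [hXi, hYi]
    simpa [hs] using h1
  · rw [hX m s hs, hY m s hs]
    refine exists_congr fun x => and_congr_right fun hx => ?_
    have := h.1 m (s, x) hx hst
    by_contra hne
    exact this ⟨hs, hne⟩

variable [Fintype M] [Fintype P] {𝔐 : Params M P}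

theorem IsHAR.ae_thinAt (hX : IsHAR Pr G N 𝔐 t₀ C X) : ∀ᵐ ω ∂Pr, ThinAt N t₀ X ω := by
  filter_upwards [hX.points_eq] with ω hω m s hs
  have h := hω m {s} (by simpa using hs)
  constructor
  · intro hsX
    have h1 : (X.points m ω ∩ {s}).encard ≠ 0 := by
      rw [encard_ne_zero]; exact ⟨s, hsX, rfl⟩
    rw [h, encard_ne_zero] at h1
    obtain ⟨⟨s', x⟩, hz, hz1, hz2⟩ := h1
    simp only [mem_singleton_iff] at hz1
    subst hz1
    exact ⟨x, hz, hz2⟩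
  · rintro ⟨x, hx, hxl⟩
    have h1 : (X.points m ω ∩ {s}).encard ≠ 0 := by
      rw [h, encard_ne_zero]; exact ⟨(s, x), hx, rfl, hxl⟩
    rw [encard_ne_zero] at h1
    obtain ⟨s', h2, h3⟩ := h1
    rw [mem_singleton_iff] at h3
    rwa [← h3]

/-- A disagreement strictly before `t` has occurred by some rational `q < t`, and a chain
disagreement is known at its grid time. The complement is thus a countable union of sets `(q, ∞) ×
A` with `A` in `𝓕_q`. -/
theorem measurableSet_agreeBefore (hN : N.IsDriving G Pr) (hX : IsHAR Pr G N 𝔐 t₀ C X)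
    (hY : IsHAR Pr G N 𝔐 t₀ C Y) :
    MeasurableSet[N.predictable G] {z : ℝ × Ω | AgreeBefore N G t₀ X Y z.1 z.2} := by
  let R : M → ℚ → Set ((ℝ × Ω) × ℝ) := fun m q =>
    disagree t₀ (X.intensity m) (Y.intensity m) ∩ {z | z.1.1 ≤ q}
  have e : {z : ℝ × Ω | AgreeBefore N G t₀ X Y z.1 z.2} =
      (⋂ m, ⋂ q : ℚ, (Ioi (q : ℝ) ×ˢ {ω | hits N m (R m q) ω ≠ 0})ᶜ) ∩
      ⋂ p, ⋂ j, ⋂ (_ : t₀ ≤ G.time p j),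
        (Ioi (G.time p j) ×ˢ {ω | X.chain p j ω ≠ Y.chain p j ω})ᶜ := by
    ext ⟨t, ω⟩
    simp only [AgreeBefore, mem_ofPred_eq, mem_inter_iff, mem_iInter, mem_compl_iff, mem_prod,
      mem_Ioi, not_and, ne_eq, not_not]
    refine and_congr (forall_congr' fun m => ?_) Iff.rfl
    constructor
    · intro h q hq
      rw [hits_eq_zero_iff]
      rintro z hz ⟨h1, h2⟩
      exact h z hz (lt_of_le_of_lt h2 hq) h1
    · intro h z hz hzt hzd
      obtain ⟨q, hq1, hq2⟩ := exists_rat_btwn hzt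
      exact hits_eq_zero_iff.1 (h q hq2) z hz ⟨hzd, hq1.le⟩
  rw [e]
  have hcount : Countable M := Finite.to_countable
  have hcount' : Countable P := Finite.to_countable
  refine @MeasurableSet.inter _ (N.predictable G) _ _ (MeasurableSet.iInter fun m =>
    MeasurableSet.iInter fun q => MeasurableSet.compl ?_) (MeasurableSet.iInter fun p =>
    MeasurableSet.iInter fun j => MeasurableSet.iInter fun hj => MeasurableSet.compl ?_)
  · refine predictable_Ioi_prod ?_
    have := measurable_hits hN m (R := R m q)
      ((measurableSet_disagree (hX.intensity_predictable m) (hY.intensity_predictable m)).inter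
        (measurable_marked_time measurableSet_Iic)) (t := q) (fun z hz => hz.2)
    exact this (measurableSet_singleton (0 : ℕ∞)).compl
  · refine predictable_Ioi_prod ?_
    obtain ⟨h1, h2⟩ := optMeasurable_iff.1 (hX.chain_adapted p j hj)
    obtain ⟨h3, h4⟩ := optMeasurable_iff.1 (hY.chain_adapted p j hj)
    have e : {ω | X.chain p j ω ≠ Y.chain p j ω} =
        symmDiff {ω | X.chain p j ω = none} {ω | Y.chain p j ω = none} ∪
        {ω | (X.chain p j ω).getD 0 = (Y.chain p j ω).getD 0}ᶜ := by
      ext ω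
      simp only [mem_ofPred_eq, mem_union, mem_symmDiff, mem_compl_iff]
      cases X.chain p j ω <;> cases Y.chain p j ω <;> simp
    rw [e]
    exact @MeasurableSet.union _ (N.filt G _) _ _ (@MeasurableSet.symmDiff _ (N.filt G _) _ _ h1 h3)
      (@MeasurableSet.compl _ _ (N.filt G _) (measurableSet_eq_fun h2 h4))

/-- Carries uniqueness through the first time of disagreement: agreement of the strict pasts forces
agreement at that time. -/
theorem IsHAR.isModification [IsProbabilityMeasure Pr] (hN : N.IsDriving G Pr)
    (hX : IsHAR Pr G N 𝔐 t₀ C X) (hXe : X.NonExploding Pr)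
    (hY : IsHAR Pr G N 𝔐 t₀ C Y) (hYe : Y.NonExploding Pr) : IsModification Pr t₀ X Y := by
  have hchain : ∀ ω t, AgreeBefore N G t₀ X Y t ω → ∀ p j, G.time p j < t →
      X.chain p j ω = Y.chain p j ω := by
    intro ω t h p j hj
    rcases lt_or_ge (G.time p j) t₀ with h0 | h0
    · rw [hX.chain_init p j ω h0, hY.chain_init p j ω h0]
    · exact h.2 p j h0 hj
  have hnull : ∀ᵐ ω ∂Pr, ∀ m, ∀ z ∈ N.π m ω, t₀ ≤ z.1 → AgreeBefore N G t₀ X Y z.1 ω →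
      X.intensity m z.1 ω = Y.intensity m z.1 ω := by
    rw [ae_all_iff]
    intro m
    -- The intensities are compared only where the pasts agree. There they differ on a null set by
    -- the intensity equations, and predictability of `E` upgrades this from almost every time to
    -- every atom.
    let E : Set (ℝ × Ω) := {z | AgreeBefore N G t₀ X Y z.1 z.2} ∩
      {z | (Ici t₀).indicator (fun t => X.intensity m t z.2) z.1 =
        (Ici t₀).indicator (fun t => Y.intensity m t z.2) z.1}ᶜ
    have hE : MeasurableSet[N.predictable G] E :=
      @MeasurableSet.inter _ (N.predictable G) _ _ (measurableSet_agreeBefore hN hX hY)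
        (@MeasurableSet.compl _ _ (N.predictable G)
          (measurableSet_eq_fun (hX.intensity_predictable m) (hY.intensity_predictable m)))
    have h0 : (volume.prod Pr) E = 0 := by
      have hq := (Measure.quasiMeasurePreserving_snd (μ := (volume : Measure ℝ)) (ν := Pr))
      have hae : ∀ᵐ z ∂((volume : Measure ℝ).prod Pr), z ∉ E := by
        filter_upwards [ae_swap (hX.intensity_eq m),
          ae_swap (hY.intensity_eq m),
          hq.ae hX.ae_thinAt, hq.ae hY.ae_thinAt] with z h1 h2 h3 h4
        rintro ⟨hz, hne⟩
        apply hne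
        rcases lt_or_ge z.1 t₀ with ht | ht
        · simp [ht]
        · simp only [mem_ofPred_eq, indicator_of_mem (show z.1 ∈ Ici t₀ from ht)]
          refine (h1 ht).2.trans (Eq.trans ?_ (h2 ht).2.symm)
          congr 2
          exact memory_congr (points_inter_Iio_of_agreeBefore (hX.points_init · _)
            (hY.points_init · _) h3 h4 hz) (fun p j => hchain _ _ hz p j)
      exact ae_iff.1 hae ▸ by simp
    filter_upwards [ae_forall_notMem_of_null hN m hE h0] with ω hω z hz ht ha
    by_contra hne
    refine hω z hz ⟨ha, ?_⟩
    simpa only [mem_compl_iff, mem_ofPred_eq, indicator_of_mem (show z.1 ∈ Ici t₀ from ht)] using hne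
  have hagree : ∀ᵐ ω ∂Pr, ∀ t, AgreeBefore N G t₀ X Y t ω := by
    filter_upwards [hnull, hX.ae_thinAt, hY.ae_thinAt, hX.chain_eq, hY.chain_eq, hXe, hYe]
      with ω h1 hXt hYt hXc hYc hXe hYe
    let bad : Set ℝ :=
      {s | ∃ m, ∃ z ∈ N.π m ω, z.1 = s ∧
        ((z.1, ω), z.2) ∈ disagree t₀ (X.intensity m) (Y.intensity m)} ∪
      {s | ∃ p j, G.time p j = s ∧ t₀ ≤ s ∧ X.chain p j ω ≠ Y.chain p j ω}
    have hbad : ∀ s, (∀ r ∈ bad, s ≤ r) → AgreeBefore N G t₀ X Y s ω := by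
      refine fun s hs => ⟨fun m z hz hzs hd => ?_, fun p j h0 hj => ?_⟩
      · exact absurd (hs z.1 (Or.inl ⟨m, z, hz, rfl, hd⟩)) (not_le.2 hzs)
      · by_contra hne
        exact absurd (hs _ (Or.inr ⟨p, j, rfl, h0, hne⟩)) (not_le.2 hj)
    -- An atom on which the thinnings differ is a point of `X` or of `Y`, so non-explosion makes bad
    -- times locally finite, and a first one exists unless there are none.
    have hfin : ∀ T, (bad ∩ Icc t₀ T).Finite := by
      intro T
      have hf1 : ((⋃ m, X.points m ω ∩ Icc t₀ T) ∪ (⋃ m, Y.points m ω ∩ Icc t₀ T) ∪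
          ⋃ p, G.time p '' {j | G.time p j ∈ Icc t₀ T}).Finite := by
        refine ((finite_iUnion fun m => hXe m _ (Metric.isBounded_Icc _ _)).union
          (finite_iUnion fun m => hYe m _ (Metric.isBounded_Icc _ _))).union
          (finite_iUnion fun p => Finite.image _ ?_)
        have hp : (0 : ℝ) < G.freq p := by exact_mod_cast G.freq_pos p
        refine (finite_Icc ⌊(t₀ - G.phase p) * G.freq p⌋ ⌈(T - G.phase p) * G.freq p⌉).subset ?_
        rintro j ⟨hj1, hj2⟩
        simp only [ChainGrid.time] at hj1 hj2
        have e : (j : ℝ) / G.freq p * G.freq p = j := by field_simp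
        constructor
        · refine Int.cast_le (R := ℝ).1 ((Int.floor_le _).trans ?_)
          nlinarith
        · refine Int.cast_le (R := ℝ).1 (le_trans ?_ (Int.le_ceil _))
          nlinarith
      refine hf1.subset ?_
      rintro s ⟨hs | hs, hsT⟩
      · obtain ⟨m, z, hz, rfl, h0, hd⟩ := hs
        left
        simp only at h0 hd
        by_cases hx : z.2 ≤ X.intensity m z.1 ω
        · exact Or.inl (mem_iUnion.2 ⟨m, (hXt m z.1 h0).2 ⟨z.2, hz, hx⟩, hsT⟩)
        · refine Or.inr (mem_iUnion.2 ⟨m, (hYt m z.1 h0).2 ⟨z.2, hz, ?_⟩, hsT⟩)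
          tauto
      · obtain ⟨p, j, rfl, -, -⟩ := hs
        exact Or.inr (mem_iUnion.2 ⟨p, j, hsT, rfl⟩)
    have hge : ∀ s ∈ bad, t₀ ≤ s := by
      rintro s (⟨m, z, hz, rfl, h0, hd⟩ | ⟨p, j, rfl, h0, -⟩) <;> exact h0
    have hempty : bad = ∅ := by
      by_contra hne
      obtain ⟨s, hs⟩ := nonempty_iff_ne_empty.2 hne
      obtain ⟨r, ⟨hr, hr0, hrs⟩, hmin⟩ := exists_min_image _ id (hfin s)
        ⟨s, hs, hge s hs, le_rfl⟩
      have hmin' : ∀ u ∈ bad, r ≤ u := by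
        intro u hu
        rcases le_total u s with h | h
        · exact hmin u ⟨hu, hge u hu, h⟩
        · exact hrs.trans h
      have hag := hbad r hmin'
      rcases hr with ⟨m, z, hz, rfl, h0, hd⟩ | ⟨p, j, rfl, h0, hne⟩
      · apply hd
        simp only at h0 ⊢
        rw [h1 m z hz h0 hag]
      · apply hne
        rw [(hXc p j h0).2, (hYc p j h0).2]
        congr 3
        exact memory_congr (points_inter_Iio_of_agreeBefore (hX.points_init · _)
            (hY.points_init · _) hXt hYt hag) (fun p j => hchain _ _ hag p j)
    exact fun t => hbad t (by simp [hempty])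
  have hpoints : ∀ᵐ ω ∂Pr, ∀ m, X.points m ω = Y.points m ω := by
    filter_upwards [hagree, hX.ae_thinAt, hY.ae_thinAt] with ω h1 hXt hYt m
    ext s
    have := points_inter_Iio_of_agreeBefore (hX.points_init · _) (hY.points_init · _) hXt hYt
      (h1 (s + 1)) m
    have := Set.ext_iff.1 this s
    simpa using this
  have hchains : ∀ᵐ ω ∂Pr, ∀ p j, X.chain p j ω = Y.chain p j ω := by
    filter_upwards [hagree] with ω h1 p j
    exact hchain ω _ (h1 (G.time p j + 1)) p j (by linarith)
  refine ⟨fun m => ?_, hpoints, hchains⟩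
  have hq := (Measure.quasiMeasurePreserving_fst (μ := Pr) (ν := volume.restrict (Ici t₀)))
  filter_upwards [hX.intensity_eq m, hY.intensity_eq m, hq.ae hpoints, hq.ae hchains]
    with z h1 h2 h3 h4
  rw [h1.2, h2.2]
  congr 2
  exact memory_congr (fun m => by rw [h3 m]) (fun p j _ => h4 p j)

end Uniqueness

/-! ### Processes obtained by thinning -/

section Thinning

variable {Ω M P : Type*} {N : Noise Ω M P} {G : ChainGrid P} {t₀ : ℝ}
  {C : InitialCondition N G t₀} {𝔐 : Params M P}

open Classical in
/-- The process which continues the initial condition by the thinning of the Poisson random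
measures by `lam` and by the chain values `w`. -/
def procOf (C : InitialCondition N G t₀) (lam : M → ℝ → Ω → ℝ) (w : P → ℤ → Ω → ℝ) :
    Proc Ω M P where
  intensity := lam
  points m ω := C.node m ω ∪ {s | t₀ ≤ s ∧ ∃ x, (s, x) ∈ N.π m ω ∧ x ≤ lam m s ω}
  chain p j ω := if G.time p j < t₀ then C.chain p j ω else some (w p j ω)

/-- The process `X` continues the initial condition in an adapted way. -/
structure IsCausal (C : InitialCondition N G t₀) (X : Proc Ω M P) : Prop where
  points_adapted : ∀ m t, t₀ ≤ t → ∀ B, MeasurableSet B → B ⊆ Iic t →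
    Measurable[N.filt G t] (count (X.points m) B)
  chain_adapted : ∀ p j, t₀ ≤ G.time p j → OptMeasurable (N.filt G (G.time p j)) (X.chain p j)
  points_init : ∀ m ω, X.points m ω ∩ Iio t₀ = C.node m ω
  chain_init : ∀ p j ω, G.time p j < t₀ → X.chain p j ω = C.chain p j ω

variable {lam : M → ℝ → Ω → ℝ} {w : P → ℤ → Ω → ℝ}

theorem mem_procOf_points {m : M} {ω : Ω} {s : ℝ} (hs : t₀ ≤ s) :
    s ∈ (procOf C lam w).points m ω ↔ ∃ x, (s, x) ∈ N.π m ω ∧ x ≤ lam m s ω := by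
  simp only [procOf, mem_union, mem_ofPred_eq, hs, true_and, or_iff_right_iff_imp]
  intro h
  exact absurd (C.node_subset m ω h) (not_lt.2 hs)

theorem procOf_points_init (m : M) (ω : Ω) :
    (procOf C lam w).points m ω ∩ Iio t₀ = C.node m ω := by
  ext s
  simp only [procOf, mem_inter_iff, mem_union, mem_ofPred_eq, mem_Iio]
  constructor
  · rintro ⟨h | h, hs⟩
    exacts [h, absurd h.1 (not_le.2 hs)]
  · exact fun h => ⟨Or.inl h, C.node_subset m ω h⟩

theorem procOf_chain_of_lt {p : P} {j : ℤ} (h : G.time p j < t₀) (ω : Ω) :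
    (procOf C lam w).chain p j ω = C.chain p j ω := if_pos h

theorem procOf_chain_of_le {p : P} {j : ℤ} (h : t₀ ≤ G.time p j) (ω : Ω) :
    (procOf C lam w).chain p j ω = some (w p j ω) := if_neg (not_lt.2 h)

variable [mΩ : MeasurableSpace Ω] {Pr : Measure Ω}

theorem procOf_points_disjoint (hN : N.IsDriving G Pr) (ω : Ω) (m m' : M) (h : m ≠ m') :
    Disjoint ((procOf C lam w).points m ω) ((procOf C lam w).points m' ω) := by
  rw [Set.disjoint_left]
  intro s h1 h2
  rcases lt_or_ge s t₀ with hs | hs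
  · have h1' : s ∈ C.node m ω := by rw [← procOf_points_init (lam := lam) (w := w)]; exact ⟨h1, hs⟩
    have h2' : s ∈ C.node m' ω := by rw [← procOf_points_init (lam := lam) (w := w)]; exact ⟨h2, hs⟩
    exact Set.disjoint_left.1 (C.node_disjoint ω m m' h) h1' h2'
  · obtain ⟨x, hx, -⟩ := (mem_procOf_points hs).1 h1
    obtain ⟨x', hx', -⟩ := (mem_procOf_points hs).1 h2
    exact h (hN.distinct ω m m' s x x' hx hx').1

theorem encard_fst_image (hN : N.IsDriving G Pr) (m : M) (ω : Ω) (R : Set (ℝ × ℝ)) :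
    (Prod.fst '' (N.π m ω ∩ R)).encard = (N.π m ω ∩ R).encard := by
  refine InjOn.encard_image ?_
  rintro ⟨s, x⟩ h1 ⟨s', x'⟩ h2 h
  simp only at h
  subst h
  rw [(hN.distinct ω m m s x x' h1.1 h2.1).2]

theorem procOf_points_eq (hN : N.IsDriving G Pr) (ω : Ω) (m : M) {B : Set ℝ} (hB : B ⊆ Ici t₀) :
    ((procOf C lam w).points m ω ∩ B).encard =
      (N.π m ω ∩ {z | z.1 ∈ B ∧ z.2 ≤ lam m z.1 ω}).encard := by
  rw [← encard_fst_image hN]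
  congr 1
  ext s
  constructor
  · rintro ⟨h1, h2⟩
    obtain ⟨x, hx, hl⟩ := (mem_procOf_points (hB h2)).1 h1
    exact ⟨(s, x), ⟨hx, h2, hl⟩, rfl⟩
  · rintro ⟨⟨s', x⟩, ⟨hx, h2, hl⟩, rfl⟩
    exact ⟨(mem_procOf_points (hB h2)).2 ⟨x, hx, hl⟩, h2⟩

theorem count_procOf_Ici (hN : N.IsDriving G Pr) (m : M) (B : Set ℝ) :
    count ((procOf C lam w).points m) (B ∩ Ici t₀) =
      hits N m (under t₀ (lam m) ∩ {z | z.1.1 ∈ B}) := by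
  ext ω
  rw [count, procOf_points_eq hN ω m inter_subset_right, hits]
  congr 2
  ext z
  simp only [under, mem_ofPred_eq, mem_inter_iff, mem_Ici]
  tauto

/-- Each time carries at most one atom, so a point belongs to exactly one of the two thinnings
precisely when its unique mark separates the two intensities. -/
theorem symmDiff_procOf_eq_image (hN : N.IsDriving G Pr) (m : M) {lam' : M → ℝ → Ω → ℝ}
    {w' : P → ℤ → Ω → ℝ} (B : Set ℝ) (ω : Ω) :
    symmDiff ((procOf C lam w).points m ω) ((procOf C lam' w').points m ω) ∩ (B ∩ Ici t₀) =
      Prod.fst '' (N.π m ω ∩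
        {z | ((z.1, ω), z.2) ∈ disagree t₀ (lam m) (lam' m) ∩ {z | z.1.1 ∈ B}}) := by
  ext s
  constructor
  · rintro ⟨h1, h2, hs⟩
    rw [mem_symmDiff, mem_procOf_points hs, mem_procOf_points hs] at h1
    rcases h1 with ⟨⟨x, hx, hl⟩, hn⟩ | ⟨⟨x, hx, hl⟩, hn⟩
    all_goals
      refine ⟨(s, x), ⟨hx, ⟨hs, fun h => hn ⟨x, hx, ?_⟩⟩, h2⟩, rfl⟩
      simp only at h
      tauto
  · rintro ⟨⟨s', x⟩, ⟨hx, ⟨hs, hl⟩, h2⟩, rfl⟩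
    simp only [mem_ofPred_eq] at hs hl h2
    refine ⟨?_, h2, hs⟩
    have huniq : ∀ x', (s', x') ∈ N.π m ω → x' = x := fun x' hx' =>
      (hN.distinct ω m m s' x' x hx' hx).2
    rw [mem_symmDiff, mem_procOf_points hs, mem_procOf_points hs]
    by_cases h : x ≤ lam m s' ω
    · refine Or.inl ⟨⟨x, hx, h⟩, ?_⟩
      rintro ⟨x', hx', hl'⟩
      rw [huniq x' hx'] at hl'
      tauto
    · refine Or.inr ⟨⟨x, hx, by tauto⟩, ?_⟩
      rintro ⟨x', hx', hl'⟩
      rw [huniq x' hx'] at hl'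
      tauto

/-- The number of points on which two thinnings differ. -/
theorem count_symmDiff_procOf (hN : N.IsDriving G Pr) (m : M) {lam' : M → ℝ → Ω → ℝ}
    {w' : P → ℤ → Ω → ℝ} (B : Set ℝ) :
    count (fun ω => symmDiff ((procOf C lam w).points m ω) ((procOf C lam' w').points m ω))
      (B ∩ Ici t₀) = hits N m (disagree t₀ (lam m) (lam' m) ∩ {z | z.1.1 ∈ B}) := by
  ext ω
  rw [count, hits, symmDiff_procOf_eq_image hN, encard_fst_image hN]

theorem measurable_count_procOf_Ici (hN : N.IsDriving G Pr) (m : M)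
    (hlam : PredictableFrom N G t₀ (lam m)) {t : ℝ} {B : Set ℝ} (hB : MeasurableSet B)
    (hBt : B ⊆ Iic t) :
    Measurable[N.filt G t] (count ((procOf C lam w).points m) (B ∩ Ici t₀)) := by
  rw [count_procOf_Ici hN]
  exact measurable_hits hN m ((measurableSet_under hlam).inter (measurable_marked_time hB))
    fun z hz => hBt hz.2

theorem isCausal_procOf (hN : N.IsDriving G Pr) (hlam : ∀ m, PredictableFrom N G t₀ (lam m))
    (hw : ∀ p j, t₀ ≤ G.time p j → Measurable[N.filt G (G.time p j)] (w p j)) :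
    IsCausal C (procOf C lam w) where
  points_init := procOf_points_init
  chain_init p j ω h := procOf_chain_of_lt h ω
  chain_adapted p j h := by
    rw [optMeasurable_iff]
    simp only [procOf_chain_of_le h]
    exact ⟨by simp, hw p j h⟩
  points_adapted m t ht B hB hBt := by
    -- Splitting at `t₀` separates the points of the initial condition, known before `t₀`, from the
    -- thinned atoms.
    have e : ∀ ω, (count ((procOf C lam w).points m) B ω : ℝ≥0∞) =
        count (C.node m) B ω + count ((procOf C lam w).points m) (B ∩ Ici t₀) ω := by
      intro ω
      simp only [count]
      rw [← procOf_points_init (lam := lam) (w := w), ← ENat.toENNReal_add, ← encard_union_eq]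
      · congr 2
        ext s
        simp only [mem_inter_iff, mem_union, mem_Iio, mem_Ici]
        rcases lt_or_ge s t₀ with h | h <;> simp [h, not_le.2, not_lt.2]
      · rw [Set.disjoint_left]
        rintro s ⟨⟨-, h1⟩, -⟩ ⟨-, -, h2⟩
        exact not_lt.2 (mem_Ici.1 h2) (mem_Iio.1 h1)
    rw [measurable_enat_iff]
    simp_rw [e]
    refine Measurable.add ?_ ?_
    · exact (measurable_enat_iff.1 (C.node_measurable m B hB)).mono
        (filtLeft_le.trans (filt_mono ht)) le_rfl
    · exact measurable_enat_iff.1 (measurable_count_procOf_Ici hN m (hlam m) hB hBt)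

end Thinning

/-! ### The memory of a causal process is predictable -/

section RegMemory

variable {Ω M P : Type*} {N : Noise Ω M P} {G : ChainGrid P} {t₀ : ℝ}
  {C : InitialCondition N G t₀} {𝔐 : Params M P} {X : Proc Ω M P}

open Classical in
-- The count before `t` is the increasing limit of the counts up to rational times `q < t`, which
-- are known at `q`. Adaptedness holds only for `q ≥ t₀`, so at `t = t₀` the supremum contributes
-- nothing, and the maximum with the count of the initial condition supplies the value.
theorem IsCausal.measurable_count_Iio (hX : IsCausal C X) (m : M) {B : Set ℝ}
    (hB : MeasurableSet B) : Measurable[N.predictable G] fun z : ℝ × Ω =>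
      if t₀ ≤ z.1 then ((X.points m z.2 ∩ Iio z.1 ∩ B).encard : ℝ≥0∞) else 0 := by
  have e : (fun z : ℝ × Ω =>
      if t₀ ≤ z.1 then ((X.points m z.2 ∩ Iio z.1 ∩ B).encard : ℝ≥0∞) else 0) =
      fun z => (if t₀ ≤ z.1 then (count (C.node m) B z.2 : ℝ≥0∞) else 0) ⊔
        ⨆ q : ℚ, ⨆ _ : t₀ ≤ q,
          if (q : ℝ) < z.1 then (count (X.points m) (B ∩ Iic (q : ℝ)) z.2 : ℝ≥0∞) else ⊥ := by
    ext ⟨t, ω⟩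
    simp only
    rcases lt_or_ge t t₀ with ht | ht
    · have : ∀ q : ℚ, t₀ ≤ q → ¬ ((q : ℝ) < t) := fun q hq h => by linarith
      simp +contextual [not_le.2 ht, this]
    · rw [if_pos ht, if_pos ht, count, ← hX.points_init m ω]
      refine le_antisymm ?_ (sup_le ?_ (iSup₂_le fun q hq => ?_))
      · rcases ht.eq_or_lt with rfl | ht'
        · exact le_sup_left
        · refine le_sup_of_le_right ?_
          obtain ⟨q₀, hq₀, hq₀'⟩ := exists_rat_btwn ht'
          have hU : X.points m ω ∩ Iio t ∩ B ⊆ X.points m ω ∩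
              ⋃ q : {q : ℚ // t₀ ≤ q ∧ (q : ℝ) < t}, B ∩ Iic (q : ℝ) := by
            rintro s ⟨⟨h1, h2⟩, h3⟩
            obtain ⟨q, hq, hq'⟩ := exists_rat_btwn (show max s t₀ < t from max_lt h2 ht')
            exact ⟨h1, mem_iUnion.2 ⟨⟨q, ((le_max_right _ _).trans_lt hq).le, hq'⟩, h3,
              ((le_max_left _ _).trans_lt hq).le⟩⟩
          have hdir : Directed (· ⊆ ·)
              (fun q : {q : ℚ // t₀ ≤ q ∧ (q : ℝ) < t} => B ∩ Iic (q : ℝ)) := by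
            refine Monotone.directed_le fun q q' h => inter_subset_inter_right _ (Iic_subset_Iic.2 ?_)
            exact_mod_cast h
          calc ((X.points m ω ∩ Iio t ∩ B).encard : ℝ≥0∞)
              ≤ ((X.points m ω ∩ ⋃ q : {q : ℚ // t₀ ≤ q ∧ (q : ℝ) < t},
                  B ∩ Iic (q : ℝ)).encard : ℝ≥0∞) := by
                exact ENat.toENNReal_le.2 (encard_le_encard hU)
            _ = ⨆ q : {q : ℚ // t₀ ≤ q ∧ (q : ℝ) < t},
                  ((X.points m ω ∩ (B ∩ Iic (q : ℝ))).encard : ℝ≥0∞) := by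
                rw [← atomMeasure_apply _ (MeasurableSet.iUnion fun q => hB.inter measurableSet_Iic),
                  hdir.measure_iUnion]
                exact iSup_congr fun q => atomMeasure_apply _ (hB.inter measurableSet_Iic)
            _ ≤ _ := by
                refine iSup_le fun q => le_iSup₂_of_le q.1 q.2.1 ?_
                rw [if_pos q.2.2, count]
      · refine ENat.toENNReal_le.2 (encard_le_encard ?_)
        rintro s ⟨⟨h1, h2⟩, h3⟩
        exact ⟨⟨h1, lt_of_lt_of_le h2 ht⟩, h3⟩
      · split_ifs with h
        · refine ENat.toENNReal_le.2 (encard_le_encard ?_)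
          rintro s ⟨h1, h2, h3⟩
          exact ⟨⟨h1, lt_of_le_of_lt h3 h⟩, h2⟩
        · exact bot_le
  rw [e]
  refine Measurable.sup ?_ ?_
  · exact measurable_ite_Ici (measurable_enat_iff.1 (C.node_measurable m B hB)) 0
  · exact measurable_iSup_predictable fun q hq => measurable_enat_iff.1
      (hX.points_adapted m q hq _ (hB.inter measurableSet_Iic) inter_subset_right)

/-- Before time `t`, the points of `X` are locally finite. -/
def LocFinBefore (X : Proc Ω M P) (t : ℝ) (ω : Ω) : Prop :=
  ∀ m, ∀ n : ℕ, (X.points m ω ∩ Iio t ∩ Icc (-n : ℝ) n).Finite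

theorem measurable_mask {𝓕 : MeasurableSpace Ω} {V : Ω → Option ℝ} (hV : OptMeasurable 𝓕 V)
    (α : M ⊕ P) (p : P) : Measurable[𝓕] fun ω => 𝔐.mask α p (V ω) := by
  classical
  obtain ⟨h1, h2⟩ := optMeasurable_iff.1 hV
  have : (fun ω => 𝔐.mask α p (V ω)) = fun ω => if V ω = none then 0 else 𝔐.κ α p ((V ω).getD 0) := by
    ext ω
    cases V ω <;> simp [Params.mask]
  rw [this]
  obtain ⟨K, hK⟩ := 𝔐.κ_lipschitz α p
  exact Measurable.ite h1 measurable_const (hK.continuous.measurable.comp h2)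

variable [Fintype M] [Fintype P]

open Classical in
/-- The memory, set to `0` where the points are not locally finite. -/
def regMemory (𝔐 : Params M P) (G : ChainGrid P) (t₀ : ℝ) (X : Proc Ω M P) (α : M ⊕ P) (t : ℝ)
    (ω : Ω) : ℝ :=
  if t₀ ≤ t ∧ LocFinBefore X t ω then
    memory 𝔐 G (fun m => X.points m ω) (fun p j => X.chain p j ω) α t else 0

/-- On the predictable set `T` the points before the current time form a locally finite random set
over `ℝ × Ω` with the predictable σ-algebra; off `T` they are replaced by the empty set. The general
measurability of sums over random sets then applies, while the chain terms are countably many and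
individually predictable. -/
theorem IsCausal.measurable_regMemory (hX : IsCausal C X) (α : M ⊕ P) :
    Measurable[N.predictable G] fun z : ℝ × Ω => regMemory 𝔐 G t₀ X α z.1 z.2 := by
  classical
  let T : Set (ℝ × Ω) := {z | t₀ ≤ z.1 ∧ LocFinBefore X z.1 z.2}
  have hT : MeasurableSet[N.predictable G] T := by
    have e : T = {z : ℝ × Ω | t₀ ≤ z.1} ∩ ⋂ m, ⋂ n : ℕ, {z | (if t₀ ≤ z.1 then
        ((X.points m z.2 ∩ Iio z.1 ∩ Icc (-n : ℝ) n).encard : ℝ≥0∞) else 0) = ⊤}ᶜ := by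
      ext z
      simp only [T, LocFinBefore, mem_ofPred_eq, mem_inter_iff, mem_iInter, mem_compl_iff]
      refine and_congr_right fun h => ?_
      simp [h]
    rw [e]
    have hcount : Countable M := Finite.to_countable
    exact (measurable_fst_predictable measurableSet_Ici).inter (MeasurableSet.iInter fun m =>
      MeasurableSet.iInter fun n => MeasurableSet.compl
        (hX.measurable_count_Iio m measurableSet_Icc (measurableSet_singleton ⊤)))
  have hnode : ∀ m, Measurable[N.predictable G] fun z : ℝ × Ω =>
      ∑' s : ↥(if z ∈ T then X.points m z.2 ∩ Iio z.1 else ∅), 𝔐.h α (.inl m) (z.1 - s) := by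
    intro m
    refine @measurable_tsum_randomSet_real ℝ _ (ℝ × Ω) (N.predictable G)
      (fun z => if z ∈ T then X.points m z.2 ∩ Iio z.1 else ∅) (fun B hB => ?_)
      (fun n : ℕ => Icc (-n : ℝ) n) (fun n => measurableSet_Icc) ?_ (fun z n => ?_)
      (fun z => 𝔐.h α (.inl m) (z.1.1 - z.2)) ?_
    · rw [measurable_enat_iff]
      have e : (fun z => (count (fun z => if z ∈ T then X.points m z.2 ∩ Iio z.1 else ∅) B z : ℝ≥0∞)) =
          fun z => if z ∈ T then (if t₀ ≤ z.1 then
            ((X.points m z.2 ∩ Iio z.1 ∩ B).encard : ℝ≥0∞) else 0) else 0 := by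
        ext z
        by_cases hz : z ∈ T
        · simp only [count, hz, if_true, if_pos hz.1]
        · simp [count, hz]
      rw [e]
      exact Measurable.ite hT (hX.measurable_count_Iio m hB) measurable_const
    · refine eq_univ_of_forall fun x => ?_
      obtain ⟨n, hn⟩ := exists_nat_ge |x|
      exact mem_iUnion.2 ⟨n, abs_le.1 hn⟩
    · rw [count, encard_ne_top_iff]
      by_cases hz : z ∈ T
      · simp only [hz, if_true]
        exact hz.2 m n
      · simp [hz]
    · exact (𝔐.h_measurable α (.inl m)).comp
        ((measurable_marked_time (N := N) (G := G)).sub measurable_marked_snd)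
  have hchain : ∀ p, Measurable[N.predictable G] fun z : ℝ × Ω =>
      ∑' j : ℤ, (if t₀ ≤ z.1 ∧ G.time p j < z.1 then 𝔐.mask α p (X.chain p j z.2) else 0) *
        𝔐.h α (.inr p) (z.1 - G.time p j) := by
    intro p
    refine measurable_tsum_of_countable fun j => Measurable.mul ?_
      ((𝔐.h_measurable α (.inr p)).comp (measurable_fst_predictable.sub_const _))
    rcases lt_or_ge (G.time p j) t₀ with h | h
    · have hm := measurable_ite_Ici (measurable_mask (𝔐 := 𝔐) (C.chain_measurable p j) α p) 0
      convert hm using 2 with z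
      rw [hX.chain_init p j z.2 h]
      by_cases hz : t₀ ≤ z.1
      · simp [hz, lt_of_lt_of_le h hz]
      · simp [hz]
    · have hm := measurable_ite_Ioi (measurable_mask (𝔐 := 𝔐) (hX.chain_adapted p j h) α p) 0
      convert hm using 2 with z
      by_cases hz : G.time p j < z.1
      · simp [hz, (h.trans_lt hz).le]
      · simp [hz]
  have e : (fun z : ℝ × Ω => regMemory 𝔐 G t₀ X α z.1 z.2) = fun z => if z ∈ T then
      (∑ m, ∑' s : ↥(if z ∈ T then X.points m z.2 ∩ Iio z.1 else ∅), 𝔐.h α (.inl m) (z.1 - s)) +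
      (∑ p, ∑' j : ℤ, (if t₀ ≤ z.1 ∧ G.time p j < z.1 then 𝔐.mask α p (X.chain p j z.2) else 0) *
        𝔐.h α (.inr p) (z.1 - G.time p j)) else 0 := by
    ext z
    by_cases hz : z ∈ T
    · have hz1 := hz.1
      rw [regMemory, if_pos hz, if_pos (show t₀ ≤ z.1 ∧ LocFinBefore X z.1 z.2 from hz), memory]
      congr 1
      · exact Finset.sum_congr rfl fun m _ => by rw [if_pos hz]
      refine Finset.sum_congr rfl fun p _ => ?_
      rw [tsum_subtype {j : ℤ | G.time p j < z.1} (fun j => 𝔐.h α (.inr p) (z.1 - G.time p j) *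
        𝔐.mask α p (X.chain p j z.2))]
      refine tsum_congr fun j => ?_
      by_cases hj : G.time p j < z.1
      · simp [hj, hz1, mul_comm]
      · simp [hj]
    · rw [regMemory, if_neg hz, if_neg (show ¬(t₀ ≤ z.1 ∧ LocFinBefore X z.1 z.2) from hz)]
  rw [e]
  exact Measurable.ite hT (Measurable.add (Finset.measurable_fun_sum _ fun m _ => hnode m)
    (Finset.measurable_fun_sum _ fun p _ => hchain p)) measurable_const

theorem enorm_regMemory_le {α : M ⊕ P} {t : ℝ} {ω : Ω} : ‖regMemory 𝔐 G t₀ X α t ω‖ₑ ≤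
    absMemory 𝔐 G (fun m => X.points m ω) (fun p j => X.chain p j ω) α t := by
  unfold regMemory
  split_ifs
  · exact enorm_memory_le
  · simp

theorem regMemory_congr {Y : Proc Ω M P} {α : M ⊕ P} {t : ℝ} {ω : Ω}
    (hS : ∀ m, X.points m ω ∩ Iio t = Y.points m ω ∩ Iio t)
    (hW : ∀ p j, G.time p j < t → X.chain p j ω = Y.chain p j ω) :
    regMemory 𝔐 G t₀ X α t ω = regMemory 𝔐 G t₀ Y α t ω := by
  have : LocFinBefore X t ω ↔ LocFinBefore Y t ω := by
    unfold LocFinBefore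
    simp_rw [hS]
  unfold regMemory
  rw [memory_congr hS hW]
  by_cases h : t₀ ≤ t ∧ LocFinBefore X t ω
  · rw [if_pos h, if_pos ⟨h.1, this.1 h.2⟩]
  · rw [if_neg h, if_neg fun h' => h ⟨h'.1, this.2 h'.2⟩]

end RegMemory

/-! ### Picard iteration -/

section Picard

variable {Ω M P : Type*} [Fintype M] [Fintype P] {N : Noise Ω M P} {G : ChainGrid P} {t₀ : ℝ}

/-- The intensities and chain values of the Picard iterates. -/
def picardData (𝔐 : Params M P) (C : InitialCondition N G t₀) :
    ℕ → (M → ℝ → Ω → ℝ) × (P → ℤ → Ω → ℝ)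
  -- Marks are nonnegative, so intensity `-1` produces no points at all after `t₀`; intensity `0`
  -- would keep atoms with mark `0`.
  | 0 => (fun _ _ _ => -1, fun _ _ _ => 0)
  | n + 1 =>
    (fun m t ω => 𝔐.Φnode m (𝔐.μ m + regMemory 𝔐 G t₀
        (procOf C (picardData 𝔐 C n).1 (picardData 𝔐 C n).2) (.inl m) t ω),
      fun p j ω => N.ξ p j ω + 𝔐.Φchain p (regMemory 𝔐 G t₀
        (procOf C (picardData 𝔐 C n).1 (picardData 𝔐 C n).2) (.inr p) (G.time p j) ω))

/-- The Picard iterates. -/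
def picard (𝔐 : Params M P) (C : InitialCondition N G t₀) (n : ℕ) : Proc Ω M P :=
  procOf C (picardData 𝔐 C n).1 (picardData 𝔐 C n).2

theorem picardData_adapted [MeasurableSpace Ω] {Pr : Measure Ω} (hN : N.IsDriving G Pr)
    (𝔐 : Params M P) (h𝔐 : 𝔐.NoExpl) (C : InitialCondition N G t₀) (n : ℕ) :
    (∀ m, PredictableFrom N G t₀ ((picardData 𝔐 C n).1 m)) ∧
      ∀ p j, t₀ ≤ G.time p j → Measurable[N.filt G (G.time p j)] ((picardData 𝔐 C n).2 p j) := by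
  classical
  have hind : ∀ l : ℝ → Ω → ℝ, Measurable[N.predictable G] (fun z : ℝ × Ω => l z.1 z.2) →
      PredictableFrom N G t₀ l := by
    intro l hl
    have : (fun z : ℝ × Ω => (Ici t₀).indicator (fun t => l t z.2) z.1) =
        {z : ℝ × Ω | t₀ ≤ z.1}.indicator fun z => l z.1 z.2 := by
      ext z
      simp [indicator_apply]
    rw [PredictableFrom, this]
    exact hl.indicator (measurable_fst_predictable measurableSet_Ici)
  induction n with
  | zero => exact ⟨fun m => hind _ measurable_const, fun p j _ => measurable_const⟩
  | succ n ih =>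
    have hc := isCausal_procOf hN ih.1 ih.2 (C := C)
    refine ⟨fun m => hind _ ?_, fun p j h => ?_⟩
    · obtain ⟨K, hK⟩ := h𝔐.Φnode_lipschitz m
      exact hK.continuous.measurable.comp ((hc.measurable_regMemory (.inl m)).const_add _)
    · obtain ⟨K, hK⟩ := 𝔐.Φchain_lipschitz p
      exact (measurable_drift_filt le_rfl).add (hK.continuous.measurable.comp
        ((hc.measurable_regMemory (.inr p)).comp (measurable_section_predictable _)))

end Picard

/-! ### Integrated estimates of the memory -/

section Convolution

/-- The function `h` on `(0, ∞)`, in absolute value, extended by `0`. -/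
def posPart (h : ℝ → ℝ) : ℝ → ℝ≥0∞ := (Ioi 0).indicator fun r => ‖h r‖ₑ

theorem measurable_posPart {h : ℝ → ℝ} (hh : Measurable h) : Measurable (posPart h) :=
  hh.enorm.indicator measurableSet_Ioi

theorem measurable_posPart_sub {h : ℝ → ℝ} (hh : Measurable h) (s : ℝ) :
    Measurable fun t => posPart h (t - s) :=
  (measurable_posPart hh).comp (measurable_id.sub_const s)

theorem lintegral_posPart_ne_top {h : ℝ → ℝ} (hh : IntegrableOn h (Ioi 0)) :
    ∫⁻ r, posPart h r ≠ ⊤ := by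
  rw [posPart, lintegral_indicator measurableSet_Ioi]
  exact hh.2.ne

theorem tsum_inter_Iio_eq (D : Set ℝ) (h : ℝ → ℝ) (t : ℝ) :
    ∑' s : ↥(D ∩ Iio t), ‖h (t - s)‖ₑ = ∑' s : D, posPart h (t - s) := by
  classical
  rw [tsum_subtype (D ∩ Iio t) (fun s => ‖h (t - s)‖ₑ), tsum_subtype D (fun s => posPart h (t - s))]
  refine tsum_congr fun s => ?_
  simp only [posPart, indicator_apply, mem_inter_iff, mem_Iio, mem_Ioi, sub_pos]
  by_cases h1 : s ∈ D <;> simp [h1]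

theorem measurable_tsum_inter_Iio {D : Set ℝ} (hD : D.Countable) {h : ℝ → ℝ} (hh : Measurable h) :
    Measurable fun t => ∑' s : ↥(D ∩ Iio t), ‖h (t - s)‖ₑ := by
  have := hD.to_subtype
  simp_rw [tsum_inter_Iio_eq]
  exact Measurable.tsum fun s => measurable_posPart_sub hh s

/-- The exponential weight. -/
def expWeight (c t : ℝ) : ℝ≥0∞ := ENNReal.ofReal (Real.exp (-(c * t)))

theorem measurable_expWeight (c : ℝ) : Measurable (expWeight c) := by
  unfold expWeight; fun_prop

theorem expWeight_add (c s t : ℝ) : expWeight c (s + t) = expWeight c s * expWeight c t := by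
  rw [expWeight, expWeight, expWeight, ← ENNReal.ofReal_mul (Real.exp_nonneg _), ← Real.exp_add]
  congr 2; ring

theorem expWeight_zero (t : ℝ) : expWeight 0 t = 1 := by simp [expWeight]

theorem expWeight_ne_zero (c t : ℝ) : expWeight c t ≠ 0 := by
  simp [expWeight, Real.exp_pos]

theorem expWeight_ne_top (c t : ℝ) : expWeight c t ≠ ⊤ := ENNReal.ofReal_ne_top

theorem expWeight_anti {c s t : ℝ} (hc : 0 ≤ c) (h : s ≤ t) : expWeight c t ≤ expWeight c s := by
  refine ENNReal.ofReal_le_ofReal (Real.exp_le_exp.2 ?_)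
  nlinarith

/-- The weight factors as `exp (-c (t - s)) exp (-c s)`, so Tonelli and translation invariance
decouple the interaction function from the points. -/
theorem lintegral_memory_node_le {D : Set ℝ} (hD : D.Countable) {h : ℝ → ℝ} (hh : Measurable h)
    (c : ℝ) (I : Set ℝ) :
    ∫⁻ t in I, expWeight c t * ∑' s : ↥(D ∩ Iio t), ‖h (t - s)‖ₑ ≤
      (∫⁻ r, expWeight c r * posPart h r) * ∑' s : D, expWeight c s := by
  have := hD.to_subtype
  refine (setLIntegral_le_lintegral _ _).trans ?_
  simp_rw [tsum_inter_Iio_eq, ← ENNReal.tsum_mul_left]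
  rw [lintegral_tsum (fun s : D => ((measurable_expWeight c).fun_mul
    (measurable_posPart_sub hh s)).aemeasurable)]
  refine ENNReal.tsum_le_tsum fun s => ?_
  have e : ∫⁻ t, expWeight c t * posPart h (t - s) =
      ∫⁻ r, expWeight c (r + s) * posPart h (r + s - s) :=
    (lintegral_add_right_eq_self (fun t => expWeight c t * posPart h (t - s)) (s : ℝ)).symm
  have e' : ∀ r, expWeight c (r + s) * posPart h (r + s - s) =
      expWeight c r * posPart h r * expWeight c s := by
    intro r
    rw [add_sub_cancel_right, expWeight_add]
    ring
  simp_rw [e, e']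
  rw [lintegral_mul_const _ ((measurable_expWeight c).fun_mul (measurable_posPart hh))]

/-- Dominated convergence on the positive half-line. This makes the contraction constant small
whatever the `L¹` norm of `h`. -/
theorem lintegral_expWeight_tendsto {h : ℝ → ℝ} (hh : Measurable h)
    (hi : IntegrableOn h (Ioi 0)) :
    Filter.Tendsto (fun n : ℕ => ∫⁻ r, expWeight n r * posPart h r) Filter.atTop (nhds 0) := by
  have h0 : ∫⁻ _r : ℝ, (0 : ℝ≥0∞) = 0 := by simp
  rw [← h0]
  refine tendsto_lintegral_of_dominated_convergence (posPart h)
    (fun n => (measurable_expWeight n).mul (measurable_posPart hh)) (fun n => ?_)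
    (lintegral_posPart_ne_top hi) ?_
  · refine Filter.Eventually.of_forall fun r => ?_
    by_cases hr : 0 < r
    · have : expWeight n r ≤ 1 := by
        rw [expWeight, ← ENNReal.ofReal_one]
        refine ENNReal.ofReal_le_ofReal (Real.exp_le_one_iff.2 ?_)
        have : (0 : ℝ) ≤ n * r := by positivity
        linarith
      calc expWeight n r * posPart h r ≤ 1 * posPart h r := by gcongr
        _ = _ := one_mul _
    · simp [posPart, hr]
  · refine Filter.Eventually.of_forall fun r => ?_
    by_cases hr : 0 < r
    · have h1 : Filter.Tendsto (fun n : ℕ => expWeight n r) Filter.atTop (nhds 0) := by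
        rw [← ENNReal.ofReal_zero]
        refine ENNReal.tendsto_ofReal (Real.tendsto_exp_neg_atTop_nhds_zero.comp ?_)
        exact tendsto_natCast_atTop_atTop.atTop_mul_const hr
      have h2 := ENNReal.Tendsto.mul_const (b := posPart h r) h1
        (Or.inr (by simp [posPart, hr]))
      simpa using h2
    · simp [posPart, hr]

/-- The substitution `r = t - τ i` leaves, for each delay `r`, only the number of `τ i` in a window
of fixed length. -/
theorem tsum_lintegral_posPart {ι : Type*} [Countable ι] (τ : ι → ℝ) {h : ℝ → ℝ}
    (hh : Measurable h) (a b : ℝ) :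
    ∑' i, ∫⁻ t in Icc a b, posPart h (t - τ i) =
      ∫⁻ r, posPart h r * ∑' i, (Icc a b).indicator 1 (r + τ i) := by
  simp_rw [← ENNReal.tsum_mul_left]
  rw [lintegral_tsum]
  · refine tsum_congr fun i => ?_
    have e := lintegral_add_right_eq_self (μ := volume)
      (fun t => (Icc a b).indicator (fun t => posPart h (t - τ i)) t) (τ i)
    rw [← lintegral_indicator measurableSet_Icc, ← e]
    refine lintegral_congr fun r => ?_
    by_cases hr : r + τ i ∈ Icc a b
    · simp [indicator_of_mem hr]
    · simp [indicator_of_notMem hr]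
  · intro i
    exact ((measurable_posPart hh).mul ((measurable_one.indicator measurableSet_Icc).comp
      (measurable_id.add_const _))).aemeasurable

end Convolution

/-! ### Counting chain times in bounded windows. -/

section Grid

variable {P : Type*} (G : ChainGrid P)

theorem ChainGrid.freq_cast_pos (p : P) : (0 : ℝ) < G.freq p := by exact_mod_cast G.freq_pos p

theorem ChainGrid.time_le_iff {p : P} {j : ℤ} {x : ℝ} :
    G.time p j ≤ x ↔ (j : ℝ) ≤ (x - G.phase p) * G.freq p := by
  rw [ChainGrid.time, ← le_sub_iff_add_le', div_le_iff₀ (G.freq_cast_pos p)]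

theorem ChainGrid.le_time_iff {p : P} {j : ℤ} {x : ℝ} :
    x ≤ G.time p j ↔ (x - G.phase p) * G.freq p ≤ j := by
  rw [ChainGrid.time, ← sub_le_iff_le_add', le_div_iff₀ (G.freq_cast_pos p)]

theorem ChainGrid.setOf_time_mem_Icc (p : P) (a b : ℝ) : {j | G.time p j ∈ Icc a b} =
    Icc ⌈(a - G.phase p) * G.freq p⌉ ⌊(b - G.phase p) * G.freq p⌋ := by
  ext j
  simp only [mem_ofPred_eq, mem_Icc, Int.ceil_le, Int.le_floor, G.time_le_iff, G.le_time_iff]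

theorem ChainGrid.finite_time_mem_Icc (p : P) (a b : ℝ) : {j | G.time p j ∈ Icc a b}.Finite := by
  rw [G.setOf_time_mem_Icc]; exact finite_Icc _ _

theorem ChainGrid.encard_time_mem_Icc_le (p : P) (a : ℝ) (L : ℕ) :
    {j | G.time p j ∈ Icc a (a + L)}.encard ≤ (L * G.freq p + 1 : ℕ) := by
  rw [G.setOf_time_mem_Icc, ← Finset.coe_Icc, encard_coe_eq_coe_finsetCard, Int.card_Icc]
  refine Nat.cast_le.2 ?_
  rw [Int.toNat_le]
  push_cast
  have h1 := Int.floor_le ((a + L - G.phase p) * G.freq p)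
  have h2 := Int.le_ceil ((a - G.phase p) * G.freq p)
  have : ((⌊(a + L - G.phase p) * G.freq p⌋ + 1 - ⌈(a - G.phase p) * G.freq p⌉ : ℤ) : ℝ) ≤
      ((L * G.freq p + 1 : ℤ) : ℝ) := by
    push_cast
    linarith
  exact_mod_cast this

end Grid

/-! ### Integrable bounds for the memory of the initial points. -/

section InitialBounds

variable {Ω M P : Type*} [mΩ : MeasurableSpace Ω] {Pr : Measure Ω}
  {N : Noise Ω M P} {G : ChainGrid P} {t₀ : ℝ} {C : InitialCondition N G t₀} {𝔐 : Params M P}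

theorem filtLeft_le_ambient (hN : N.IsDriving G Pr) : N.filtLeft G t₀ ≤ mΩ :=
  filtLeft_le.trans (filt_le hN t₀)

theorem measurable_count_node (hN : N.IsDriving G Pr) (C : InitialCondition N G t₀) (m : M)
    {B : Set ℝ} (hB : MeasurableSet B) : Measurable fun ω => (count (C.node m) B ω : ℝ≥0∞) :=
  (measurable_enat_iff.1 (C.node_measurable m B hB)).mono (filtLeft_le_ambient hN) le_rfl

theorem lintegral_count_node_le (hN : N.IsDriving G Pr) {K : ℝ≥0} (m : M)
    (hK : ∀ a : ℝ, ∫⁻ ω, (count (C.node m) (Icc a (a + 1)) ω : ℝ≥0∞) ∂Pr ≤ K) (a : ℝ) (L : ℕ) :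
    ∫⁻ ω, (count (C.node m) (Icc a (a + L)) ω : ℝ≥0∞) ∂Pr ≤ (L + 1 : ℕ) * K := by
  calc ∫⁻ ω, (count (C.node m) (Icc a (a + L)) ω : ℝ≥0∞) ∂Pr
      ≤ ∫⁻ ω, ∑ i ∈ Finset.range (L + 1),
          (count (C.node m) (Icc (a + i) (a + i + 1)) ω : ℝ≥0∞) ∂Pr := by
        refine lintegral_mono fun ω => ?_
        simp only [count]
        simp_rw [← atomMeasure_apply (C.node m ω) measurableSet_Icc]
        refine (measure_mono ?_).trans (measure_biUnion_finset_le _ _)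
        rintro x ⟨h1, h2⟩
        have h3 : 0 ≤ x - a := by linarith
        refine mem_iUnion₂.2 ⟨⌊x - a⌋₊, ?_, ?_, ?_⟩
        · rw [Finset.mem_range, Nat.lt_succ_iff]
          exact Nat.floor_le_of_le (by linarith)
        · linarith [Nat.floor_le h3]
        · linarith [Nat.lt_floor_add_one (x - a)]
    _ = ∑ i ∈ Finset.range (L + 1),
          ∫⁻ ω, (count (C.node m) (Icc (a + i) (a + i + 1)) ω : ℝ≥0∞) ∂Pr :=
        lintegral_finsetSum _ fun i _ => measurable_count_node hN C m measurableSet_Icc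
    _ ≤ ∑ i ∈ Finset.range (L + 1), (K : ℝ≥0∞) := Finset.sum_le_sum fun i _ => hK _
    _ = _ := by simp

theorem ae_node_finite [Finite M] (hN : N.IsDriving G Pr) (hC : C.IsIntegrable Pr) :
    ∀ᵐ ω ∂Pr, ∀ m, ∀ a b : ℝ, (C.node m ω ∩ Icc a b).Finite := by
  obtain ⟨K, hK, -⟩ := hC
  have h : ∀ᵐ ω ∂Pr, ∀ m, ∀ n : ℕ, (count (C.node m) (Icc (-n : ℝ) (-n + (2 * n : ℕ))) ω : ℝ≥0∞) < ⊤ := by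
    have : Countable M := Finite.to_countable
    rw [ae_all_iff]
    intro m
    rw [ae_all_iff]
    intro n
    refine ae_lt_top (measurable_count_node hN C m measurableSet_Icc) (ne_top_of_le_ne_top ?_
      (lintegral_count_node_le hN m (hK m) _ _))
    exact ENNReal.mul_ne_top (ENNReal.natCast_ne_top _) ENNReal.coe_ne_top
  filter_upwards [h] with ω hω m a b
  obtain ⟨n, hn⟩ := exists_nat_ge (max |a| |b|)
  have h1 := abs_le.1 ((le_max_left _ _).trans hn)
  have h2 := abs_le.1 ((le_max_right _ _).trans hn)
  have h3 := hω m n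
  rw [← ENat.toENNReal_top, ENat.toENNReal_lt, count, encard_lt_top_iff] at h3
  refine h3.subset (inter_subset_inter_right _ (Icc_subset_Icc h1.1 ?_))
  push_cast
  linarith

theorem countable_of_finite_inter {A : Set ℝ} (h : ∀ a b : ℝ, (A ∩ Icc a b).Finite) :
    A.Countable := by
  have : A = ⋃ n : ℕ, A ∩ Icc (-n : ℝ) n := by
    ext x
    simp only [mem_iUnion, mem_inter_iff, exists_and_left, iff_self_and]
    intro _
    obtain ⟨n, hn⟩ := exists_nat_ge |x|
    exact ⟨n, abs_le.1 hn⟩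
  rw [this]
  exact countable_iUnion fun n => (h _ _).countable

/-- For a fixed delay, only initial points in a window of fixed length matter, and their mean number
is bounded uniformly. Tonelli then bounds the mean by a multiple of the `L¹` norm of `h`. -/
theorem exists_bound_node [Finite M] [IsProbabilityMeasure Pr] (hN : N.IsDriving G Pr)
    (hC : C.IsIntegrable Pr) (m : M) {h : ℝ → ℝ} (hh : Measurable h)
    (hi : IntegrableOn h (Ioi 0)) (L : ℕ) :
    ∃ V : Ω → ℝ≥0∞, Measurable V ∧ ∫⁻ ω, V ω ∂Pr ≠ ⊤ ∧
      ∀ᵐ ω ∂Pr, ∫⁻ t in Icc t₀ (t₀ + L), ∑' s : ↥(C.node m ω ∩ Iio t), ‖h (t - s)‖ₑ ≤ V ω := by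
  have hC' := hC
  obtain ⟨K, hK, -⟩ := hC'
  -- For `n ≤ r < n + 1`, the relevant points lie in `[t₀ - r, t₀ - r + L]`, hence in this window of
  -- length `L + 1`. Discretizing the delay gives joint measurability from countably many counts.
  obtain ⟨U, hUeq⟩ : ∃ U : Ω × ℕ → ℝ≥0∞, ∀ ω n, U (ω, n) =
      count (C.node m) (Icc (t₀ - n - 1) (t₀ - n - 1 + (L + 1 : ℕ))) ω :=
    ⟨fun z => count (C.node m) (Icc (t₀ - z.2 - 1) (t₀ - z.2 - 1 + (L + 1 : ℕ))) z.1,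
      fun _ _ => rfl⟩
  have hU : Measurable U := by
    refine measurable_from_prod_countable_left fun n => ?_
    simp_rw [hUeq]
    exact measurable_count_node hN C m measurableSet_Icc
  have hV' : Measurable fun z : Ω × ℝ => posPart h z.2 * U (z.1, ⌊z.2⌋₊) :=
    ((measurable_posPart hh).comp measurable_snd).mul
      (hU.comp (measurable_fst.prodMk (Nat.measurable_floor.comp measurable_snd)))
  refine ⟨fun ω => ∫⁻ r, posPart h r * U (ω, ⌊r⌋₊), hV'.lintegral_prod_right', ?_, ?_⟩
  · rw [lintegral_lintegral_swap hV'.aemeasurable]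
    refine ne_top_of_le_ne_top (ENNReal.mul_ne_top (lintegral_posPart_ne_top hi)
      (b := ((L + 1 + 1 : ℕ) : ℝ≥0∞) * K) (ENNReal.mul_ne_top (ENNReal.natCast_ne_top _) ENNReal.coe_ne_top)) ?_
    rw [← lintegral_mul_const _ (measurable_posPart hh)]
    refine lintegral_mono fun r => ?_
    have hr : Measurable fun ω => U (ω, ⌊r⌋₊) := hU.comp measurable_prodMk_right
    simp only
    rw [lintegral_const_mul _ hr]
    gcongr
    simp_rw [hUeq]
    exact lintegral_count_node_le hN m (hK m) _ (L + 1)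
  · filter_upwards [ae_node_finite hN hC] with ω hω
    have hc := countable_of_finite_inter (hω m)
    have := hc.to_subtype
    simp_rw [tsum_inter_Iio_eq]
    rw [lintegral_tsum (fun s : C.node m ω => (measurable_posPart_sub hh s).aemeasurable),
      tsum_lintegral_posPart (fun s : C.node m ω => (s : ℝ)) hh]
    refine lintegral_mono fun r => ?_
    simp only
    by_cases hr : 0 < r
    · gcongr
      rw [hUeq, count]
      rw [← atomMeasure_apply _ measurableSet_Icc, ← lintegral_indicator_one measurableSet_Icc,
        lintegral_atomMeasure _ (measurable_one.indicator measurableSet_Icc)]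
      refine ENNReal.tsum_le_tsum fun s => ?_
      by_cases hs : r + s ∈ Icc t₀ (t₀ + L)
      · rw [indicator_of_mem hs, indicator_of_mem]
        · rfl
        · have h1 := Nat.floor_le hr.le
          have h2 := Nat.lt_floor_add_one r
          obtain ⟨h3, h4⟩ := hs
          constructor
          · linarith
          · push_cast; linarith
      · rw [indicator_of_notMem hs]; exact zero_le
    · simp [posPart, hr]

end InitialBounds

/-! ### Integrable bounds for the memory of the initial chains. -/

section ChainBounds

variable {Ω M P : Type*} {N : Noise Ω M P} {G : ChainGrid P} {t₀ : ℝ}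
  {C : InitialCondition N G t₀} {𝔐 : Params M P}

theorem tsum_chain_eq (G : ChainGrid P) (p : P) (h : ℝ → ℝ) (v : ℤ → ℝ) (t : ℝ) :
    ∑' j : ↥{j : ℤ | G.time p j < t}, ‖h (t - G.time p j) * v j‖ₑ =
      ∑' j : ℤ, posPart h (t - G.time p j) * ‖v j‖ₑ := by
  classical
  rw [tsum_subtype {j : ℤ | G.time p j < t} (fun j => ‖h (t - G.time p j) * v j‖ₑ)]
  refine tsum_congr fun j => ?_
  simp only [posPart, indicator_apply, mem_ofPred_eq, mem_Ioi, sub_pos, enorm_mul]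
  split_ifs <;> simp

theorem exists_enorm_le_of_lipschitz {f : ℝ → ℝ} (hf : ∃ K : ℝ≥0, LipschitzWith K f) :
    ∃ K : ℝ≥0, (∀ x, ‖f x‖ₑ ≤ K * (1 + ‖x‖ₑ)) ∧ ∀ x y, ‖f x - f y‖ₑ ≤ K * ‖x - y‖ₑ := by
  obtain ⟨K, hK⟩ := hf
  have hd : ∀ x y, ‖f x - f y‖ₑ ≤ K * ‖x - y‖ₑ := fun x y => by
    have := hK x y
    rwa [edist_eq_enorm_sub, edist_eq_enorm_sub] at this
  refine ⟨K + ‖f 0‖₊, fun x => ?_, fun x y => (hd x y).trans ?_⟩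
  · have h1 : ‖f x‖ₑ ≤ ‖f x - f 0‖ₑ + ‖f 0‖ₑ := by
      have := enorm_add_le (f x - f 0) (f 0)
      rwa [sub_add_cancel] at this
    have h2 := hd x 0
    rw [sub_zero] at h2
    refine h1.trans ((add_le_add_left h2 _).trans ?_)
    rw [ENNReal.coe_add, add_mul, mul_add, mul_add]
    have h3 : ‖f 0‖ₑ = (‖f 0‖₊ : ℝ≥0∞) := rfl
    rw [h3, mul_one, mul_one]
    exact add_le_add le_add_self le_self_add
  · gcongr
    exact le_self_add

theorem exists_enorm_mask_le (𝔐 : Params M P) (α : M ⊕ P) (p : P) :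
    ∃ K : ℝ≥0, ∀ v : Option ℝ, ‖𝔐.mask α p v‖ₑ ≤ K * (1 + ‖v.getD 0‖ₑ) := by
  obtain ⟨K, hK, -⟩ := exists_enorm_le_of_lipschitz (𝔐.κ_lipschitz α p)
  refine ⟨K, fun v => ?_⟩
  cases v with
  | none => simp [Params.mask]
  | some x => simpa [Params.mask] using hK x

variable [mΩ : MeasurableSpace Ω] {Pr : Measure Ω}

/-- Whatever the delay, a window of length `L` contains at most `L * freq + 1` times of the chain.
-/
theorem tsum_lintegral_grid_ne_top (G : ChainGrid P) (p : P) {h : ℝ → ℝ} (hh : Measurable h)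
    (hi : IntegrableOn h (Ioi 0)) (t₀ : ℝ) (L : ℕ) :
    ∑' j : ℤ, ∫⁻ t in Icc t₀ (t₀ + L), posPart h (t - G.time p j) ≠ ⊤ := by
  rw [tsum_lintegral_posPart _ hh]
  refine ne_top_of_le_ne_top (ENNReal.mul_ne_top (lintegral_posPart_ne_top hi)
    (ENNReal.natCast_ne_top (L * G.freq p + 1))) ?_
  rw [← lintegral_mul_const _ (measurable_posPart hh)]
  refine lintegral_mono fun r => ?_
  gcongr
  have e : ∑' j : ℤ, (Icc t₀ (t₀ + L)).indicator (1 : ℝ → ℝ≥0∞) (r + G.time p j) =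
      ({j | G.time p j ∈ Icc (t₀ - r) (t₀ - r + L)}.encard : ℝ≥0∞) := by
    classical
    rw [← ENNReal.tsum_set_one, tsum_subtype {j | G.time p j ∈ Icc (t₀ - r) (t₀ - r + L)}
      (fun _ => (1 : ℝ≥0∞))]
    refine tsum_congr fun j => ?_
    have : r + G.time p j ∈ Icc t₀ (t₀ + L) ↔ G.time p j ∈ Icc (t₀ - r) (t₀ - r + L) := by
      simp only [mem_Icc]
      constructor <;> rintro ⟨h1, h2⟩ <;> constructor <;> linarith
    simp only [indicator_apply, mem_ofPred_eq, this, Pi.one_apply]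
  rw [e, ← ENat.toENNReal_coe]
  exact ENat.toENNReal_le.2 (G.encard_time_mem_Icc_le p _ L)

/-- Integrating in time first leaves a deterministic summable family of coefficients. The mean
masked values are bounded uniformly, because masks grow at most linearly. -/
theorem exists_bound_chain [IsProbabilityMeasure Pr] (hN : N.IsDriving G Pr)
    (hC : C.IsIntegrable Pr) (α : M ⊕ P) (p : P) {h : ℝ → ℝ} (hh : Measurable h)
    (hi : IntegrableOn h (Ioi 0)) (L : ℕ) :
    ∃ V : Ω → ℝ≥0∞, Measurable V ∧ ∫⁻ ω, V ω ∂Pr ≠ ⊤ ∧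
      ∀ ω, ∫⁻ t in Icc t₀ (t₀ + L), ∑' j : ↥{j : ℤ | G.time p j < t},
        ‖h (t - G.time p j) * 𝔐.mask α p (C.chain p j ω)‖ₑ ≤ V ω := by
  obtain ⟨K, -, hK⟩ := hC
  obtain ⟨K', hK'⟩ := exists_enorm_mask_le 𝔐 α p
  have hmask : ∀ j, Measurable fun ω => ‖𝔐.mask α p (C.chain p j ω)‖ₑ := fun j =>
    ((measurable_mask (C.chain_measurable p j) α p).mono (filtLeft_le_ambient hN) le_rfl).enorm
  have hgetD : ∀ j, Measurable fun ω => ‖(C.chain p j ω).getD 0‖ₑ := fun j =>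
    ((optMeasurable_iff.1 (C.chain_measurable p j)).2.mono (filtLeft_le_ambient hN) le_rfl).enorm
  refine ⟨fun ω => ∑' j : ℤ, (∫⁻ t in Icc t₀ (t₀ + L), posPart h (t - G.time p j)) *
    ‖𝔐.mask α p (C.chain p j ω)‖ₑ, Measurable.tsum fun j => (hmask j).const_mul _, ?_, ?_⟩
  · rw [lintegral_tsum fun j => ((hmask j).const_mul _).aemeasurable]
    refine ne_top_of_le_ne_top (ENNReal.mul_ne_top
      (tsum_lintegral_grid_ne_top G p hh hi t₀ L)
      (b := (K' : ℝ≥0∞) * (1 + K)) (ENNReal.mul_ne_top ENNReal.coe_ne_top (by simp))) ?_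
    rw [← ENNReal.tsum_mul_right]
    refine ENNReal.tsum_le_tsum fun j => ?_
    rw [lintegral_const_mul _ (hmask j)]
    gcongr
    calc ∫⁻ ω, ‖𝔐.mask α p (C.chain p j ω)‖ₑ ∂Pr
        ≤ ∫⁻ ω, K' * (1 + ‖(C.chain p j ω).getD 0‖ₑ) ∂Pr := lintegral_mono fun ω => hK' _
      _ = K' * (1 + ∫⁻ ω, ‖(C.chain p j ω).getD 0‖ₑ ∂Pr) := by
          rw [lintegral_const_mul _ ((hgetD j).const_add _), lintegral_add_left measurable_const]
          simp
      _ ≤ _ := by gcongr; exact hK p j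
  · intro ω
    simp_rw [tsum_chain_eq G p h (fun j => 𝔐.mask α p (C.chain p j ω))]
    rw [lintegral_tsum fun j : ℤ => ((measurable_posPart_sub hh _).mul_const _).aemeasurable]
    refine ENNReal.tsum_le_tsum fun j => ?_
    rw [lintegral_mul_const _ (measurable_posPart_sub hh _)]

variable [Fintype M] [Fintype P]

/-- The contribution of the initial condition to the node equations is integrable in time, with
an integrable bound. -/
theorem exists_bound_absMemory [IsProbabilityMeasure Pr] (hN : N.IsDriving G Pr)
    (h𝔐 : 𝔐.NoExpl) (hC : C.IsIntegrable Pr) (m : M) (L : ℕ) :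
    ∃ V : Ω → ℝ≥0∞, Measurable V ∧ ∫⁻ ω, V ω ∂Pr ≠ ⊤ ∧
      ∀ᵐ ω ∂Pr, ∫⁻ t in Icc t₀ (t₀ + L),
        absMemory 𝔐 G (fun m => C.node m ω) (fun p j => C.chain p j ω) (.inl m) t ≤ V ω := by
  choose V hVm hVi hV using fun m' => exists_bound_node hN hC m'
    (𝔐.h_measurable (.inl m) (.inl m')) (h𝔐.node_node m m') L
  choose V' hVm' hVi' hV' using fun p => exists_bound_chain (𝔐 := 𝔐) hN hC (.inl m) p
    (𝔐.h_measurable (.inl m) (.inr p)) (h𝔐.node_chain m p) L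
  refine ⟨fun ω => ∑ m', V m' ω + ∑ p, V' p ω, (Finset.measurable_fun_sum _ fun m' _ => hVm m').add
    (Finset.measurable_fun_sum _ fun p _ => hVm' p), ?_, ?_⟩
  · rw [lintegral_add_left (Finset.measurable_fun_sum _ fun m' _ => hVm m'),
      lintegral_finsetSum _ fun m' _ => hVm m', lintegral_finsetSum _ fun p _ => hVm' p]
    exact ENNReal.add_ne_top.2 ⟨ENNReal.sum_ne_top.2 fun m' _ => hVi m',
      ENNReal.sum_ne_top.2 fun p _ => hVi' p⟩
  · filter_upwards [ae_all_iff.2 hV, ae_node_finite hN hC] with ω h1 h2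
    have hmeas : ∀ m', Measurable fun t =>
        ∑' s : ↥(C.node m' ω ∩ Iio t), ‖𝔐.h (.inl m) (.inl m') (t - s)‖ₑ := fun m' =>
      measurable_tsum_inter_Iio (countable_of_finite_inter (h2 m')) (𝔐.h_measurable _ _)
    have hmeas' : ∀ p, Measurable fun t => ∑' j : ↥{j : ℤ | G.time p j < t},
        ‖𝔐.h (.inl m) (.inr p) (t - G.time p j) * 𝔐.mask (.inl m) p (C.chain p j ω)‖ₑ := by
      intro p
      simp_rw [tsum_chain_eq G p (𝔐.h (.inl m) (.inr p)) (fun j => 𝔐.mask (.inl m) p (C.chain p j ω))]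
      exact Measurable.tsum fun j => (measurable_posPart_sub (𝔐.h_measurable _ _) _).mul_const _
    unfold absMemory
    rw [lintegral_add_left (Finset.measurable_fun_sum _ fun m' _ => hmeas m'),
      lintegral_finsetSum _ fun m' _ => hmeas m', lintegral_finsetSum _ fun p _ => hmeas' p]
    exact add_le_add (Finset.sum_le_sum fun m' _ => h1 m') (Finset.sum_le_sum fun p _ => hV' p ω)

end ChainBounds

/-! ### Separating the memory of the initial condition from that of later times. -/

section AbsMemory

variable {Ω M P : Type*} [Fintype M] [Fintype P] {N : Noise Ω M P} {G : ChainGrid P} {t₀ : ℝ}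
  {C : InitialCondition N G t₀} {𝔐 : Params M P} {X : Proc Ω M P} {ω : Ω}

theorem absMemory_le_initial (hS : ∀ m, X.points m ω ∩ Iio t₀ = C.node m ω)
    (hW : ∀ p j, G.time p j < t₀ → X.chain p j ω = C.chain p j ω) (α : M ⊕ P) (t : ℝ) :
    absMemory 𝔐 G (fun m => X.points m ω) (fun p j => X.chain p j ω) α t ≤
      absMemory 𝔐 G (fun m => C.node m ω) (fun p j => C.chain p j ω) α t +
      ((∑ m, ∑' s : ↥((X.points m ω ∩ Ico t₀ t) ∩ Iio t), ‖𝔐.h α (.inl m) (t - s)‖ₑ) +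
      ∑ p, ∑' j : ↥{j : ℤ | G.time p j ∈ Ico t₀ t},
        posPart (𝔐.h α (.inr p)) (t - G.time p j) * ‖𝔐.mask α p (X.chain p j ω)‖ₑ) := by
  unfold absMemory
  rw [add_add_add_comm, ← Finset.sum_add_distrib, ← Finset.sum_add_distrib]
  refine add_le_add (Finset.sum_le_sum fun m _ => ?_) (Finset.sum_le_sum fun p _ => ?_)
  · have hsub : X.points m ω ∩ Iio t ⊆
        (C.node m ω ∩ Iio t) ∪ ((X.points m ω ∩ Ico t₀ t) ∩ Iio t) := by
      rintro s ⟨h1, h2⟩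
      rcases lt_or_ge s t₀ with h | h
      · left
        rw [← hS m]
        exact ⟨⟨h1, h⟩, h2⟩
      · exact Or.inr ⟨⟨h1, h, h2⟩, h2⟩
    exact (ENNReal.tsum_mono_subtype (fun s => ‖𝔐.h α (.inl m) (t - s)‖ₑ) hsub).trans
      (ENNReal.tsum_union_le (fun s => ‖𝔐.h α (.inl m) (t - s)‖ₑ) _ _)
  · rw [tsum_chain_eq G p (𝔐.h α (.inr p)) (fun j => 𝔐.mask α p (X.chain p j ω)),
      tsum_chain_eq G p (𝔐.h α (.inr p)) (fun j => 𝔐.mask α p (C.chain p j ω)),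
      tsum_subtype {j : ℤ | G.time p j ∈ Ico t₀ t} (fun j => posPart (𝔐.h α (.inr p))
        (t - G.time p j) * ‖𝔐.mask α p (X.chain p j ω)‖ₑ), ← ENNReal.tsum_add]
    refine ENNReal.tsum_le_tsum fun j => ?_
    rcases lt_or_ge (G.time p j) t₀ with h | h
    · rw [hW p j h]; exact le_self_add
    · rcases lt_or_ge (G.time p j) t with h' | h'
      · rw [indicator_of_mem (show j ∈ {j : ℤ | G.time p j ∈ Ico t₀ t} from ⟨h, h'⟩)]
        exact le_add_self
      · rw [posPart, indicator_of_notMem (by simpa using h')]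
        simp

theorem posPart_ne_top (h : ℝ → ℝ) (r : ℝ) : posPart h r ≠ ⊤ := by
  by_cases hr : 0 < r <;> simp [posPart, hr]

theorem tsum_ne_top_of_finite {ι : Type*} {A : Set ι} (hA : A.Finite) {f : ι → ℝ≥0∞}
    (hf : ∀ i, f i ≠ ⊤) : ∑' i : A, f i ≠ ⊤ := by
  have := hA.fintype
  rw [tsum_fintype]
  exact ENNReal.sum_ne_top.2 fun i _ => hf i

/-- After `t₀` the memory has only finitely many terms, each finite, so only the initial condition
can cause divergence. -/
theorem memoryConverges_of_initial (hS : ∀ m, X.points m ω ∩ Iio t₀ = C.node m ω)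
    (hW : ∀ p j, G.time p j < t₀ → X.chain p j ω = C.chain p j ω) {α : M ⊕ P} {t : ℝ}
    (hC : absMemory 𝔐 G (fun m => C.node m ω) (fun p j => C.chain p j ω) α t ≠ ⊤)
    (hfin : ∀ m, (X.points m ω ∩ Ico t₀ t).Finite) :
    MemoryConverges 𝔐 G (fun m => X.points m ω) (fun p j => X.chain p j ω) α t := by
  rw [memoryConverges_iff]
  refine ne_top_of_le_ne_top ?_ (absMemory_le_initial hS hW α t)
  refine ENNReal.add_ne_top.2 ⟨hC, ENNReal.add_ne_top.2 ⟨ENNReal.sum_ne_top.2 fun m _ => ?_,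
    ENNReal.sum_ne_top.2 fun p _ => ?_⟩⟩
  · exact tsum_ne_top_of_finite (f := fun s => ‖𝔐.h α (.inl m) (t - s)‖ₑ)
      ((hfin m).subset inter_subset_left) fun s => enorm_ne_top
  · exact tsum_ne_top_of_finite (f := fun j => posPart (𝔐.h α (.inr p))
        (t - G.time p j) * ‖𝔐.mask α p (X.chain p j ω)‖ₑ)
      ((G.finite_time_mem_Icc p t₀ t).subset fun j hj => ⟨hj.1, hj.2.le⟩)
      fun j => ENNReal.mul_ne_top (posPart_ne_top _ _) enorm_ne_top

end AbsMemory

/-! ### The Picard iteration between two chain times -/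

section Compensator

variable {Ω M P : Type*} {N : Noise Ω M P} {G : ChainGrid P} {t₀ : ℝ}
  {C : InitialCondition N G t₀} {lam lam' : M → ℝ → Ω → ℝ} {w w' : P → ℤ → Ω → ℝ}

theorem measurable_marked_symmDiff (hlam : ∀ m, PredictableFrom N G t₀ (lam m))
    (hlam' : ∀ m, PredictableFrom N G t₀ (lam' m)) (m : M) (a b : ℝ)
    {g : ℝ → ℝ≥0∞} (hg : Measurable g) :
    Measurable[marked N G] ((disagree t₀ (lam m) (lam' m) ∩ {z | z.1.1 ∈ Ioc a b}).indicator
        (fun z => g z.1.1)) :=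
  (hg.comp (measurable_marked_time (N := N) (G := G))).indicator
    ((measurableSet_disagree (hlam m) (hlam' m)).inter (measurable_marked_time measurableSet_Ioc))

variable [mΩ : MeasurableSpace Ω] {Pr : Measure Ω}

/-- Writes the sum over differing points as a sum over all atoms of a predictable marked function,
the form required by the compensation formula. -/
theorem tsum_symmDiff_procOf (hN : N.IsDriving G Pr) (m : M) {a b : ℝ} (ha : t₀ ≤ a)
    (g : ℝ → ℝ≥0∞) (ω : Ω) :
    ∑' s : ↥(symmDiff ((procOf C lam w).points m ω) ((procOf C lam' w').points m ω) ∩ Ioc a b), g s =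
      ∑' z : N.π m ω, (disagree t₀ (lam m) (lam' m) ∩ {z | z.1.1 ∈ Ioc a b}).indicator
        (fun z => g z.1.1) ((z.1.1, ω), z.1.2) := by
  classical
  have e : Ioc a b = Ioc a b ∩ Ici t₀ :=
    (inter_eq_left.2 fun s hs => ha.trans hs.1.le).symm
  have hinj : InjOn Prod.fst (N.π m ω ∩ {z | ((z.1, ω), z.2) ∈
      disagree t₀ (lam m) (lam' m) ∩ {z | z.1.1 ∈ Ioc a b}}) := by
    rintro ⟨s, x⟩ h1 ⟨s', x'⟩ h2 h
    simp only at h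
    subst h
    rw [(hN.distinct ω m m s x x' h1.1 h2.1).2]
  have h1 := tsum_image g hinj
  rw [← symmDiff_procOf_eq_image (C := C) (w := w) (w' := w') hN, ← e] at h1
  rw [h1, tsum_subtype (N.π m ω ∩ {z | ((z.1, ω), z.2) ∈
      disagree t₀ (lam m) (lam' m) ∩ {z | z.1.1 ∈ Ioc a b}}) (fun z => g z.1),
    tsum_subtype (N.π m ω) (fun z => (disagree t₀ (lam m) (lam' m) ∩
      {z | z.1.1 ∈ Ioc a b}).indicator (fun z => g z.1.1) ((z.1, ω), z.2))]
  refine tsum_congr fun z => ?_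
  simp only [indicator_apply, mem_inter_iff, mem_ofPred_eq]
  by_cases hz : z ∈ N.π m ω <;> simp [hz]

theorem measurable_tsum_symmDiff (hN : N.IsDriving G Pr)
    (hlam : ∀ m, PredictableFrom N G t₀ (lam m))
    (hlam' : ∀ m, PredictableFrom N G t₀ (lam' m)) (m : M) {a b : ℝ} (ha : t₀ ≤ a)
    {g : ℝ → ℝ≥0∞} (hg : Measurable g) :
    Measurable fun ω => ∑' s : ↥(symmDiff ((procOf C lam w).points m ω)
      ((procOf C lam' w').points m ω) ∩ Ioc a b), g s := by
  simp_rw [tsum_symmDiff_procOf hN m ha g]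
  exact (hN.poisson m).measurable_tsum
    ((measurable_marked_symmDiff hlam hlam' m a b hg).mono (marked_le hN) le_rfl)

theorem volume_disagree_le (x y : ℝ) :
    (volume.restrict (Ici (0 : ℝ))) {r | ¬(r ≤ x ↔ r ≤ y)} ≤ ‖x - y‖ₑ := by
  refine (Measure.restrict_apply_le _ _).trans ?_
  have hsub : {r | ¬(r ≤ x ↔ r ≤ y)} ⊆ uIoc y x := by
    intro r hr
    rw [mem_uIoc]
    simp only [mem_ofPred_eq] at hr
    by_cases h : r ≤ x
    · exact Or.inl ⟨by by_contra h'; exact hr ⟨fun _ => not_lt.1 h', fun _ => h⟩, h⟩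
    · refine Or.inr ⟨not_le.1 h, ?_⟩
      by_contra h'
      exact hr ⟨fun h1 => absurd h1 h, fun h1 => absurd h1 h'⟩
  refine (measure_mono hsub).trans ?_
  rw [Real.volume_uIoc, ← Real.norm_eq_abs, ofReal_norm]

theorem PredictableFrom.measurable (hN : N.IsDriving G Pr) {l : ℝ → Ω → ℝ}
    (hl : PredictableFrom N G t₀ l) :
    Measurable fun z : ℝ × Ω => (Ici t₀).indicator (fun t => l t z.2) z.1 :=
  Measurable.mono hl (predictable_le hN) le_rfl

/-- The expected weighted number of points on which two thinnings differ is bounded by the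
distance of their intensities. -/
theorem lintegral_tsum_symmDiff_le [IsProbabilityMeasure Pr] (hN : N.IsDriving G Pr)
    (hlam : ∀ m, PredictableFrom N G t₀ (lam m))
    (hlam' : ∀ m, PredictableFrom N G t₀ (lam' m)) (m : M) {a b : ℝ} (ha : t₀ ≤ a) (hab : a < b)
    {g : ℝ → ℝ≥0∞} (hg : Measurable g) {A : Set Ω} (hA : MeasurableSet[N.filt G a] A) :
    ∫⁻ ω in A, ∑' s : ↥(symmDiff ((procOf C lam w).points m ω)
      ((procOf C lam' w').points m ω) ∩ Ioc a b), g s ∂Pr ≤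
      ∫⁻ ω in A, (∫⁻ t in Ioc a b, g t * ‖lam m t ω - lam' m t ω‖ₑ) ∂Pr := by
  classical
  have hA' : MeasurableSet A := filt_le hN a A hA
  -- Since `A` is known at the left endpoint, its indicator can enter the integrand without losing
  -- predictability. This is what permits localization.
  have hI : MeasurableSet[N.predictable G] (Ioc a b ×ˢ A) :=
    MeasurableSpace.measurableSet_generateFrom ⟨a, b, A, hab, hA, rfl⟩
  let F : (ℝ × Ω) × ℝ → ℝ≥0∞ := (disagree t₀ (lam m) (lam' m) ∩ {z | z.1.1 ∈ Ioc a b}).indicator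
        (fun z => g z.1.1)
  have hF : Measurable[marked N G] F := measurable_marked_symmDiff hlam hlam' m a b hg
  let H : (ℝ × Ω) × ℝ → ℝ≥0∞ := (Prod.fst ⁻¹' (Ioc a b ×ˢ A)).indicator F
  have hH : Measurable[marked N G] H := hF.indicator (measurable_marked_fst hI)
  have hcomp := compensation hN m hH
  have e1 : ∫⁻ ω in A, ∑' s : ↥(symmDiff ((procOf C lam w).points m ω)
      ((procOf C lam' w').points m ω) ∩ Ioc a b), g s ∂Pr =
      ∫⁻ ω, ∑' z : N.π m ω, H ((z.1.1, ω), z.1.2) ∂Pr := by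
    rw [← lintegral_indicator hA']
    refine lintegral_congr fun ω => ?_
    by_cases hω : ω ∈ A
    · rw [indicator_of_mem hω, tsum_symmDiff_procOf hN m ha g]
      refine tsum_congr fun z => ?_
      by_cases hz : z.1.1 ∈ Ioc a b
      · simp only [H, F]
        rw [indicator_of_mem (s := Prod.fst ⁻¹' (Ioc a b ×ˢ A)) (show _ from ⟨hz, hω⟩)]
      · simp only [H, F]
        rw [indicator_of_notMem (fun h => hz h.2),
          indicator_of_notMem (s := Prod.fst ⁻¹' (Ioc a b ×ˢ A)) (fun h => hz h.1)]
    · rw [indicator_of_notMem hω]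
      refine (ENNReal.tsum_eq_zero.2 fun z => ?_).symm
      exact indicator_of_notMem (fun h => hω h.2) _
  have hφ : Measurable fun z : ℝ × Ω => ‖(Ici t₀).indicator (fun t => lam m t z.2) z.1 -
      (Ici t₀).indicator (fun t => lam' m t z.2) z.1‖ₑ :=
    (((hlam m).measurable hN).sub ((hlam' m).measurable hN)).enorm
  have hψ : Measurable fun z : ℝ × Ω => g z.1 * ‖(Ici t₀).indicator (fun t => lam m t z.2) z.1 -
      (Ici t₀).indicator (fun t => lam' m t z.2) z.1‖ₑ := (hg.comp measurable_fst).mul hφ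
  have hJ : MeasurableSet (Ioc a b ×ˢ A) := measurableSet_Ioc.prod hA'
  rw [e1, hcomp, lintegral_prod _ ((hH.mono (marked_le hN) le_rfl).aemeasurable)]
  calc ∫⁻ z, ∫⁻ x, H (z, x) ∂(volume.restrict (Ici (0 : ℝ))) ∂(volume.prod Pr)
      ≤ ∫⁻ z, (Ioc a b ×ˢ A).indicator (fun z : ℝ × Ω => g z.1 *
          ‖(Ici t₀).indicator (fun t => lam m t z.2) z.1 -
            (Ici t₀).indicator (fun t => lam' m t z.2) z.1‖ₑ) z ∂(volume.prod Pr) := by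
        refine lintegral_mono fun z => ?_
        simp only
        by_cases hz : z ∈ Ioc a b ×ˢ A
        · have hz0 : z.1 ∈ Ici t₀ := ha.trans hz.1.1.le
          rw [indicator_of_mem hz, indicator_of_mem hz0, indicator_of_mem hz0]
          refine le_trans ?_ (mul_le_mul_right (volume_disagree_le _ _) (g z.1))
          have hle : ∀ x, H (z, x) ≤ g z.1 *
              {r | ¬(r ≤ lam m z.1 z.2 ↔ r ≤ lam' m z.1 z.2)}.indicator 1 x := by
            intro x
            by_cases hx : ¬(x ≤ lam m z.1 z.2 ↔ x ≤ lam' m z.1 z.2)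
            · rw [indicator_of_mem (s := {r | ¬(r ≤ lam m z.1 z.2 ↔ r ≤ lam' m z.1 z.2)}) hx,
                Pi.one_apply, mul_one]
              refine (indicator_le_self _ _ _).trans (indicator_le_self _ _ _)
            · simp only [H, F]
              have : (z, x) ∉ disagree t₀ (lam m) (lam' m) ∩ {z | z.1.1 ∈ Ioc a b} :=
                fun h => hx h.1.2
              rw [indicator_apply, indicator_of_notMem this]
              simp
          have hms : MeasurableSet {r | ¬(r ≤ lam m z.1 z.2 ↔ r ≤ lam' m z.1 z.2)} := by
            have : {r | ¬(r ≤ lam m z.1 z.2 ↔ r ≤ lam' m z.1 z.2)} =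
                symmDiff (Iic (lam m z.1 z.2)) (Iic (lam' m z.1 z.2)) := by
              ext r
              simp only [mem_ofPred_eq, mem_symmDiff, mem_Iic]
              tauto
            rw [this]
            exact measurableSet_Iic.symmDiff measurableSet_Iic
          refine (lintegral_mono hle).trans ?_
          rw [lintegral_const_mul _ (measurable_one.indicator hms), lintegral_indicator_one hms]
        · rw [indicator_of_notMem hz]
          have h0 : ∀ x, H (z, x) = 0 := fun x =>
            indicator_of_notMem (s := Prod.fst ⁻¹' (Ioc a b ×ˢ A)) (fun h => hz h) _
          simp [h0]
    _ = ∫⁻ ω in A, (∫⁻ t in Ioc a b, g t * ‖lam m t ω - lam' m t ω‖ₑ) ∂Pr := by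
        rw [lintegral_prod_symm _ ((hψ.indicator hJ).aemeasurable),
          ← lintegral_indicator hA']
        refine lintegral_congr fun ω => ?_
        by_cases hω : ω ∈ A
        · rw [indicator_of_mem hω, ← lintegral_indicator measurableSet_Ioc]
          refine lintegral_congr fun t => ?_
          by_cases ht : t ∈ Ioc a b
          · have ht0 : t ∈ Ici t₀ := ha.trans ht.1.le
            rw [indicator_of_mem (show (t, ω) ∈ Ioc a b ×ˢ A from ⟨ht, hω⟩), indicator_of_mem ht]
            simp only [indicator_of_mem ht0]
          · rw [indicator_of_notMem (fun h => ht h.1), indicator_of_notMem ht]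
        · rw [indicator_of_notMem hω]
          simp [hω]

end Compensator

/-! ### Agreement and size of processes up to a given time. -/

section Segment

variable {Ω M P : Type*} {N : Noise Ω M P} {G : ChainGrid P} {t₀ : ℝ}
  {C : InitialCondition N G t₀} {lam lam' : M → ℝ → Ω → ℝ} {w : P → ℤ → Ω → ℝ}

/-- The processes `X` and `Y` have the same points and chains on `[t₀, a]`. -/
def AgreeOn (G : ChainGrid P) (t₀ a : ℝ) (X Y : Proc Ω M P) (ω : Ω) : Prop :=
  (∀ m, X.points m ω ∩ Icc t₀ a = Y.points m ω ∩ Icc t₀ a) ∧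
    ∀ p j, G.time p j ∈ Icc t₀ a → X.chain p j ω = Y.chain p j ω

theorem AgreeOn.trans {a : ℝ} {X Y Z : Proc Ω M P} {ω : Ω} (h : AgreeOn G t₀ a X Y ω)
    (h' : AgreeOn G t₀ a Y Z ω) : AgreeOn G t₀ a X Z ω :=
  ⟨fun m => (h.1 m).trans (h'.1 m), fun p j hj => (h.2 p j hj).trans (h'.2 p j hj)⟩

/-- The number of points and the total size of the chains of `X` on `[t₀, a]`. -/
def size [Fintype M] [Fintype P] (G : ChainGrid P) (t₀ a : ℝ) (X : Proc Ω M P) (ω : Ω) : ℝ≥0∞ :=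
  ∑ m, ((X.points m ω ∩ Icc t₀ a).encard : ℝ≥0∞) +
    ∑ p, ∑' j : ↥{j : ℤ | G.time p j ∈ Icc t₀ a}, ‖(X.chain p j ω).getD 0‖ₑ

theorem AgreeOn.size_eq [Fintype M] [Fintype P] {a : ℝ} {X Y : Proc Ω M P} {ω : Ω}
    (h : AgreeOn G t₀ a X Y ω) : size G t₀ a X ω = size G t₀ a Y ω := by
  unfold size
  congr 1
  · exact Finset.sum_congr rfl fun m _ => by rw [h.1 m]
  · exact Finset.sum_congr rfl fun p _ => tsum_congr fun j => by rw [h.2 p j j.2]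

theorem size_ne_top_iff [Fintype M] [Fintype P] {a : ℝ} {X : Proc Ω M P} {ω : Ω} :
    size G t₀ a X ω ≠ ⊤ ↔ ∀ m, (X.points m ω ∩ Icc t₀ a).Finite := by
  have h2 : ∑ p, ∑' j : ↥{j : ℤ | G.time p j ∈ Icc t₀ a}, ‖(X.chain p j ω).getD 0‖ₑ ≠ ⊤ :=
    ENNReal.sum_ne_top.2 fun p _ => tsum_ne_top_of_finite
      (f := fun j => ‖(X.chain p j ω).getD 0‖ₑ) (G.finite_time_mem_Icc p t₀ a)
      fun j => enorm_ne_top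
  rw [size, ENNReal.add_ne_top, and_iff_left h2, ENNReal.sum_ne_top]
  simp

theorem procOf_points_countable [MeasurableSpace Ω] {Pr : Measure Ω} (hN : N.IsDriving G Pr)
    {m : M} {ω : Ω} (hc : (C.node m ω).Countable) : ((procOf C lam w).points m ω).Countable := by
  have h1 : (N.π m ω).Countable := by
    have : N.π m ω = ⋃ n : ℕ, N.π m ω ∩ Metric.closedBall 0 n := by
      rw [← inter_iUnion, Metric.iUnion_closedBall_nat, inter_univ]
    rw [this]
    exact countable_iUnion fun n => ((hN.poisson m).locallyFinite ω _
      Metric.isBounded_closedBall).countable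
  refine (hc.union (h1.image Prod.fst)).mono ?_
  rintro s (hs | ⟨-, x, hx, -⟩)
  exacts [Or.inl hs, Or.inr ⟨(s, x), hx, rfl⟩]

theorem IsCausal.measurable_size [Fintype M] [Fintype P] {X : Proc Ω M P} (hX : IsCausal C X)
    {a : ℝ} (ha : t₀ ≤ a) : Measurable[N.filt G a] (size G t₀ a X) := by
  let _ : MeasurableSpace Ω := N.filt G a
  have h1 : Measurable[N.filt G a] fun ω =>
      ∑ m, ((X.points m ω ∩ Icc t₀ a).encard : ℝ≥0∞) :=
    Finset.measurable_fun_sum _ fun m _ => measurable_enat_iff.1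
      (hX.points_adapted m a ha _ measurableSet_Icc Icc_subset_Iic_self)
  have h2 : Measurable[N.filt G a] fun ω =>
      ∑ p, ∑' j : ↥{j : ℤ | G.time p j ∈ Icc t₀ a}, ‖(X.chain p j ω).getD 0‖ₑ :=
    Finset.measurable_fun_sum _ fun p _ => Measurable.tsum fun j =>
      ((optMeasurable_iff.1 (hX.chain_adapted p j j.2.1)).2.mono (filt_mono j.2.2) le_rfl).enorm
  exact h1.add h2

theorem measurableSet_agreeOn [Countable M] [Countable P] [MeasurableSpace Ω] {Pr : Measure Ω}
    (hN : N.IsDriving G Pr) {w' : P → ℤ → Ω → ℝ}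
    (hlam : ∀ m, PredictableFrom N G t₀ (lam m))
    (hw : ∀ p j, t₀ ≤ G.time p j → Measurable[N.filt G (G.time p j)] (w p j))
    (hlam' : ∀ m, PredictableFrom N G t₀ (lam' m))
    (hw' : ∀ p j, t₀ ≤ G.time p j → Measurable[N.filt G (G.time p j)] (w' p j)) (a : ℝ) :
    MeasurableSet[N.filt G a] {ω | AgreeOn G t₀ a (procOf C lam w) (procOf C lam' w') ω} := by
  have e : {ω | AgreeOn G t₀ a (procOf C lam w) (procOf C lam' w') ω} =
      (⋂ m, (count (fun ω => symmDiff ((procOf C lam w).points m ω)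
        ((procOf C lam' w').points m ω)) (Iic a ∩ Ici t₀)) ⁻¹' {0}) ∩
      ⋂ p, ⋂ j, ⋂ (_ : G.time p j ∈ Icc t₀ a), {ω | w p j ω = w' p j ω} := by
    ext ω
    simp only [AgreeOn, mem_ofPred_eq, mem_inter_iff, mem_iInter, mem_preimage,
      mem_singleton_iff, count, encard_eq_zero]
    refine and_congr (forall_congr' fun m => ?_) (forall_congr' fun p => forall_congr' fun j =>
      forall_congr' fun h => ?_)
    · rw [inter_comm (Iic a), Ici_inter_Iic, inter_symmDiff_distrib_right, ← bot_eq_empty,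
        symmDiff_eq_bot]
    · rw [procOf_chain_of_le h.1, procOf_chain_of_le h.1, Option.some_inj]
  rw [e]
  refine @MeasurableSet.inter _ (N.filt G a) _ _ (MeasurableSet.iInter fun m => ?_)
    (MeasurableSet.iInter fun p => MeasurableSet.iInter fun j => MeasurableSet.iInter fun h => ?_)
  · rw [count_symmDiff_procOf hN]
    exact measurable_hits hN m ((measurableSet_disagree (hlam m) (hlam' m)).inter
      (measurable_marked_time measurableSet_Iic)) (fun z hz => hz.2) (measurableSet_singleton 0)
  · exact measurableSet_eq_fun ((hw p j h.1).mono (filt_mono h.2) le_rfl)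
      ((hw' p j h.1).mono (filt_mono h.2) le_rfl)

theorem measurable_dist [MeasurableSpace Ω] {Pr : Measure Ω} (hN : N.IsDriving G Pr)
    {l l' : ℝ → Ω → ℝ} (hl : PredictableFrom N G t₀ l) (hl' : PredictableFrom N G t₀ l') :
    Measurable fun z : ℝ × Ω => ‖(Ici t₀).indicator (fun t => l t z.2) z.1 -
      (Ici t₀).indicator (fun t => l' t z.2) z.1‖ₑ :=
  ((hl.measurable hN).sub (hl'.measurable hN)).enorm

theorem setLIntegral_dist_eq {l l' : ℝ → Ω → ℝ} {a b : ℝ} (ha : t₀ ≤ a) (g : ℝ → ℝ≥0∞) (ω : Ω) :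
    ∫⁻ t in Ioc a b, g t * ‖l t ω - l' t ω‖ₑ = ∫⁻ t in Ioc a b, g t *
      ‖(Ici t₀).indicator (fun t => l t ω) t - (Ici t₀).indicator (fun t => l' t ω) t‖ₑ := by
  refine setLIntegral_congr_fun measurableSet_Ioc fun t ht => ?_
  have ht0 : t ∈ Ici t₀ := ha.trans ht.1.le
  simp only [indicator_of_mem ht0]

theorem measurable_setLIntegral_dist [MeasurableSpace Ω] {Pr : Measure Ω} [SFinite Pr]
    (hN : N.IsDriving G Pr)
    {l l' : ℝ → Ω → ℝ} (hl : PredictableFrom N G t₀ l) (hl' : PredictableFrom N G t₀ l')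
    {a b : ℝ} (ha : t₀ ≤ a) {g : ℝ → ℝ≥0∞} (hg : Measurable g) :
    Measurable fun ω => ∫⁻ t in Ioc a b, g t * ‖l t ω - l' t ω‖ₑ := by
  simp_rw [setLIntegral_dist_eq ha g]
  exact ((hg.comp measurable_fst).mul (measurable_dist hN hl hl')).lintegral_prod_left'

theorem setLIntegral_dist_triangle [MeasurableSpace Ω] {Pr : Measure Ω} (hN : N.IsDriving G Pr)
    {l l' l'' : ℝ → Ω → ℝ} (hl : PredictableFrom N G t₀ l) (hl' : PredictableFrom N G t₀ l')
    {a b : ℝ} (ha : t₀ ≤ a) {g : ℝ → ℝ≥0∞} (hg : Measurable g) (ω : Ω) :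
    ∫⁻ t in Ioc a b, g t * ‖l t ω - l'' t ω‖ₑ ≤ (∫⁻ t in Ioc a b, g t * ‖l t ω - l' t ω‖ₑ) +
      ∫⁻ t in Ioc a b, g t * ‖l'' t ω - l' t ω‖ₑ := by
  have hm : Measurable fun t => g t * ‖(Ici t₀).indicator (fun t => l t ω) t -
      (Ici t₀).indicator (fun t => l' t ω) t‖ₑ :=
    hg.mul ((measurable_dist hN hl hl').comp measurable_prodMk_right)
  rw [setLIntegral_dist_eq (l := l) (l' := l') ha, ← lintegral_add_left hm]
  refine setLIntegral_mono' measurableSet_Ioc fun t ht => ?_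
  have ht0 : t ∈ Ici t₀ := ha.trans ht.1.le
  simp only [indicator_of_mem ht0]
  rw [← mul_add]
  gcongr
  have e : l t ω - l'' t ω = (l t ω - l' t ω) + -(l'' t ω - l' t ω) := by ring
  rw [e, ← enorm_neg (l'' t ω - l' t ω)]
  exact enorm_add_le _ _

theorem inter_Iic_eq_of_Icc {A B : Set ℝ} {a b t : ℝ} (h0 : A ∩ Iio t₀ = B ∩ Iio t₀)
    (h1 : A ∩ Icc t₀ a = B ∩ Icc t₀ a) (h2 : symmDiff A B ∩ Ioc a b = ∅) (ht : t ≤ b) :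
    A ∩ Iic t = B ∩ Iic t := by
  ext s
  simp only [mem_inter_iff, mem_Iic]
  refine and_congr_left fun hs => ?_
  rcases lt_or_ge s t₀ with h | h
  · have := congrArg (s ∈ ·) h0
    simpa [h] using this
  · rcases le_or_gt s a with h' | h'
    · have := congrArg (s ∈ ·) h1
      simpa [h, h'] using this
    · by_contra hne
      have : s ∈ symmDiff A B ∩ Ioc a b := by
        refine ⟨?_, h', hs.trans ht⟩
        rw [mem_symmDiff]
        tauto
      rw [h2] at this
      exact this

theorem locFinBefore_of_finite {X : Proc Ω M P} {ω : Ω} {t : ℝ}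
    (hX : ∀ m, X.points m ω ∩ Iio t₀ = C.node m ω)
    (hC : ∀ m, ∀ a b : ℝ, (C.node m ω ∩ Icc a b).Finite)
    (hfin : ∀ m, (X.points m ω ∩ Ico t₀ t).Finite) : LocFinBefore X t ω := by
  intro m n
  refine ((hC m (-n) n).union (hfin m)).subset ?_
  rintro s ⟨⟨h1, h2⟩, h3⟩
  rcases lt_or_ge s t₀ with h | h
  · left
    rw [← hX m]
    exact ⟨⟨h1, h⟩, h3⟩
  · exact Or.inr ⟨h1, h, h2⟩

end Segment

/-! ### Pathwise estimates on an interval free of chain times. -/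

section Segment

variable {Ω M P : Type*} [Fintype M] [Fintype P] {N : Noise Ω M P} {G : ChainGrid P} {t₀ : ℝ}
  {C : InitialCondition N G t₀} {𝔐 : Params M P}

theorem picard_points_init (n : ℕ) (m : M) (ω : Ω) :
    (picard 𝔐 C n).points m ω ∩ Iio t₀ = C.node m ω := procOf_points_init m ω

theorem picard_chain_init (n : ℕ) {p : P} {j : ℤ} (h : G.time p j < t₀) (ω : Ω) :
    (picard 𝔐 C n).chain p j ω = C.chain p j ω := procOf_chain_of_lt h ω

theorem picard_chain_succ (n : ℕ) {p : P} {j : ℤ} (h : t₀ ≤ G.time p j) (ω : Ω) :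
    (picard 𝔐 C (n + 1)).chain p j ω = some (N.ξ p j ω + 𝔐.Φchain p
      (regMemory 𝔐 G t₀ (picard 𝔐 C n) (.inr p) (G.time p j) ω)) := procOf_chain_of_le h ω

theorem picard_intensity_succ (n : ℕ) (m : M) (t : ℝ) (ω : Ω) :
    (picardData 𝔐 C (n + 1)).1 m t ω = 𝔐.Φnode m (𝔐.μ m +
      regMemory 𝔐 G t₀ (picard 𝔐 C n) (.inl m) t ω) := rfl

/-- Between two chain times, the distance of the intensities of consecutive iterates is controlled
by the points on which the previous iterates differ. -/
theorem setLIntegral_picard_sub_le {ω : Ω} {a b c : ℝ} (ha : t₀ ≤ a)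
    (hgrid : ∀ p j, G.time p j ∉ Ioo a b) {m : M} {L : ℝ≥0}
    (hL : ∀ x y, ‖𝔐.Φnode m x - 𝔐.Φnode m y‖ₑ ≤ L * ‖x - y‖ₑ) {n n' : ℕ}
    (hc : ∀ n m, ((picard 𝔐 C n).points m ω).Countable)
    (hCfin : ∀ m, ∀ a b : ℝ, (C.node m ω ∩ Icc a b).Finite)
    (hfin : ∀ n m, ((picard 𝔐 C n).points m ω ∩ Icc t₀ b).Finite)
    (hagree : AgreeOn G t₀ a (picard 𝔐 C n) (picard 𝔐 C n') ω)
    (hmem : ∀ᵐ t ∂(volume.restrict (Ioc a b)),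
      absMemory 𝔐 G (fun m => C.node m ω) (fun p j => C.chain p j ω) (.inl m) t ≠ ⊤) :
    ∫⁻ t in Ioc a b, expWeight c t *
        ‖(picardData 𝔐 C (n + 1)).1 m t ω - (picardData 𝔐 C (n' + 1)).1 m t ω‖ₑ ≤
      ∑ m', L * (∫⁻ r, expWeight c r * posPart (𝔐.h (.inl m) (.inl m')) r) *
        ∑' s : ↥(symmDiff ((picard 𝔐 C n).points m' ω) ((picard 𝔐 C n').points m' ω) ∩ Ioc a b),
          expWeight c s := by
  have hD : ∀ m', (symmDiff ((picard 𝔐 C n).points m' ω) ((picard 𝔐 C n').points m' ω) ∩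
      Ioc a b).Countable := fun m' => by
    refine (((hc n m').union (hc n' m')).mono ?_).mono inter_subset_left
    exact symmDiff_subset_union
  have hstep : ∀ᵐ t ∂(volume.restrict (Ioc a b)), expWeight c t *
        ‖(picardData 𝔐 C (n + 1)).1 m t ω - (picardData 𝔐 C (n' + 1)).1 m t ω‖ₑ ≤
      ∑ m', L * (expWeight c t * ∑' s : ↥((symmDiff ((picard 𝔐 C n).points m' ω)
        ((picard 𝔐 C n').points m' ω) ∩ Ioc a b) ∩ Iio t), ‖𝔐.h (.inl m) (.inl m') (t - s)‖ₑ) := by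
    filter_upwards [hmem, ae_restrict_mem measurableSet_Ioc] with t htop ht
    have ht0 : t₀ ≤ t := ha.trans ht.1.le
    have hfin' : ∀ n m, ((picard 𝔐 C n).points m ω ∩ Ico t₀ t).Finite := fun n m =>
      (hfin n m).subset (inter_subset_inter_right _ fun s hs => ⟨hs.1, hs.2.le.trans ht.2⟩)
    have hreg : ∀ n, regMemory 𝔐 G t₀ (picard 𝔐 C n) (.inl m) t ω =
        memory 𝔐 G (fun m => (picard 𝔐 C n).points m ω)
          (fun p j => (picard 𝔐 C n).chain p j ω) (.inl m) t := fun n =>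
      if_pos ⟨ht0, locFinBefore_of_finite (fun m => picard_points_init n m ω) hCfin (hfin' n)⟩
    have hconv : ∀ n, MemoryConverges 𝔐 G (fun m => (picard 𝔐 C n).points m ω)
          (fun p j => (picard 𝔐 C n).chain p j ω) (.inl m) t := fun n =>
      memoryConverges_of_initial (fun m => picard_points_init n m ω)
        (fun p j h => picard_chain_init n h ω) htop (hfin' n)
    -- No chain time lies strictly between `a` and `b`, so every chain value entering the memory at
    -- `t ≤ b` dates from `a` or earlier, where the iterates agree.
    have hchain : ∀ p j, G.time p j < t →
        (picard 𝔐 C n).chain p j ω = (picard 𝔐 C n').chain p j ω := by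
      intro p j hj
      rcases lt_or_ge (G.time p j) t₀ with h | h
      · rw [picard_chain_init _ h, picard_chain_init _ h]
      · refine hagree.2 p j ⟨h, ?_⟩
        by_contra h'
        exact hgrid p j ⟨not_le.1 h', hj.trans_le ht.2⟩
    rw [← Finset.mul_sum, ← Finset.mul_sum, mul_left_comm]
    gcongr
    rw [picard_intensity_succ, picard_intensity_succ]
    refine (hL _ _).trans ?_
    rw [add_sub_add_left_eq_sub, hreg, hreg]
    gcongr
    refine (enorm_memory_sub_le (hconv n) (hconv n') hchain).trans
      (Finset.sum_le_sum fun m' _ => ?_)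
    refine ENNReal.tsum_mono_subtype (fun s => ‖𝔐.h (.inl m) (.inl m') (t - s)‖ₑ) ?_
    rintro s ⟨hs, hst⟩
    refine ⟨⟨hs, ?_, (mem_Iio.1 hst).le.trans ht.2⟩, hst⟩
    by_contra hsa
    rcases lt_or_ge s t₀ with h | h
    · have h1 := picard_points_init (𝔐 := 𝔐) (C := C) n m' ω
      rw [← picard_points_init (𝔐 := 𝔐) (C := C) n' m' ω] at h1
      have h2 := congrArg (s ∈ ·) h1
      simp only [mem_inter_iff, mem_Iio, h, and_true, eq_iff_iff] at h2
      rw [mem_symmDiff] at hs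
      tauto
    · have h2 := congrArg (s ∈ ·) (hagree.1 m')
      simp only [mem_inter_iff, mem_Icc, h, not_lt.1 hsa, and_true, eq_iff_iff] at h2
      rw [mem_symmDiff] at hs
      tauto
  refine (lintegral_mono_ae hstep).trans ?_
  rw [lintegral_finsetSum]
  · refine Finset.sum_le_sum fun m' _ => ?_
    rw [lintegral_const_mul' _ _ ENNReal.coe_ne_top, mul_assoc]
    gcongr
    exact lintegral_memory_node_le (hD m') (𝔐.h_measurable _ _) c _
  · intro m' _
    exact ((measurable_expWeight c).fun_mul
      (measurable_tsum_inter_Iio (hD m') (𝔐.h_measurable _ _))).const_mul _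

/-- Between two chain times, the intensities of an iterate are controlled by its size and by the
number of points of the previous iterate. -/
theorem exists_setLIntegral_absMemory_le (h𝔐 : 𝔐.NoExpl) (C : InitialCondition N G t₀) (m : M)
    (a : ℝ) : ∃ K : ℝ≥0∞, K ≠ ⊤ ∧ ∀ (b : ℝ) (L : ℕ) (n : ℕ) (ω : Ω), t₀ ≤ a → b ≤ t₀ + L →
      (∀ p j, G.time p j ∉ Ioo a b) →
      (∀ m, ((picard 𝔐 C n).points m ω).Countable) →
      ∫⁻ t in Ioc a b, absMemory 𝔐 G (fun m => (picard 𝔐 C n).points m ω)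
          (fun p j => (picard 𝔐 C n).chain p j ω) (.inl m) t ≤
        (∫⁻ t in Icc t₀ (t₀ + L),
          absMemory 𝔐 G (fun m => C.node m ω) (fun p j => C.chain p j ω) (.inl m) t) +
        K * (1 + size G t₀ a (picard 𝔐 C n) ω +
          ∑ m', (((picard 𝔐 C n).points m' ω ∩ Ioc a b).encard : ℝ≥0∞)) := by
  choose κ hκ using fun p => exists_enorm_mask_le 𝔐 (.inl m) p
  let H : M → ℝ≥0∞ := fun m' => ∫⁻ r, posPart (𝔐.h (.inl m) (.inl m')) r
  let H' : P → ℝ≥0∞ := fun p => (∫⁻ r, posPart (𝔐.h (.inl m) (.inr p)) r) * κ p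
  let J : P → Set ℤ := fun p => {j : ℤ | G.time p j ∈ Icc t₀ a}
  have hJ : ∀ p, (J p).Finite := fun p => G.finite_time_mem_Icc p t₀ a
  have hH : ∑ m', H m' ≠ ⊤ := ENNReal.sum_ne_top.2 fun m' _ =>
    lintegral_posPart_ne_top (h𝔐.node_node m m')
  have hH' : ∑ p, H' p ≠ ⊤ := ENNReal.sum_ne_top.2 fun p _ =>
    ENNReal.mul_ne_top (lintegral_posPart_ne_top (h𝔐.node_chain m p)) ENNReal.coe_ne_top
  have hcard : ∑ p, ((J p).encard : ℝ≥0∞) ≠ ⊤ := ENNReal.sum_ne_top.2 fun p _ => by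
    simpa using hJ p
  -- The constant must not depend on `b`, `n` or `ω`. The cardinalities of the chain times up to `a`
  -- absorb the constant term in the linear growth of the masks.
  refine ⟨(∑ m', H m' + ∑ p, H' p) * (1 + ∑ p, ((J p).encard : ℝ≥0∞)), ENNReal.mul_ne_top
    (ENNReal.add_ne_top.2 ⟨hH, hH'⟩) (ENNReal.add_ne_top.2 ⟨ENNReal.one_ne_top, hcard⟩), ?_⟩
  intro b L n ω ha hb hgrid hc
  set X := picard 𝔐 C n with hX
  have hD : ∀ m', (X.points m' ω ∩ Ico t₀ b).Countable := fun m' => (hc m').mono inter_subset_left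
  let f : ℝ → ℝ≥0∞ := fun t =>
    (∑ m', ∑' s : ↥((X.points m' ω ∩ Ico t₀ b) ∩ Iio t), ‖𝔐.h (.inl m) (.inl m') (t - s)‖ₑ) +
      ∑ p, ∑' j : J p, posPart (𝔐.h (.inl m) (.inr p)) (t - G.time p j) *
        ‖𝔐.mask (.inl m) p (X.chain p j ω)‖ₑ
  have hf1 : ∀ m', Measurable fun t => ∑' s : ↥((X.points m' ω ∩ Ico t₀ b) ∩ Iio t),
      ‖𝔐.h (.inl m) (.inl m') (t - s)‖ₑ := fun m' =>
    measurable_tsum_inter_Iio (hD m') (𝔐.h_measurable _ _)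
  have hf2 : ∀ p (j : J p), Measurable fun t => posPart (𝔐.h (.inl m) (.inr p)) (t - G.time p j) *
        ‖𝔐.mask (.inl m) p (X.chain p j ω)‖ₑ := fun p j =>
    (measurable_posPart_sub (𝔐.h_measurable _ _) _).mul_const _
  have hf2' : ∀ p, Measurable fun t => ∑' j : J p, posPart (𝔐.h (.inl m) (.inr p))
      (t - G.time p j) * ‖𝔐.mask (.inl m) p (X.chain p j ω)‖ₑ := fun p =>
    Measurable.tsum fun j => hf2 p j
  have hf : Measurable f := (Finset.measurable_fun_sum _ fun m' _ => hf1 m').add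
    (Finset.measurable_fun_sum _ fun p _ => hf2' p)
  have hle : ∀ t ∈ Ioc a b, absMemory 𝔐 G (fun m => X.points m ω)
      (fun p j => X.chain p j ω) (.inl m) t ≤
      absMemory 𝔐 G (fun m => C.node m ω) (fun p j => C.chain p j ω) (.inl m) t + f t := by
    intro t ht
    refine (absMemory_le_initial (fun m => picard_points_init n m ω)
      (fun p j h => picard_chain_init n h ω) _ t).trans ?_
    refine add_le_add_right (add_le_add (Finset.sum_le_sum fun m' _ => ?_)
      (Finset.sum_le_sum fun p _ => ?_)) _
    · exact ENNReal.tsum_mono_subtype (fun s => ‖𝔐.h (.inl m) (.inl m') (t - s)‖ₑ)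
        (inter_subset_inter_left _ (inter_subset_inter_right _ (Ico_subset_Ico_right ht.2)))
    · refine ENNReal.tsum_mono_subtype (fun j => posPart (𝔐.h (.inl m) (.inr p))
        (t - G.time p j) * ‖𝔐.mask (.inl m) p (X.chain p j ω)‖ₑ) fun j hj => ⟨hj.1, ?_⟩
      by_contra h'
      exact hgrid p j ⟨not_le.1 h', hj.2.trans_le ht.2⟩
  have hnode : ∀ m', ∫⁻ t in Ioc a b, ∑' s : ↥((X.points m' ω ∩ Ico t₀ b) ∩ Iio t),
      ‖𝔐.h (.inl m) (.inl m') (t - s)‖ₑ ≤ H m' * (((X.points m' ω ∩ Icc t₀ a).encard : ℝ≥0∞) +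
        (X.points m' ω ∩ Ioc a b).encard) := by
    intro m'
    have h1 := lintegral_memory_node_le (hD m') (𝔐.h_measurable (.inl m) (.inl m')) 0 (Ioc a b)
    simp only [expWeight_zero, one_mul, ENNReal.tsum_set_one] at h1
    refine h1.trans ?_
    gcongr
    rw [← ENat.toENNReal_add]
    refine ENat.toENNReal_le.2 ((encard_le_encard ?_).trans (encard_union_le _ _))
    rintro s ⟨h2, h3, h4⟩
    rcases le_or_gt s a with h | h
    exacts [Or.inl ⟨h2, h3, h⟩, Or.inr ⟨h2, h, h4.le⟩]
  have hchain : ∀ p, ∫⁻ t in Ioc a b, ∑' j : J p, posPart (𝔐.h (.inl m) (.inr p))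
      (t - G.time p j) * ‖𝔐.mask (.inl m) p (X.chain p j ω)‖ₑ ≤
      H' p * (((J p).encard : ℝ≥0∞) + ∑' j : J p, ‖(X.chain p j ω).getD 0‖ₑ) := by
    intro p
    rw [lintegral_tsum fun j => (hf2 p j).aemeasurable, ← ENNReal.tsum_set_one,
      ← ENNReal.tsum_add, ← ENNReal.tsum_mul_left]
    refine ENNReal.tsum_le_tsum fun j => ?_
    rw [lintegral_mul_const _ (measurable_posPart_sub (𝔐.h_measurable _ _) _)]
    refine (mul_le_mul' (setLIntegral_le_lintegral _ _) (hκ p _)).trans ?_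
    rw [lintegral_sub_right_eq_self (μ := volume) (posPart (𝔐.h (.inl m) (.inr p))), ← mul_assoc]
  have hKm : ∀ m', H m' ≤ (∑ m', H m' + ∑ p, H' p) * (1 + ∑ p, ((J p).encard : ℝ≥0∞)) := fun m' =>
    calc H m' ≤ ∑ m', H m' := Finset.single_le_sum (fun _ _ => zero_le) (Finset.mem_univ m')
      _ ≤ (∑ m', H m' + ∑ p, H' p) * 1 := by rw [mul_one]; exact le_self_add
      _ ≤ _ := by gcongr; exact le_self_add
  have hKp : ∀ p, H' p ≤ (∑ m', H m' + ∑ p, H' p) * (1 + ∑ p, ((J p).encard : ℝ≥0∞)) := fun p =>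
    calc H' p ≤ ∑ p, H' p := Finset.single_le_sum (fun _ _ => zero_le) (Finset.mem_univ p)
      _ ≤ (∑ m', H m' + ∑ p, H' p) * 1 := by rw [mul_one]; exact le_add_self
      _ ≤ _ := by gcongr; exact le_self_add
  have hKc : ∑ p, H' p * ((J p).encard : ℝ≥0∞) ≤
      (∑ m', H m' + ∑ p, H' p) * (1 + ∑ p, ((J p).encard : ℝ≥0∞)) :=
    calc ∑ p, H' p * ((J p).encard : ℝ≥0∞)
        ≤ ∑ p, H' p * (1 + ∑ p, ((J p).encard : ℝ≥0∞)) := by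
          gcongr with p
          exact (Finset.single_le_sum (f := fun p => ((J p).encard : ℝ≥0∞)) (fun _ _ => zero_le)
            (Finset.mem_univ p)).trans le_add_self
      _ = (∑ p, H' p) * (1 + ∑ p, ((J p).encard : ℝ≥0∞)) := by rw [Finset.sum_mul]
      _ ≤ _ := by gcongr; exact le_add_self
  generalize (∑ m', H m' + ∑ p, H' p) * (1 + ∑ p, ((J p).encard : ℝ≥0∞)) = K at *
  refine (setLIntegral_mono' measurableSet_Ioc hle).trans ?_
  rw [lintegral_add_right _ hf]
  refine add_le_add (lintegral_mono_set fun t ht => ⟨ha.trans ht.1.le, ht.2.trans hb⟩) ?_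
  rw [lintegral_add_left (Finset.measurable_fun_sum _ fun m' _ => hf1 m'),
    lintegral_finsetSum _ fun m' _ => hf1 m', lintegral_finsetSum _ fun p _ => hf2' p]
  calc _ ≤ ∑ m', K * (((X.points m' ω ∩ Icc t₀ a).encard : ℝ≥0∞) +
        (X.points m' ω ∩ Ioc a b).encard) + (∑ p, (H' p * ((J p).encard : ℝ≥0∞) +
          K * ∑' j : J p, ‖(X.chain p j ω).getD 0‖ₑ)) := by
        refine add_le_add (Finset.sum_le_sum fun m' _ => (hnode m').trans ?_)
          (Finset.sum_le_sum fun p _ => (hchain p).trans ?_)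
        · gcongr; exact hKm m'
        · rw [mul_add]; gcongr; exact hKp p
    _ = ∑ p, H' p * ((J p).encard : ℝ≥0∞) + K * (size G t₀ a X ω +
          ∑ m', ((X.points m' ω ∩ Ioc a b).encard : ℝ≥0∞)) := by
        rw [size, ← Finset.mul_sum, Finset.sum_add_distrib, Finset.sum_add_distrib,
          ← Finset.mul_sum]
        ring
    _ ≤ K + K * (size G t₀ a X ω + ∑ m', ((X.points m' ω ∩ Ioc a b).encard : ℝ≥0∞)) := by
        gcongr
    _ = _ := by ring

end Segment

/-! ### The contraction in mean on an interval free of chain times. -/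

section Step

variable {Ω M P : Type*} [Fintype M] [Fintype P] [mΩ : MeasurableSpace Ω] {Pr : Measure Ω}
  {N : Noise Ω M P} {G : ChainGrid P} {t₀ : ℝ} {C : InitialCondition N G t₀} {𝔐 : Params M P}
  {a b : ℝ} {A : Set Ω}

theorem picard_zero_points (hN : N.IsDriving G Pr) (m : M) (ω : Ω) :
    (picard 𝔐 C 0).points m ω ∩ Ici t₀ = ∅ := by
  rw [eq_empty_iff_forall_notMem]
  rintro s ⟨h1, h2⟩
  obtain ⟨x, hx, hl⟩ := (mem_procOf_points h2).1 h1
  have h0 : (0 : ℝ) ≤ x := ((hN.poisson m).subset ω hx).2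
  have h3 : x ≤ -1 := hl
  linarith

/-- The initial iterate has no points after `t₀`, so a point count is a special case of a difference
of two thinnings and inherits the compensator bound. -/
theorem encard_picard_eq (hN : N.IsDriving G Pr) (ha : t₀ ≤ a) (n : ℕ) (m : M) (ω : Ω) :
    (((picard 𝔐 C n).points m ω ∩ Ioc a b).encard : ℝ≥0∞) =
      ∑' s : ↥(symmDiff ((picard 𝔐 C n).points m ω) ((picard 𝔐 C 0).points m ω) ∩ Ioc a b),
        (fun _ => 1 : ℝ → ℝ≥0∞) s := by
  have e : symmDiff ((picard 𝔐 C n).points m ω) ((picard 𝔐 C 0).points m ω) ∩ Ioc a b =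
      (picard 𝔐 C n).points m ω ∩ Ioc a b := by
    have h0 : (picard 𝔐 C 0).points m ω ∩ Ioc a b = ∅ := by
      rw [← subset_empty_iff, ← picard_zero_points (𝔐 := 𝔐) (C := C) hN m ω]
      exact inter_subset_inter_right _ fun s hs => ha.trans hs.1.le
    rw [inter_symmDiff_distrib_right, h0, ← bot_eq_empty, symmDiff_bot]
  rw [e, ENNReal.tsum_set_one]

theorem lintegral_tsum_symmDiff_picard_le [IsProbabilityMeasure Pr] (hN : N.IsDriving G Pr)
    (h𝔐 : 𝔐.NoExpl) (n n' : ℕ) (m : M) (ha : t₀ ≤ a) (hab : a < b) {g : ℝ → ℝ≥0∞} (hg : Measurable g)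
    (hA : MeasurableSet[N.filt G a] A) :
    ∫⁻ ω in A, ∑' s : ↥(symmDiff ((picard 𝔐 C n).points m ω)
      ((picard 𝔐 C n').points m ω) ∩ Ioc a b), g s ∂Pr ≤
      ∫⁻ ω in A, (∫⁻ t in Ioc a b, g t * ‖(picardData 𝔐 C n).1 m t ω -
        (picardData 𝔐 C n').1 m t ω‖ₑ) ∂Pr :=
  lintegral_tsum_symmDiff_le hN (picardData_adapted hN 𝔐 h𝔐 C n).1
    (picardData_adapted hN 𝔐 h𝔐 C n').1 m ha hab hg hA

theorem measurable_tsum_symmDiff_picard (hN : N.IsDriving G Pr) (h𝔐 : 𝔐.NoExpl) (n n' : ℕ)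
    (m : M) (ha : t₀ ≤ a) {g : ℝ → ℝ≥0∞} (hg : Measurable g) :
    Measurable fun ω => ∑' s : ↥(symmDiff ((picard 𝔐 C n).points m ω)
      ((picard 𝔐 C n').points m ω) ∩ Ioc a b), g s :=
  measurable_tsum_symmDiff hN (picardData_adapted hN 𝔐 h𝔐 C n).1
    (picardData_adapted hN 𝔐 h𝔐 C n').1 m ha hg

theorem ae_countable_picard (hN : N.IsDriving G Pr) (hC : C.IsIntegrable Pr) :
    ∀ᵐ ω ∂Pr, ∀ n m, ((picard 𝔐 C n).points m ω).Countable := by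
  filter_upwards [ae_node_finite hN hC] with ω hω n m
  exact procOf_points_countable hN (countable_of_finite_inter (hω m))

/-- Between two chain times, the intensities of the iterates have a finite mean. -/
theorem lintegral_picard_ne_top [IsProbabilityMeasure Pr] (hN : N.IsDriving G Pr)
    (h𝔐 : 𝔐.NoExpl) (hC : C.IsIntegrable Pr) (ha : t₀ ≤ a) (hab : a < b) (hgrid : ∀ p j, G.time p j ∉ Ioo a b)
    (hA : MeasurableSet[N.filt G a] A) {K : ℝ≥0}
    (hK : ∀ n, ∀ ω ∈ A, size G t₀ a (picard 𝔐 C n) ω ≤ K) (n : ℕ) (m : M) :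
    ∫⁻ ω in A, (∫⁻ t in Ioc a b, ‖(picardData 𝔐 C n).1 m t ω -
        (picardData 𝔐 C 0).1 m t ω‖ₑ) ∂Pr ≠ ⊤ := by
  induction n generalizing m with
  | zero => simp
  | succ n ih =>
    have hA' : MeasurableSet A := filt_le hN a A hA
    obtain ⟨L, hL⟩ := exists_nat_ge (b - t₀)
    obtain ⟨V, hVm, hVi, hV⟩ := exists_bound_absMemory hN h𝔐 hC m L
    obtain ⟨K₁, hK₁, hbound⟩ := exists_setLIntegral_absMemory_le h𝔐 C m a
    obtain ⟨K₂, hK₂, -⟩ := exists_enorm_le_of_lipschitz (h𝔐.Φnode_lipschitz m)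
    let cnt : M → Ω → ℝ≥0∞ := fun m' ω => ((picard 𝔐 C n).points m' ω ∩ Ioc a b).encard
    have hcm : ∀ m', Measurable (cnt m') := fun m' => by
      simp only [cnt]
      simp_rw [encard_picard_eq hN ha]
      exact measurable_tsum_symmDiff_picard hN h𝔐 n 0 m' ha measurable_const
    -- The induction hypothesis bounds the intensities of the previous iterate, and the compensation
    -- formula turns this into a finite mean number of points. Those points, the bounded past and
    -- the integrable initial memory control the next intensities.
    have hci : ∀ m', ∫⁻ ω in A, cnt m' ω ∂Pr ≠ ⊤ := fun m' => by
      simp only [cnt]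
      simp_rw [encard_picard_eq hN ha]
      refine ne_top_of_le_ne_top (ih m') ((lintegral_tsum_symmDiff_picard_le hN h𝔐 n 0 m' ha hab
        measurable_const hA).trans ?_)
      simp
    have hpt : ∀ ω, ∫⁻ t in Ioc a b, ‖(picardData 𝔐 C (n + 1)).1 m t ω -
        (picardData 𝔐 C 0).1 m t ω‖ₑ ≤ (1 + K₂ * (1 + ‖𝔐.μ m‖ₑ)) * volume (Ioc a b) +
        K₂ * ∫⁻ t in Ioc a b, absMemory 𝔐 G (fun m => (picard 𝔐 C n).points m ω)
          (fun p j => (picard 𝔐 C n).chain p j ω) (.inl m) t := by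
      intro ω
      rw [← lintegral_const_mul' _ _ ENNReal.coe_ne_top, ← setLIntegral_const,
        ← lintegral_add_left measurable_const]
      refine lintegral_mono fun t => ?_
      rw [picard_intensity_succ]
      have h1 : ‖𝔐.Φnode m (𝔐.μ m + regMemory 𝔐 G t₀ (picard 𝔐 C n) (.inl m) t ω) -
          (picardData 𝔐 C 0).1 m t ω‖ₑ ≤
          ‖𝔐.Φnode m (𝔐.μ m + regMemory 𝔐 G t₀ (picard 𝔐 C n) (.inl m) t ω)‖ₑ + 1 := by
        have h2 : (picardData 𝔐 C 0).1 m t ω = -1 := rfl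
        rw [h2, sub_neg_eq_add]
        exact (enorm_add_le _ _).trans (by simp)
      refine (h1.trans (add_le_add_left (hK₂ _) _)).trans ?_
      calc _ ≤ K₂ * (1 + (‖𝔐.μ m‖ₑ + absMemory 𝔐 G (fun m => (picard 𝔐 C n).points m ω)
          (fun p j => (picard 𝔐 C n).chain p j ω) (.inl m) t)) + 1 := by
            gcongr
            exact (enorm_add_le _ _).trans (add_le_add_right enorm_regMemory_le _)
        _ = _ := by ring
    have hall : ∀ᵐ ω ∂(Pr.restrict A), ∫⁻ t in Ioc a b, ‖(picardData 𝔐 C (n + 1)).1 m t ω -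
        (picardData 𝔐 C 0).1 m t ω‖ₑ ≤ (1 + K₂ * (1 + ‖𝔐.μ m‖ₑ)) * volume (Ioc a b) +
          K₂ * (V ω + K₁ * (1 + K + ∑ m', cnt m' ω)) := by
      rw [ae_restrict_iff' hA']
      filter_upwards [hV, ae_countable_picard (𝔐 := 𝔐) hN hC] with ω h1 h2 hω
      refine (hpt ω).trans ?_
      gcongr
      refine (hbound b L n ω ha (by linarith) hgrid (h2 n)).trans ?_
      gcongr
      exact hK n ω hω
    refine ne_top_of_le_ne_top ?_ (lintegral_mono_ae hall)
    have hsm : Measurable fun ω => ∑ m', cnt m' ω := Finset.measurable_fun_sum _ fun m' _ => hcm m'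
    rw [lintegral_add_left measurable_const, lintegral_const_mul' _ _ ENNReal.coe_ne_top,
      lintegral_add_left hVm, lintegral_const_mul' _ _ hK₁, lintegral_add_left measurable_const,
      lintegral_finsetSum _ fun m' _ => hcm m', lintegral_const, lintegral_const]
    have hμ : (Pr.restrict A) univ ≠ ⊤ := measure_ne_top _ _
    have hvol : volume (Ioc a b) ≠ ⊤ := by simp
    have hV' : ∫⁻ ω in A, V ω ∂Pr ≠ ⊤ := ne_top_of_le_ne_top hVi (setLIntegral_le_lintegral _ _)
    have hs : ∑ m', ∫⁻ ω in A, cnt m' ω ∂Pr ≠ ⊤ := ENNReal.sum_ne_top.2 fun m' _ => hci m'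
    finiteness

theorem measurable_absMemory {S : M → Set ℝ} (hS : ∀ m, (S m).Countable) (W : P → ℤ → Option ℝ)
    (α : M ⊕ P) : Measurable fun t => absMemory 𝔐 G S W α t := by
  refine (Finset.measurable_fun_sum _ fun m' _ =>
    measurable_tsum_inter_Iio (hS m') (𝔐.h_measurable _ _)).add
    (Finset.measurable_fun_sum _ fun p _ => ?_)
  simp_rw [tsum_chain_eq G p (𝔐.h α (.inr p)) (fun j => 𝔐.mask α p (W p j))]
  exact Measurable.tsum fun j => (measurable_posPart_sub (𝔐.h_measurable _ _) _).mul_const _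

theorem ae_absMemory_ne_top [IsProbabilityMeasure Pr] (hN : N.IsDriving G Pr) (h𝔐 : 𝔐.NoExpl)
    (hC : C.IsIntegrable Pr) : ∀ᵐ ω ∂Pr, ∀ m, ∀ᵐ t ∂(volume.restrict (Ici t₀)),
      absMemory 𝔐 G (fun m => C.node m ω) (fun p j => C.chain p j ω) (.inl m) t ≠ ⊤ := by
  have : ∀ᵐ ω ∂Pr, ∀ m, ∀ L : ℕ, ∫⁻ t in Icc t₀ (t₀ + L),
      absMemory 𝔐 G (fun m => C.node m ω) (fun p j => C.chain p j ω) (.inl m) t ≠ ⊤ := by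
    rw [ae_all_iff]
    intro m
    rw [ae_all_iff]
    intro L
    obtain ⟨V, hVm, hVi, hV⟩ := exists_bound_absMemory hN h𝔐 hC m L
    filter_upwards [hV, ae_lt_top hVm hVi] with ω h1 h2
    exact (h1.trans_lt h2).ne
  filter_upwards [this, ae_node_finite hN hC] with ω hω hfin m
  have hU : Ici t₀ = ⋃ L : ℕ, Icc t₀ (t₀ + L) := by
    ext t
    simp only [mem_Ici, mem_iUnion, mem_Icc, exists_and_left, iff_self_and]
    intro _
    obtain ⟨L, hL⟩ := exists_nat_ge (t - t₀)
    exact ⟨L, by linarith⟩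
  rw [hU, ae_restrict_iUnion_iff]
  intro L
  filter_upwards [ae_lt_top (measurable_absMemory (fun m => countable_of_finite_inter (hfin m)) _ _)
    (hω m L)] with t ht
  exact ht.ne

/-- Between two chain times, the points of the iterates are almost surely finite in number and
eventually constant, on an event where this is so up to the first of these times. -/
theorem ae_eventually_symmDiff_eq_empty [IsProbabilityMeasure Pr] (hN : N.IsDriving G Pr)
    (h𝔐 : 𝔐.NoExpl) (hC : C.IsIntegrable Pr)
    (ha : t₀ ≤ a) (hab : a < b) (hgrid : ∀ p j, G.time p j ∉ Ioo a b)
    (hA : MeasurableSet[N.filt G a] A) {K : ℕ}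
    (hK : ∀ n, ∀ ω ∈ A, size G t₀ a (picard 𝔐 C n) ω ≤ K)
    (hagree : ∀ n ≥ K, ∀ ω ∈ A, AgreeOn G t₀ a (picard 𝔐 C (n + 1)) (picard 𝔐 C n) ω) :
    ∀ᵐ ω ∂Pr, ω ∈ A → (∀ n m, ((picard 𝔐 C n).points m ω ∩ Ioc a b).Finite) ∧
      ∀ᶠ n in Filter.atTop, ∀ m, symmDiff ((picard 𝔐 C (n + 1)).points m ω)
        ((picard 𝔐 C n).points m ω) ∩ Ioc a b = ∅ := by
  have hA' : MeasurableSet A := filt_le hN a A hA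
  have hpred := fun n => (picardData_adapted hN 𝔐 h𝔐 C n).1
  have hE := lintegral_picard_ne_top (𝔐 := 𝔐) hN h𝔐 hC ha hab hgrid hA (K := K)
    (by simpa using hK)
  have hfin : ∀ᵐ ω ∂(Pr.restrict A), ∀ n m, ((picard 𝔐 C n).points m ω ∩ Ioc a b).Finite := by
    rw [ae_all_iff]
    intro n
    rw [ae_all_iff]
    intro m
    have hm := measurable_tsum_symmDiff_picard (C := C) (b := b) hN h𝔐 n 0 m ha
      (g := fun _ => 1) measurable_const
    have hlt : ∀ᵐ ω ∂(Pr.restrict A), ∑' s : ↥(symmDiff ((picard 𝔐 C n).points m ω)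
        ((picard 𝔐 C 0).points m ω) ∩ Ioc a b), (fun _ => 1 : ℝ → ℝ≥0∞) s < ⊤ := by
      refine ae_lt_top hm (ne_top_of_le_ne_top (hE n m)
        ((lintegral_tsum_symmDiff_picard_le hN h𝔐 n 0 m ha hab measurable_const hA).trans ?_))
      simp
    filter_upwards [hlt] with ω hω
    rw [← encard_picard_eq hN ha, ← ENat.toENNReal_top, ENat.toENNReal_lt,
      encard_lt_top_iff] at hω
    exact hω
  choose L hL using fun m => (exists_enorm_le_of_lipschitz (h𝔐.Φnode_lipschitz m)).imp
    fun K h => h.2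
  -- A steep enough weight makes the sum of all entries of the interaction matrix at most one half.
  obtain ⟨c, hc⟩ : ∃ c : ℕ, ∑ m, ∑ m', (L m : ℝ≥0∞) *
      (∫⁻ r, expWeight c r * posPart (𝔐.h (.inl m) (.inl m')) r) ≤ 2⁻¹ := by
    have h1 : Filter.Tendsto (fun c : ℕ => ∑ m, ∑ m', (L m : ℝ≥0∞) *
        (∫⁻ r, expWeight c r * posPart (𝔐.h (.inl m) (.inl m')) r)) Filter.atTop
        (nhds (∑ m : M, ∑ m' : M, (L m : ℝ≥0∞) * 0)) :=
      tendsto_finsetSum _ fun m _ => tendsto_finsetSum _ fun m' _ =>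
        ENNReal.Tendsto.const_mul (lintegral_expWeight_tendsto (𝔐.h_measurable _ _)
          (h𝔐.node_node m m')) (Or.inr ENNReal.coe_ne_top)
    simp only [mul_zero, Finset.sum_const_zero] at h1
    exact (h1.eventually_le_const (u := 2⁻¹) (by simp)).exists
  let θ : M → M → ℝ≥0∞ := fun m m' => (L m : ℝ≥0∞) *
      (∫⁻ r, expWeight c r * posPart (𝔐.h (.inl m) (.inl m')) r)
  let T : ℕ → M → Ω → ℝ≥0∞ := fun n m ω => ∑' s : ↥(symmDiff ((picard 𝔐 C (n + 1)).points m ω)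
      ((picard 𝔐 C n).points m ω) ∩ Ioc a b), expWeight c s
  let u : ℕ → M → ℝ≥0∞ := fun n m => ∫⁻ ω in A, (∫⁻ t in Ioc a b, expWeight c t *
      ‖(picardData 𝔐 C (n + 1)).1 m t ω - (picardData 𝔐 C n).1 m t ω‖ₑ) ∂Pr
  have hTm : ∀ n m, Measurable (T n m) := fun n m =>
    measurable_tsum_symmDiff_picard hN h𝔐 (n + 1) n m ha (measurable_expWeight c)
  have hTu : ∀ n m, ∫⁻ ω in A, T n m ω ∂Pr ≤ u n m := fun n m =>
    lintegral_tsum_symmDiff_picard_le hN h𝔐 (n + 1) n m ha hab (measurable_expWeight c) hA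
  -- Finiteness is essential: the contraction inequality says nothing about infinite distances.
  have hu : ∀ n m, u n m ≠ ⊤ := by
    intro n m
    have h1 : ∀ ω, (∫⁻ t in Ioc a b, expWeight c t *
        ‖(picardData 𝔐 C (n + 1)).1 m t ω - (picardData 𝔐 C n).1 m t ω‖ₑ) ≤
        expWeight c a * ((∫⁻ t in Ioc a b, ‖(picardData 𝔐 C (n + 1)).1 m t ω -
          (picardData 𝔐 C 0).1 m t ω‖ₑ) + ∫⁻ t in Ioc a b, ‖(picardData 𝔐 C n).1 m t ω -
          (picardData 𝔐 C 0).1 m t ω‖ₑ) := by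
      intro ω
      have h2 := setLIntegral_dist_triangle hN (hpred (n + 1) m) (hpred 0 m)
        (l'' := (picardData 𝔐 C n).1 m) (b := b) ha (measurable_const (a := (1 : ℝ≥0∞))) ω
      simp only [one_mul] at h2
      refine le_trans ?_ (mul_le_mul_right h2 _)
      rw [← lintegral_const_mul' _ _ (expWeight_ne_top _ _)]
      refine setLIntegral_mono' measurableSet_Ioc fun t ht => ?_
      gcongr
      exact expWeight_anti c.cast_nonneg ht.1.le
    refine ne_top_of_le_ne_top ?_ (lintegral_mono h1)
    have hm := measurable_setLIntegral_dist hN (hpred (n + 1) m) (hpred 0 m) (b := b) ha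
      (measurable_const (a := (1 : ℝ≥0∞)))
    simp only [one_mul] at hm
    rw [lintegral_const_mul' _ _ (expWeight_ne_top _ _), lintegral_add_left hm]
    exact ENNReal.mul_ne_top (expWeight_ne_top _ _)
      (ENNReal.add_ne_top.2 ⟨hE (n + 1) m, hE n m⟩)
  -- One full turn: the distance of intensities is bounded by the differing points of the previous
  -- iterates, whose mean is bounded by the distance of the previous intensities. It starts at `K`
  -- because the iterates must already agree up to `a`.
  have hrec : ∀ n ≥ K, ∑ m, u (n + 1) m ≤ 2⁻¹ * ∑ m, u n m := by
    intro n hn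
    have h1 : ∀ m, u (n + 1) m ≤ ∑ m', θ m m' * u n m' := by
      intro m
      have h2 : ∀ᵐ ω ∂(Pr.restrict A), (∫⁻ t in Ioc a b, expWeight c t *
          ‖(picardData 𝔐 C (n + 1 + 1)).1 m t ω - (picardData 𝔐 C (n + 1)).1 m t ω‖ₑ) ≤
          ∑ m', θ m m' * T n m' ω := by
        filter_upwards [hfin, ae_restrict_mem hA',
          ae_restrict_of_ae (ae_node_finite hN hC),
          ae_restrict_of_ae (ae_countable_picard (𝔐 := 𝔐) hN hC),
          ae_restrict_of_ae (ae_absMemory_ne_top (𝔐 := 𝔐) hN h𝔐 hC)] with ω h3 h4 h5 h6 h7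
        refine setLIntegral_picard_sub_le ha hgrid (hL m) h6 h5 (fun n' m' => ?_)
          (hagree n hn ω h4) (ae_restrict_of_ae_restrict_of_subset
            (fun t ht => ha.trans ht.1.le) (h7 m))
        have h8 := size_ne_top_iff.1 (ne_top_of_le_ne_top (ENNReal.natCast_ne_top K) (hK n' ω h4))
        refine ((h8 m').union (h3 n' m')).subset ?_
        rw [← inter_union_distrib_left, Icc_union_Ioc_eq_Icc ha hab.le]
      refine (lintegral_mono_ae h2).trans ?_
      rw [lintegral_finsetSum _ fun m' _ => (hTm n m').const_mul _]
      refine Finset.sum_le_sum fun m' _ => ?_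
      rw [lintegral_const_mul _ (hTm n m')]
      gcongr
      exact hTu n m'
    calc ∑ m, u (n + 1) m ≤ ∑ m, ∑ m', θ m m' * ∑ m', u n m' := by
          refine Finset.sum_le_sum fun m _ => (h1 m).trans (Finset.sum_le_sum fun m' _ => ?_)
          gcongr
          exact Finset.single_le_sum (f := fun m' => u n m') (fun _ _ => zero_le)
            (Finset.mem_univ m')
      _ = (∑ m, ∑ m', θ m m') * ∑ m', u n m' := by
          rw [Finset.sum_mul]
          exact Finset.sum_congr rfl fun m _ => by rw [Finset.sum_mul]
      _ ≤ _ := by gcongr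
  have hgeo : ∀ n, ∑ m, u (K + n) m ≤ 2⁻¹ ^ n * ∑ m, u K m := by
    intro n
    induction n with
    | zero => simp
    | succ n ih =>
      refine (hrec (K + n) (Nat.le_add_right _ _)).trans ?_
      rw [pow_succ', mul_assoc]
      gcongr
  have hsum : ∀ m, ∫⁻ ω in A, ∑' n, T (K + n) m ω ∂Pr ≠ ⊤ := by
    intro m
    rw [lintegral_tsum fun n => (hTm _ m).aemeasurable]
    have h1 : ∑' n, ∫⁻ ω in A, T (K + n) m ω ∂Pr ≤ ∑' n : ℕ, 2⁻¹ ^ n * ∑ m, u K m := by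
      refine ENNReal.tsum_le_tsum fun n => (hTu _ m).trans (le_trans ?_ (hgeo n))
      exact Finset.single_le_sum (f := fun m' => u (K + n) m') (fun _ _ => zero_le)
            (Finset.mem_univ m)
    refine ne_top_of_le_ne_top ?_ h1
    rw [ENNReal.tsum_mul_right, ENNReal.tsum_geometric]
    refine ENNReal.mul_ne_top ?_ (ENNReal.sum_ne_top.2 fun m _ => hu K m)
    simp
  have hev : ∀ᵐ ω ∂(Pr.restrict A), ∀ m, ∑' n, T (K + n) m ω < ⊤ := by
    rw [ae_all_iff]
    exact fun m => ae_lt_top (Measurable.tsum fun n => hTm _ m) (hsum m)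
  rw [← ae_restrict_iff' hA']
  filter_upwards [hfin, hev] with ω h1 h2
  refine ⟨h1, ?_⟩
  rw [Filter.eventually_all]
  intro m
  have h3 : Filter.Tendsto (fun n => T (K + n) m ω) Filter.atTop (nhds 0) :=
    ENNReal.tendsto_atTop_zero_of_tsum_ne_top (h2 m).ne
  -- Each differing point in `(a, b]` contributes at least the weight at `b`. Once the weighted sum
  -- is below this value, there is no such point.
  have h4 := h3.eventually_lt_const (pos_iff_ne_zero.2 (expWeight_ne_zero c b))
  obtain ⟨n₀, hn₀⟩ := Filter.eventually_atTop.1 h4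
  refine Filter.eventually_atTop.2 ⟨K + n₀, fun n hn => ?_⟩
  rw [eq_empty_iff_forall_notMem]
  intro s hs
  obtain ⟨k, rfl⟩ := Nat.exists_eq_add_of_le ((Nat.le_add_right _ _).trans hn)
  refine absurd (hn₀ k (by omega)) (not_lt.2 ?_)
  exact (expWeight_anti c.cast_nonneg hs.2.2).trans (ENNReal.le_tsum
    (f := fun s : ↥(symmDiff ((picard 𝔐 C (K + k + 1)).points m ω)
      ((picard 𝔐 C (K + k)).points m ω) ∩ Ioc a b) => expWeight c s) ⟨s, hs⟩)

end Step

/-! ### Stability of the Picard iteration -/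

section Stability

variable {Ω M P : Type*} [Fintype M] [Fintype P] {N : Noise Ω M P} {G : ChainGrid P} {t₀ : ℝ}
  {C : InitialCondition N G t₀} {𝔐 : Params M P} {a b : ℝ} {ω : Ω}

/-- On `[t₀, a]`, the Picard iterates have finitely many points and are eventually constant. -/
def Stable (𝔐 : Params M P) (C : InitialCondition N G t₀) (a : ℝ) (ω : Ω) : Prop :=
  (∀ n m, ((picard 𝔐 C n).points m ω ∩ Icc t₀ a).Finite) ∧
    ∀ᶠ n in Filter.atTop, AgreeOn G t₀ a (picard 𝔐 C (n + 1)) (picard 𝔐 C n) ω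

theorem picard_chain_succ_eq {n n' : ℕ} {p : P} {j : ℤ} (hj : t₀ ≤ G.time p j)
    (hS : ∀ m, (picard 𝔐 C n).points m ω ∩ Iio (G.time p j) =
      (picard 𝔐 C n').points m ω ∩ Iio (G.time p j))
    (hW : ∀ p' j', G.time p' j' < G.time p j →
      (picard 𝔐 C n).chain p' j' ω = (picard 𝔐 C n').chain p' j' ω) :
    (picard 𝔐 C (n + 1)).chain p j ω = (picard 𝔐 C (n' + 1)).chain p j ω := by
  rw [picard_chain_succ n hj, picard_chain_succ n' hj, regMemory_congr hS hW]

theorem picard_inter_Iio (n n' : ℕ) (m : M) : (picard 𝔐 C n).points m ω ∩ Iio t₀ =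
    (picard 𝔐 C n').points m ω ∩ Iio t₀ := by
  rw [picard_points_init, picard_points_init]

/-- Without an atom at `t₀` no iterate has a point there. Chain values at `t₀` see only the initial
condition, so they are constant from index `1` on; index `0` holds a placeholder. -/
theorem stable_self (h : ∀ m, ∀ z ∈ N.π m ω, z.1 ≠ t₀) : Stable 𝔐 C t₀ ω := by
  have hempty : ∀ n m, (picard 𝔐 C n).points m ω ∩ Icc t₀ t₀ = ∅ := by
    intro n m
    rw [Icc_self, eq_empty_iff_forall_notMem]
    rintro s ⟨h1, h2⟩
    rw [mem_singleton_iff] at h2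
    subst h2
    obtain ⟨x, hx, -⟩ := (mem_procOf_points le_rfl).1 h1
    exact h m _ hx rfl
  refine ⟨fun n m => by rw [hempty]; exact finite_empty, ?_⟩
  refine Filter.eventually_atTop.2 ⟨1, fun n hn => ⟨fun m => by rw [hempty, hempty], ?_⟩⟩
  intro p j hj
  obtain ⟨k, rfl⟩ := Nat.exists_eq_add_of_le' hn
  have hj' : G.time p j = t₀ := le_antisymm hj.2 hj.1
  refine picard_chain_succ_eq hj.1 (fun m => ?_) fun p' j' h' => ?_
  · rw [hj']; exact picard_inter_Iio _ _ m
  · rw [hj'] at h'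
    rw [picard_chain_init _ h', picard_chain_init _ h']

/-- Points stabilize by assumption. The only new chain time can be `b`, and its update uses the
strict past, which has already stabilized. -/
theorem Stable.extend (ha : t₀ ≤ a) (hab : a < b) (hgrid : ∀ p j, G.time p j ∉ Ioo a b)
    (h : Stable 𝔐 C a ω) (hfin : ∀ n m, ((picard 𝔐 C n).points m ω ∩ Ioc a b).Finite)
    (hev : ∀ᶠ n in Filter.atTop, ∀ m, symmDiff ((picard 𝔐 C (n + 1)).points m ω)
        ((picard 𝔐 C n).points m ω) ∩ Ioc a b = ∅) : Stable 𝔐 C b ω := by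
  refine ⟨fun n m => ?_, ?_⟩
  · rw [← Icc_union_Ioc_eq_Icc ha hab.le, inter_union_distrib_left]
    exact (h.1 n m).union (hfin n m)
  · obtain ⟨k, hk⟩ := Filter.eventually_atTop.1 (h.2.and hev)
    have hpts : ∀ n ≥ k, ∀ m, (picard 𝔐 C (n + 1)).points m ω ∩ Iic b =
        (picard 𝔐 C n).points m ω ∩ Iic b := fun n hn m =>
      inter_Iic_eq_of_Icc (picard_inter_Iio _ _ m) ((hk n hn).1.1 m) ((hk n hn).2 m) le_rfl
    -- A chain value of iterate `n + 1` is computed from iterate `n`, whence one extra step.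
    refine Filter.eventually_atTop.2 ⟨k + 1, fun n hn => ⟨fun m => ?_, fun p j hj => ?_⟩⟩
    · have h1 := hpts n (by omega) m
      rw [← Iic_inter_Ici, ← inter_assoc, ← inter_assoc, h1]
    · rcases le_or_gt (G.time p j) a with h' | h'
      · exact (hk n (by omega)).1.2 p j ⟨hj.1, h'⟩
      · have hjb : G.time p j = b := by
          refine le_antisymm hj.2 (not_lt.1 fun h'' => hgrid p j ⟨h', h''⟩)
        obtain ⟨n, rfl⟩ : ∃ l, n = l + 1 := ⟨n - 1, by omega⟩
        refine picard_chain_succ_eq hj.1 (fun m => ?_) fun p' j' hj' => ?_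
        · have h1 := hpts n (by omega) m
          rw [hjb, ← inter_eq_right.2 (Iio_subset_Iic_self (a := b)), ← inter_assoc,
            ← inter_assoc, h1]
        · rcases lt_or_ge (G.time p' j') t₀ with h0 | h0
          · rw [picard_chain_init _ h0, picard_chain_init _ h0]
          · refine (hk n (by omega)).1.2 p' j' ⟨h0, ?_⟩
            rw [hjb] at hj'
            exact not_lt.1 fun h'' => hgrid p' j' ⟨h'', hj'⟩

/-- Makes stability quantitative with a single integer: finitely many sizes before stabilization, a
constant size afterwards. The stable event is thus covered by countably many events on which the
mean estimates apply. -/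
theorem Stable.exists_bound (h : Stable 𝔐 C a ω) : ∃ K : ℕ,
    (∀ n, size G t₀ a (picard 𝔐 C n) ω ≤ K) ∧
      ∀ n ≥ K, AgreeOn G t₀ a (picard 𝔐 C (n + 1)) (picard 𝔐 C n) ω := by
  obtain ⟨k, hk⟩ := Filter.eventually_atTop.1 h.2
  have hne : ∑ n ∈ Finset.range (k + 1), size G t₀ a (picard 𝔐 C n) ω ≠ ⊤ :=
    ENNReal.sum_ne_top.2 fun n _ => size_ne_top_iff.2 (h.1 n)
  obtain ⟨K, hK⟩ := ENNReal.exists_nat_gt hne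
  have hsmall : ∀ n ≤ k, size G t₀ a (picard 𝔐 C n) ω ≤ K := fun n hn =>
    (Finset.single_le_sum (f := fun n => size G t₀ a (picard 𝔐 C n) ω) (fun _ _ => zero_le)
      (Finset.mem_range.2 (Nat.lt_succ_of_le hn))).trans hK.le
  have hbig : ∀ n, size G t₀ a (picard 𝔐 C (k + n)) ω ≤ K := by
    intro n
    induction n with
    | zero => exact hsmall k le_rfl
    | succ n ih => rwa [← add_assoc, (hk (k + n) (by omega)).size_eq]
  refine ⟨max K k, fun n => ?_, fun n hn => hk n ((le_max_right _ _).trans hn)⟩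
  refine le_trans ?_ (Nat.cast_le.2 (le_max_left K k))
  rcases le_total n k with hn | hn
  · exact hsmall n hn
  · obtain ⟨l, rfl⟩ := Nat.exists_eq_add_of_le hn
    exact hbig l

variable [mΩ : MeasurableSpace Ω] {Pr : Measure Ω}

/-- The events `A K` lie in `𝓕_a`, so the contraction can be run on each of them separately, without
integrability of the whole past. -/
theorem ae_stable_extend [IsProbabilityMeasure Pr] (hN : N.IsDriving G Pr) (h𝔐 : 𝔐.NoExpl)
    (hC : C.IsIntegrable Pr) (ha : t₀ ≤ a) (hab : a < b) (hgrid : ∀ p j, G.time p j ∉ Ioo a b)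
    (h : ∀ᵐ ω ∂Pr, Stable 𝔐 C a ω) : ∀ᵐ ω ∂Pr, Stable 𝔐 C b ω := by
  let A : ℕ → Set Ω := fun K => {ω | (∀ n, size G t₀ a (picard 𝔐 C n) ω ≤ K) ∧
      ∀ n ≥ K, AgreeOn G t₀ a (picard 𝔐 C (n + 1)) (picard 𝔐 C n) ω}
  have had := fun n => picardData_adapted hN 𝔐 h𝔐 C n
  have hA : ∀ K, MeasurableSet[N.filt G a] (A K) := by
    intro K
    have e : A K = (⋂ n, {ω | size G t₀ a (picard 𝔐 C n) ω ≤ K}) ∩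
        ⋂ n, ⋂ (_ : n ≥ K), {ω | AgreeOn G t₀ a (picard 𝔐 C (n + 1)) (picard 𝔐 C n) ω} := by
      ext ω; simp [A]
    rw [e]
    refine @MeasurableSet.inter _ (N.filt G a) _ _ (MeasurableSet.iInter fun n => ?_)
      (MeasurableSet.iInter fun n => MeasurableSet.iInter fun _ => ?_)
    · exact (isCausal_procOf hN (had n).1 (had n).2).measurable_size ha measurableSet_Iic
    · have : Countable M := Finite.to_countable
      have : Countable P := Finite.to_countable
      exact measurableSet_agreeOn hN (had (n + 1)).1 (had (n + 1)).2 (had n).1 (had n).2 a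
  have hstep : ∀ᵐ ω ∂Pr, ∀ K, ω ∈ A K →
      (∀ n m, ((picard 𝔐 C n).points m ω ∩ Ioc a b).Finite) ∧
      ∀ᶠ n in Filter.atTop, ∀ m, symmDiff ((picard 𝔐 C (n + 1)).points m ω)
        ((picard 𝔐 C n).points m ω) ∩ Ioc a b = ∅ := by
    rw [ae_all_iff]
    exact fun K => ae_eventually_symmDiff_eq_empty hN h𝔐 hC ha hab hgrid (hA K)
      (fun n ω hω => hω.1 n) fun n hn ω hω => hω.2 n hn
  filter_upwards [h, hstep] with ω h1 h2
  obtain ⟨K, hK⟩ := h1.exists_bound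
  obtain ⟨h3, h4⟩ := h2 K hK
  exact h1.extend ha hab hgrid h3 h4

theorem ae_stable_self [IsProbabilityMeasure Pr] (hN : N.IsDriving G Pr) :
    ∀ᵐ ω ∂Pr, Stable 𝔐 C t₀ ω := by
  have hE : MeasurableSet[N.predictable G] ({z | z.1 = t₀} : Set (ℝ × Ω)) :=
    measurable_fst_predictable (measurableSet_singleton t₀)
  have h0 : ((volume : Measure ℝ).prod Pr) {z | z.1 = t₀} = 0 := by
    have : ({z | z.1 = t₀} : Set (ℝ × Ω)) = {t₀} ×ˢ univ := by ext z; simp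
    rw [this, Measure.prod_prod, Real.volume_singleton, zero_mul]
  have : Countable M := Finite.to_countable
  filter_upwards [ae_all_iff.2 fun m => ae_forall_notMem_of_null hN m hE h0] with ω hω
  exact stable_self fun m z hz h => hω m z hz h

/-- Strong induction on the number of chain times in `[t₀, b)`. The last of them, `a`, has fewer
chain times before it, and no chain time lies strictly between `a` and `b`. -/
theorem ae_stable [IsProbabilityMeasure Pr] (hN : N.IsDriving G Pr) (h𝔐 : 𝔐.NoExpl)
    (hC : C.IsIntegrable Pr) (hT : t₀ ≤ b) : ∀ᵐ ω ∂Pr, Stable 𝔐 C b ω := by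
  let J : ℝ → Set ℝ := fun T => ⋃ p, G.time p '' {j | G.time p j ∈ Ico t₀ T}
  have hJ : ∀ T, (J T).Finite := fun T => finite_iUnion fun p =>
    ((G.finite_time_mem_Icc p t₀ T).subset fun j hj => ⟨hj.1, hj.2.le⟩).image _
  have hmem : ∀ T s, s ∈ J T ↔ ∃ p j, G.time p j = s ∧ s ∈ Ico t₀ T := by
    intro T s
    simp only [J, mem_iUnion, mem_image, mem_ofPred_eq]
    refine exists_congr fun p => exists_congr fun j => ?_
    constructor
    · rintro ⟨h1, rfl⟩; exact ⟨rfl, h1⟩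
    · rintro ⟨rfl, h1⟩; exact ⟨h1, rfl⟩
  induction hk : (J b).ncard using Nat.strong_induction_on generalizing b with
  | _ k ih =>
    rcases hT.eq_or_lt with rfl | hT'
    · exact ae_stable_self hN
    rcases (J b).eq_empty_or_nonempty with he | hne
    · refine ae_stable_extend hN h𝔐 hC le_rfl hT' (fun p j hj => ?_) (ae_stable_self hN)
      have : G.time p j ∈ J b := (hmem _ _).2 ⟨p, j, rfl, hj.1.le, hj.2⟩
      rw [he] at this
      exact this
    · obtain ⟨a, haJ, hmax⟩ := exists_max_image (J b) id (hJ b) hne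
      obtain ⟨-, -, -, ha0, hab⟩ := (hmem _ _).1 haJ
      refine ae_stable_extend hN h𝔐 hC ha0 hab (fun p j hj => ?_) (ih (J a).ncard ?_ ha0 rfl)
      · exact absurd (hmax _ ((hmem _ _).2 ⟨p, j, rfl, ha0.trans hj.1.le, hj.2⟩)) (not_le.2 hj.1)
      · rw [← hk]
        refine ncard_lt_ncard ⟨fun s hs => ?_, fun h => ?_⟩ (hJ b)
        · obtain ⟨p, j, h1, h2⟩ := (hmem _ _).1 hs
          exact (hmem _ _).2 ⟨p, j, h1, h2.1, h2.2.trans hab⟩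
        · obtain ⟨-, -, -, h1⟩ := (hmem _ _).1 (h haJ)
          exact lt_irrefl _ h1.2

end Stability

/-! ### Existence -/

section Limit

variable {Ω M P : Type*} [Fintype M] [Fintype P] {N : Noise Ω M P} {G : ChainGrid P} {t₀ : ℝ}
  {C : InitialCondition N G t₀} {𝔐 : Params M P} {a : ℝ} {ω : Ω}

/-- The limit of the Picard iterates. -/
def picardLimit (𝔐 : Params M P) (C : InitialCondition N G t₀) : Proc Ω M P :=
  -- The limsup is defined for every realization and preserves predictability; where the iterates
  -- are stable it is their eventual value.
  procOf C (fun m t ω => Filter.limsup (fun n => (picardData 𝔐 C n).1 m t ω) Filter.atTop)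
    (fun p j ω => Filter.limsup (fun n => (picardData 𝔐 C n).2 p j ω) Filter.atTop)

theorem AgreeOn.regMemory_eq {X Y : Proc Ω M P} (h : AgreeOn G t₀ a X Y ω)
    (hS : ∀ m, X.points m ω ∩ Iio t₀ = Y.points m ω ∩ Iio t₀)
    (hW : ∀ p j, G.time p j < t₀ → X.chain p j ω = Y.chain p j ω) (α : M ⊕ P) {t : ℝ}
    (ht : t ≤ a) : regMemory 𝔐 G t₀ X α t ω = regMemory 𝔐 G t₀ Y α t ω := by
  refine regMemory_congr (fun m => ?_) fun p j hj => ?_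
  · have h1 : X.points m ω ∩ Iic a = Y.points m ω ∩ Iic a :=
      inter_Iic_eq_of_Icc (hS m) (h.1 m) (by simp) le_rfl
    rw [← inter_eq_right.2 (show Iio t ⊆ Iic a from fun s hs => (mem_Iio.1 hs).le.trans ht),
      ← inter_assoc, ← inter_assoc, h1]
  · rcases lt_or_ge (G.time p j) t₀ with h0 | h0
    · exact hW p j h0
    · exact h.2 p j ⟨h0, hj.le.trans ht⟩

theorem limsup_eq_of_eventually {u : ℕ → ℝ} {x : ℝ} {k : ℕ} (h : ∀ n ≥ k, u n = x) :
    Filter.limsup u Filter.atTop = x := by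
  have : u =ᶠ[Filter.atTop] fun _ => x := Filter.eventually_atTop.2 ⟨k, h⟩
  rw [Filter.limsup_congr this, Filter.limsup_const]

/-- Where the iterates are stable, the limit solves the equations with the regularized memory. -/
theorem Stable.picardLimit_eq (h : Stable 𝔐 C a ω) :
    (∀ m, ((picardLimit 𝔐 C).points m ω ∩ Icc t₀ a).Finite) ∧
    (∀ m, ∀ t ∈ Icc t₀ a, (picardLimit 𝔐 C).intensity m t ω = 𝔐.Φnode m (𝔐.μ m +
      regMemory 𝔐 G t₀ (picardLimit 𝔐 C) (.inl m) t ω)) ∧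
    ∀ p j, G.time p j ∈ Icc t₀ a → (picardLimit 𝔐 C).chain p j ω =
      some (N.ξ p j ω + 𝔐.Φchain p
        (regMemory 𝔐 G t₀ (picardLimit 𝔐 C) (.inr p) (G.time p j) ω)) := by
  obtain ⟨k, hk⟩ := Filter.eventually_atTop.1 h.2
  have hagree : ∀ n, AgreeOn G t₀ a (picard 𝔐 C (k + n)) (picard 𝔐 C k) ω := by
    intro n
    induction n with
    | zero => exact ⟨fun _ => rfl, fun _ _ _ => rfl⟩
    | succ n ih => exact (hk (k + n) (Nat.le_add_right _ _)).trans ih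
  have hreg : ∀ n α, ∀ t ≤ a, regMemory 𝔐 G t₀ (picard 𝔐 C (k + n)) α t ω =
      regMemory 𝔐 G t₀ (picard 𝔐 C k) α t ω := fun n α t ht =>
    (hagree n).regMemory_eq (fun m => picard_inter_Iio _ _ m)
      (fun p j hj => by rw [picard_chain_init _ hj, picard_chain_init _ hj]) α ht
  have hlam : ∀ m, ∀ t ∈ Icc t₀ a, (picardLimit 𝔐 C).intensity m t ω =
      (picardData 𝔐 C (k + 1)).1 m t ω := by
    intro m t ht
    refine limsup_eq_of_eventually (k := k + 1) fun n hn => ?_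
    obtain ⟨l, rfl⟩ := Nat.exists_eq_add_of_le hn
    rw [add_right_comm, picard_intensity_succ, picard_intensity_succ, hreg l _ t ht.2]
  have hw : ∀ p j, G.time p j ∈ Icc t₀ a → (picardLimit 𝔐 C).chain p j ω =
      (picard 𝔐 C (k + 1)).chain p j ω := by
    intro p j hj
    rw [picardLimit, procOf_chain_of_le hj.1, picard_chain_succ _ hj.1, Option.some_inj]
    refine limsup_eq_of_eventually (k := k + 1) fun n hn => ?_
    obtain ⟨l, rfl⟩ := Nat.exists_eq_add_of_le hn
    rw [add_right_comm, ← hreg l _ _ hj.2]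
    rfl
  -- The points of the limit are the thinning by the limiting intensity, which on `[t₀, a]` is
  -- exactly that of iterate `k + 1`.
  have hlim : AgreeOn G t₀ a (picardLimit 𝔐 C) (picard 𝔐 C (k + 1)) ω := by
    refine ⟨fun m => ?_, hw⟩
    ext s
    simp only [mem_inter_iff]
    refine and_congr_left fun hs => ?_
    rw [picardLimit, picard, mem_procOf_points hs.1, mem_procOf_points hs.1]
    refine exists_congr fun x => and_congr_right fun _ => ?_
    rw [← hlam m s hs]
    rfl
  have hlim' : AgreeOn G t₀ a (picardLimit 𝔐 C) (picard 𝔐 C k) ω := hlim.trans (hagree 1)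
  have hreg' : ∀ α, ∀ t ≤ a, regMemory 𝔐 G t₀ (picardLimit 𝔐 C) α t ω =
      regMemory 𝔐 G t₀ (picard 𝔐 C k) α t ω := fun α t ht =>
    hlim'.regMemory_eq (fun m => (procOf_points_init m ω).trans (procOf_points_init m ω).symm)
      (fun p j hj => (procOf_chain_of_lt hj ω).trans (procOf_chain_of_lt hj ω).symm) α ht
  refine ⟨fun m => ?_, fun m t ht => ?_, fun p j hj => ?_⟩
  · rw [hlim'.1 m]
    exact h.1 k m
  · rw [hlam m t ht, picard_intensity_succ, hreg' _ t ht.2]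
  · rw [hw p j hj, picard_chain_succ _ hj.1, hreg' _ _ hj.2]

variable [mΩ : MeasurableSpace Ω] {Pr : Measure Ω}

theorem picardLimit_adapted (hN : N.IsDriving G Pr) (h𝔐 : 𝔐.NoExpl)
    (C : InitialCondition N G t₀) :
    (∀ m, PredictableFrom N G t₀ ((picardLimit 𝔐 C).intensity m)) ∧
      IsCausal C (picardLimit 𝔐 C) := by
  have had := fun n => picardData_adapted hN 𝔐 h𝔐 C n
  have h1 : ∀ m, PredictableFrom N G t₀ ((picardLimit 𝔐 C).intensity m) := by
    intro m
    have e : (fun z : ℝ × Ω => (Ici t₀).indicator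
        (fun t => (picardLimit 𝔐 C).intensity m t z.2) z.1) = fun z => Filter.limsup (fun n =>
        (Ici t₀).indicator (fun t => (picardData 𝔐 C n).1 m t z.2) z.1) Filter.atTop := by
      ext z
      by_cases hz : z.1 ∈ Ici t₀
      · simp only [indicator_of_mem hz]
        rfl
      · simp only [indicator_of_notMem hz, Filter.limsup_const]
    rw [PredictableFrom, e]
    exact Measurable.limsup fun n => (had n).1 m
  refine ⟨h1, isCausal_procOf hN h1 fun p j hj => ?_⟩
  exact Measurable.limsup fun n => (had n).2 p j hj

theorem ae_forall_stable [IsProbabilityMeasure Pr] (hN : N.IsDriving G Pr) (h𝔐 : 𝔐.NoExpl)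
    (hC : C.IsIntegrable Pr) : ∀ᵐ ω ∂Pr, ∀ L : ℕ, Stable 𝔐 C (t₀ + L) ω :=
  ae_all_iff.2 fun L => ae_stable hN h𝔐 hC (le_add_of_nonneg_right L.cast_nonneg)

/-- Passing from almost every time for almost every realization to the product measure requires
joint measurability. It is obtained by discarding the initial points on the null event where they
are not locally finite. -/
theorem ae_prod_absMemory_ne_top [IsProbabilityMeasure Pr] (hN : N.IsDriving G Pr)
    (h𝔐 : 𝔐.NoExpl) (hC : C.IsIntegrable Pr) (m : M) :
    ∀ᵐ z ∂(Pr.prod (volume.restrict (Ici t₀))),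
      absMemory 𝔐 G (fun m => C.node m z.1) (fun p j => C.chain p j z.1) (.inl m) z.2 ≠ ⊤ := by
  classical
  have hcount : Countable M := Finite.to_countable
  let good : Set Ω := ⋂ m, ⋂ n : ℕ, {ω | (count (C.node m) (Icc (-n : ℝ) n) ω : ℝ≥0∞) = ⊤}ᶜ
  have hgood : MeasurableSet good := MeasurableSet.iInter fun m => MeasurableSet.iInter fun n =>
    (measurable_count_node hN C m measurableSet_Icc (measurableSet_singleton ⊤)).compl
  let S : M → Ω → Set ℝ := fun m ω => if ω ∈ good then C.node m ω else ∅
  have hae : ∀ᵐ ω ∂Pr, ω ∈ good := by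
    filter_upwards [ae_node_finite hN hC] with ω hω
    simp only [good, mem_iInter, mem_compl_iff, mem_ofPred_eq]
    intro m n
    rw [← ENat.toENNReal_top, ENat.toENNReal_inj, count, encard_eq_top_iff, not_infinite]
    exact hω m _ _
  have hS : ∀ ω ∈ good, (fun m => S m ω) = fun m => C.node m ω := fun ω hω => by
    ext m : 1
    exact if_pos hω
  have hmeas : Measurable fun z : Ω × ℝ =>
      absMemory 𝔐 G (fun m => S m z.1) (fun p j => C.chain p j z.1) (.inl m) z.2 := by
    refine (Finset.measurable_fun_sum _ fun m' _ => ?_).add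
      (Finset.measurable_fun_sum _ fun p _ => ?_)
    · simp_rw [tsum_inter_Iio_eq]
      refine measurable_tsum_randomSet (A := fun z : Ω × ℝ => S m' z.1) (fun B hB => ?_)
        (D := fun n : ℕ => Icc (-n : ℝ) n) (fun n => measurableSet_Icc) ?_ (fun z n => ?_)
        (g := fun z => posPart (𝔐.h (.inl m) (.inl m')) (z.1.2 - z.2)) ?_
      · rw [measurable_enat_iff]
        have e : (fun z : Ω × ℝ => (count (fun z : Ω × ℝ => S m' z.1) B z : ℝ≥0∞)) =
            fun z => good.indicator (fun ω => (count (C.node m') B ω : ℝ≥0∞)) z.1 := by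
          ext z
          by_cases hz : z.1 ∈ good
          · rw [indicator_of_mem hz]; simp only [count, S, if_pos hz]
          · rw [indicator_of_notMem hz]; simp [count, S, if_neg hz]
        rw [e]
        exact ((measurable_count_node hN C m' hB).indicator hgood).comp measurable_fst
      · refine eq_univ_of_forall fun x => ?_
        obtain ⟨n, hn⟩ := exists_nat_ge |x|
        exact mem_iUnion.2 ⟨n, abs_le.1 hn⟩
      · by_cases hz : z.1 ∈ good
        · have h1 := hz
          simp only [good, mem_iInter, mem_compl_iff, mem_ofPred_eq] at h1
          have h2 := h1 m' n
          rw [← ENat.toENNReal_top, ENat.toENNReal_inj] at h2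
          simpa only [count, S, if_pos hz] using h2
        · simp [count, S, if_neg hz]
      · exact (measurable_posPart (𝔐.h_measurable _ _)).comp
          ((measurable_snd.comp measurable_fst).sub measurable_snd)
    · have e := fun z : Ω × ℝ => tsum_chain_eq G p (𝔐.h (.inl m) (.inr p))
        (fun j => 𝔐.mask (.inl m) p (C.chain p j z.1)) z.2
      simp_rw [e]
      refine Measurable.tsum fun j => Measurable.mul ?_ ?_
      · exact (measurable_posPart_sub (𝔐.h_measurable _ _) _).comp measurable_snd
      · exact ((measurable_mask (C.chain_measurable p j) (.inl m) p).mono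
          (filtLeft_le_ambient hN) le_rfl).enorm.comp measurable_fst
  have h1 : ∀ᵐ z ∂(Pr.prod (volume.restrict (Ici t₀))),
      absMemory 𝔐 G (fun m => S m z.1) (fun p j => C.chain p j z.1) (.inl m) z.2 ≠ ⊤ := by
    refine (Measure.ae_prod_iff_ae_ae (p := fun z : Ω × ℝ => absMemory 𝔐 G (fun m => S m z.1)
      (fun p j => C.chain p j z.1) (.inl m) z.2 ≠ ⊤)
      (hmeas (measurableSet_singleton ⊤)).compl).2 ?_
    filter_upwards [ae_absMemory_ne_top (𝔐 := 𝔐) hN h𝔐 hC, hae] with ω h2 h3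
    simp only [hS ω h3]
    exact h2 m
  filter_upwards [h1, Measure.quasiMeasurePreserving_fst.ae hae] with z h2 h3
  rwa [hS z.1 h3] at h2

/-- Stability up to every integer horizon gives the equations at all times. The hypothesis on the
initial condition enters only in the convergence part of the chain equations. -/
theorem isHAR_picardLimit [IsProbabilityMeasure Pr] (hN : N.IsDriving G Pr) (h𝔐 : 𝔐.NoExpl)
    (hC : C.IsIntegrable Pr) (hconv : C.ChainMemoryConverges 𝔐 Pr) :
    IsHAR Pr G N 𝔐 t₀ C (picardLimit 𝔐 C) ∧ (picardLimit 𝔐 C).NonExploding Pr := by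
  obtain ⟨hpred, hcausal⟩ := picardLimit_adapted hN h𝔐 C
  have hsol : ∀ᵐ ω ∂Pr, (∀ m a, ((picardLimit 𝔐 C).points m ω ∩ Icc t₀ a).Finite) ∧
      (∀ m t, t₀ ≤ t → (picardLimit 𝔐 C).intensity m t ω = 𝔐.Φnode m (𝔐.μ m +
        memory 𝔐 G (fun m => (picardLimit 𝔐 C).points m ω)
          (fun p j => (picardLimit 𝔐 C).chain p j ω) (.inl m) t)) ∧
      ∀ p j, t₀ ≤ G.time p j → (picardLimit 𝔐 C).chain p j ω =
        some (N.ξ p j ω + 𝔐.Φchain p (memory 𝔐 G (fun m => (picardLimit 𝔐 C).points m ω)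
          (fun p j => (picardLimit 𝔐 C).chain p j ω) (.inr p) (G.time p j))) := by
    filter_upwards [ae_forall_stable (𝔐 := 𝔐) hN h𝔐 hC, ae_node_finite hN hC] with ω h1 h2
    have hL : ∀ t : ℝ, ∃ L : ℕ, t ≤ t₀ + L := fun t => by
      obtain ⟨L, hL⟩ := exists_nat_ge (t - t₀)
      exact ⟨L, by linarith⟩
    have hfin : ∀ m a, ((picardLimit 𝔐 C).points m ω ∩ Icc t₀ a).Finite := by
      intro m a
      obtain ⟨L, hL⟩ := hL a
      exact ((h1 L).picardLimit_eq.1 m).subset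
        (inter_subset_inter_right _ (Icc_subset_Icc_right hL))
    have hreg : ∀ α t, t₀ ≤ t → regMemory 𝔐 G t₀ (picardLimit 𝔐 C) α t ω =
        memory 𝔐 G (fun m => (picardLimit 𝔐 C).points m ω)
          (fun p j => (picardLimit 𝔐 C).chain p j ω) α t := fun α t ht =>
      if_pos ⟨ht, locFinBefore_of_finite (fun m => hcausal.points_init m ω) h2 fun m =>
        (hfin m t).subset (inter_subset_inter_right _ Ico_subset_Icc_self)⟩
    refine ⟨hfin, fun m t ht => ?_, fun p j hj => ?_⟩
    · obtain ⟨L, hL⟩ := hL t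
      rw [← hreg _ _ ht]
      exact (h1 L).picardLimit_eq.2.1 m t ⟨ht, hL⟩
    · obtain ⟨L, hL⟩ := hL (G.time p j)
      rw [← hreg _ _ hj]
      exact (h1 L).picardLimit_eq.2.2 p j ⟨hj, hL⟩
  have hmc : ∀ ω, (∀ m a, ((picardLimit 𝔐 C).points m ω ∩ Icc t₀ a).Finite) → ∀ α t,
      absMemory 𝔐 G (fun m => C.node m ω) (fun p j => C.chain p j ω) α t ≠ ⊤ →
      MemoryConverges 𝔐 G (fun m => (picardLimit 𝔐 C).points m ω)
        (fun p j => (picardLimit 𝔐 C).chain p j ω) α t := fun ω hfin α t ht =>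
    memoryConverges_of_initial (fun m => hcausal.points_init m ω)
      (fun p j hj => hcausal.chain_init p j ω hj) ht fun m =>
        (hfin m t).subset (inter_subset_inter_right _ Ico_subset_Icc_self)
  refine ⟨⟨fun ω m m' h => procOf_points_disjoint hN ω m m' h, hcausal.points_adapted,
    hcausal.chain_adapted, hpred, hcausal.points_init, hcausal.chain_init, fun m => ?_,
    Filter.Eventually.of_forall fun ω m B hB => procOf_points_eq hN ω m hB, ?_⟩, ?_⟩
  · have ht : ∀ᵐ z ∂(Pr.prod (volume.restrict (Ici t₀))), z.2 ∈ Ici t₀ :=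
      Measure.quasiMeasurePreserving_snd.ae (ae_restrict_mem measurableSet_Ici)
    filter_upwards [ae_prod_absMemory_ne_top (𝔐 := 𝔐) hN h𝔐 hC m,
      Measure.quasiMeasurePreserving_fst.ae hsol, ht] with z h1 h2 h3
    exact ⟨hmc z.1 h2.1 _ _ h1, h2.2.1 m z.2 h3⟩
  · have hcv : ∀ᵐ ω ∂Pr, ∀ p j, t₀ ≤ G.time p j →
        MemoryConverges 𝔐 G (fun m => C.node m ω) (fun p' j' => C.chain p' j' ω) (.inr p)
          (G.time p j) := by
      have : Countable P := Finite.to_countable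
      simp_rw [ae_all_iff]
      exact hconv
    filter_upwards [hcv, hsol] with ω h1 h2 p j hj
    exact ⟨hmc ω h2.1 _ _ (memoryConverges_iff.1 (h1 p j hj)), h2.2.2 p j hj⟩
  · filter_upwards [hsol, ae_node_finite hN hC] with ω h1 h2 m B hB
    obtain ⟨r, hr⟩ := hB.subset_closedBall 0
    rw [Real.closedBall_eq_Icc] at hr
    refine ((h2 m (0 - r) (0 + r)).union (h1.1 m (0 + r))).subset ?_
    rintro s ⟨h3, h4⟩
    rcases lt_or_ge s t₀ with h | h
    · left
      rw [← hcausal.points_init m ω]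
      exact ⟨⟨h3, h⟩, hr h4⟩
    · exact Or.inr ⟨h3, h, (hr h4).2⟩

/-- The memory of the initial condition is a subsum of that of the process: its points are among
those of `X`, and its chains are `∅` from `t₀` on, where the mask vanishes. -/
theorem IsHAR.chainMemoryConverges {X : Proc Ω M P} (hX : IsHAR Pr G N 𝔐 t₀ C X) :
    C.ChainMemoryConverges 𝔐 Pr := by
  intro p j hj
  filter_upwards [hX.chain_eq] with ω hω
  have h := memoryConverges_iff.1 (hω p j hj).1
  refine memoryConverges_iff.2 (ne_top_of_le_ne_top h (add_le_add
    (Finset.sum_le_sum fun m _ => ?_) (Finset.sum_le_sum fun p' _ =>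
      ENNReal.tsum_le_tsum fun j' => ?_)))
  · refine ENNReal.tsum_mono_subtype (fun s => ‖𝔐.h (.inr p) (.inl m) (G.time p j - s)‖ₑ)
      (inter_subset_inter_left _ ?_)
    simp only
    rw [← hX.points_init m ω]
    exact inter_subset_left
  · simp only
    rcases lt_or_ge (G.time p' j') t₀ with h0 | h0
    · rw [hX.chain_init p' j' ω h0]
    · rw [C.chain_eq_none p' j' ω h0]
      simp [Params.mask]

end Limit

end HAR

end

theorem theorem3p4 {Ω M P : Type*} [MeasurableSpace Ω] [Fintype M] [Fintype P]
    (Pr : Measure Ω) [IsProbabilityMeasure Pr]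
    (G : HAR.ChainGrid P) (N : HAR.Noise Ω M P) (hN : N.IsDriving G Pr)
    (𝔐 : HAR.Params M P) (h𝔐 : 𝔐.NoExpl)
    (t₀ : ℝ) (C : HAR.InitialCondition N G t₀) (hC : C.IsIntegrable Pr) :
    ((∃ X : HAR.Proc Ω M P, HAR.IsHAR Pr G N 𝔐 t₀ C X ∧ X.NonExploding Pr) ↔
      C.ChainMemoryConverges 𝔐 Pr) ∧
    ∀ X Y : HAR.Proc Ω M P,
      HAR.IsHAR Pr G N 𝔐 t₀ C X → X.NonExploding Pr →
      HAR.IsHAR Pr G N 𝔐 t₀ C Y → Y.NonExploding Pr →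
      HAR.IsModification Pr t₀ X Y :=
  ⟨⟨fun ⟨_, hX, _⟩ => hX.chainMemoryConverges,
    fun h => ⟨HAR.picardLimit 𝔐 C, HAR.isHAR_picardLimit hN h𝔐 hC h⟩⟩,
    fun _ _ hX hXe hY hYe => hX.isModification hN hXe hY hYe⟩
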